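/- Let $S$ be a smooth ($C^\infty$) surface immersed in real affine $3$-space. Its elliptic and hyperbolic domains are the sets where the Gaussian curvature is positive, respectively negative; a parabolic point is a point with a unique (double) asymptotic direction. Let $g\in S$ be a godron, i.e. a parabolic point near which the parabolic curve $P$ is regular (the determinant of the second fundamental form has non-zero differential at $g$) and at which the asymptotic direction is tangent to $P$. Let $F$ be the flecnodal curve (the points at which an asymptotic line has more than $3$-point contact with $S$) and let $D$ be the local conodal curve (the closure of the set of points of contact of the planes tangent, at two distinct points at least, to a small neighbourhood of $g$ in $S$). Let $\rho=\rho(g)$ be the cr-invariant of $g$: the germs of $F,P,D$ at $g$ being smooth curves tangent to one another at $g$, $\rho$ is the cross-ratio $(\ell_F,\ell_P,\ell_D,\ell_g)$ of the tangent lines, in the manifold of contact elements $PT^*S$, of the Legendrian curves of contact elements tangent to $F$, to $P$, to $D$ and to the point $g$ (the last one is the fibre over $g$), at their common point; the convention is $(\ell_F,\ell_P,\ell_D,\ell_g)=\frac{c_F-c_D}{c_P-c_D}$ if $\ell_F,\ell_P,\ell_D$ have slopes $c_F,c_P,c_D$ and $\ell_g$ is vertical. The $g$-contour of $S$ is the set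 of points of $S$ at which the tangent plane of $S$ passes through $g$. (a) Suppose $\rho\neq\frac43$. There is a neighbourhood $U$ of $g$ in $S$ such that no plane tangent to $S$ at a point of $U\smallsetminus\{g\}$ passes through $g$ if and only if $\rho>\frac43$. (b) Suppose $\rho<\frac43$ and $\rho\neq1$. Then, in any sufficiently small neighbourhood of $g$, the $g$-contour of $S$ consists of two smooth regular curves through $g$, which meet only at $g$ and are tangent to the parabolic curve at $g$. Call $g$ positive (negative) if at the neighbouring parabolic points the half-asymptotic lines directed to the hyperbolic domain point towards (away from) $g$. Then $g$ is positive if and only if $\rho>1$, and negative if and only if $\rho<1$. If $g$ is positive ($1<\rho<\frac43$), then, apart from $g$, one of the two curves lies locally in the elliptic domain and the other one in the hyperbolic domain. If $g$ is negative ($\rho<1$), then, apart from $g$, both curves lie locally in the hyperbolic domain. -/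

import Mathlib

open Set Filter Topology Asymptotics
open scoped ContDiff

/-!
A smooth surface is given near a point by a smooth immersion `r` of an open set `Ω ⊆ ℝ²` into
affine 3-space. Points, curves and neighbourhoods on the surface are described by their parameters
in `Ω`, and tangent vectors `dr(v)` of the surface by `v ∈ ℝ²`.
-/

noncomputable section

namespace Godron

/-- The tangent plane of the surface at the point with parameter `u`. -/
def tangentPlane (r : ℝ × ℝ → Fin 3 → ℝ) (u : ℝ × ℝ) : AffineSubspace ℝ (Fin 3 → ℝ) :=
  AffineSubspace.mk' (r u) (LinearMap.range (fderiv ℝ r u : ℝ × ℝ →ₗ[ℝ] Fin 3 → ℝ))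

/-- The `q`-contour: the points at which the tangent plane passes through the point `q`. -/
def contour (r : ℝ × ℝ → Fin 3 → ℝ) (Ω : Set (ℝ × ℝ)) (q : ℝ × ℝ) : Set (ℝ × ℝ) :=
  {u ∈ Ω | r q ∈ tangentPlane r u}

/-- The second fundamental form, up to a nonvanishing factor: `det (r_x, r_y, D²r(v, w))`.
For the graph of `f` it is the Hessian form of `f`. -/
def secondForm (r : ℝ × ℝ → Fin 3 → ℝ) (u v w : ℝ × ℝ) : ℝ :=
  Matrix.det (Matrix.of
    ![fderiv ℝ r u (1, 0), fderiv ℝ r u (0, 1), fderiv ℝ (fderiv ℝ r) u v w])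

/-- The determinant of the second fundamental form. It has the sign of the Gaussian curvature. -/
def hessian (r : ℝ × ℝ → Fin 3 → ℝ) (u : ℝ × ℝ) : ℝ :=
  secondForm r u (1, 0) (1, 0) * secondForm r u (0, 1) (0, 1) - secondForm r u (1, 0) (0, 1) ^ 2

/-- Elliptic points: positive Gaussian curvature, no asymptotic direction. -/
def IsElliptic (r : ℝ × ℝ → Fin 3 → ℝ) (u : ℝ × ℝ) : Prop := 0 < hessian r u

/-- Hyperbolic points: negative Gaussian curvature, two asymptotic directions. -/
def IsHyperbolic (r : ℝ × ℝ → Fin 3 → ℝ) (u : ℝ × ℝ) : Prop := hessian r u < 0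

/-- Parabolic points: the second fundamental form is degenerate and nonzero, so that there is
exactly one (double) asymptotic direction. -/
def IsParabolic (r : ℝ × ℝ → Fin 3 → ℝ) (u : ℝ × ℝ) : Prop :=
  hessian r u = 0 ∧ ∃ v, secondForm r u v v ≠ 0

/-- `v` spans an asymptotic direction at `u`. -/
def IsAsymptotic (r : ℝ × ℝ → Fin 3 → ℝ) (u v : ℝ × ℝ) : Prop :=
  v ≠ 0 ∧ secondForm r u v v = 0

/-- `γ` is smooth near the parameter value `0`. -/
def SmoothNearZero (γ : ℝ → ℝ × ℝ) : Prop := ∀ᶠ t in 𝓝 (0 : ℝ), ContDiffAt ℝ ∞ γ t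

/-- The tangent line with direction `dr(v)` at `u` has at least `k`-point contact with the surface:
some curve of the surface agrees with the line up to `O(t ^ k)`. -/
def HasLineContact (r : ℝ × ℝ → Fin 3 → ℝ) (u v : ℝ × ℝ) (k : ℕ) : Prop :=
  ∃ c : ℝ → ℝ × ℝ, SmoothNearZero c ∧ c 0 = u ∧
    (fun t : ℝ => r (c t) - (r u + t • fderiv ℝ r u v)) =O[𝓝 0] fun t : ℝ => t ^ k

/-- The parabolic curve. -/
def parabolicSet (r : ℝ × ℝ → Fin 3 → ℝ) (Ω : Set (ℝ × ℝ)) : Set (ℝ × ℝ) :=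
  {u ∈ Ω | IsParabolic r u}

/-- The flecnodal curve: some asymptotic line exceeds 3-point contact with the surface. -/
def flecnodalSet (r : ℝ × ℝ → Fin 3 → ℝ) (Ω : Set (ℝ × ℝ)) : Set (ℝ × ℝ) :=
  {u ∈ Ω | ∃ v, IsAsymptotic r u v ∧ HasLineContact r u v 4}

/-- The conodal curve of the piece `U` of the surface: the closure of the set of points of contact
of planes which are tangent to `U` at two distinct points at least. -/
def conodalSet (r : ℝ × ℝ → Fin 3 → ℝ) (U : Set (ℝ × ℝ)) : Set (ℝ × ℝ) :=
  closure {u ∈ U | ∃ v ∈ U, v ≠ u ∧ tangentPlane r u = tangentPlane r v}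

/-- A godron: a parabolic point, at which the parabolic curve is regular (the determinant of the
second fundamental form has a nonzero differential) and is tangent to the asymptotic direction. -/
def IsGodron (r : ℝ × ℝ → Fin 3 → ℝ) (g : ℝ × ℝ) : Prop :=
  IsParabolic r g ∧ fderiv ℝ (hessian r) g ≠ 0 ∧
    ∃ v, IsAsymptotic r g v ∧ fderiv ℝ (hessian r) g v = 0

/-- `v` points towards `g` from `u` (an acute angle in the parameter plane). At points of a regular
curve close to `g`, and for directions close to the tangent direction of that curve, this does not
depend on the parametrization of the surface. -/
def PointsTowards (g u v : ℝ × ℝ) : Prop := 0 < v.1 * (g.1 - u.1) + v.2 * (g.2 - u.2)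

/-- A positive godron: at the neighbouring parabolic points the half-asymptotic line directed to the
hyperbolic domain (along which the determinant of the second form decreases) points towards `g`. -/
def IsPositive (r : ℝ × ℝ → Fin 3 → ℝ) (g : ℝ × ℝ) : Prop :=
  ∀ᶠ u in 𝓝[≠] g, IsParabolic r u →
    ∃ v, IsAsymptotic r u v ∧ fderiv ℝ (hessian r) u v < 0 ∧ PointsTowards g u v

/-- A negative godron: these half-asymptotic lines point away from `g`. -/
def IsNegative (r : ℝ × ℝ → Fin 3 → ℝ) (g : ℝ × ℝ) : Prop :=
  ∀ᶠ u in 𝓝[≠] g, IsParabolic r u →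
    ∃ v, IsAsymptotic r u v ∧ fderiv ℝ (hessian r) u v < 0 ∧ PointsTowards g u (-v)

/-- `γ` is a smooth regular curve with `γ 0 = g`. -/
def IsArcAt (γ : ℝ → ℝ × ℝ) (g : ℝ × ℝ) : Prop :=
  SmoothNearZero γ ∧ γ 0 = g ∧ deriv γ 0 ≠ 0

/-- The germ of the set `A` at `g` is the germ of the smooth regular curve `γ`. -/
def IsCurveGerm (A : Set (ℝ × ℝ)) (g : ℝ × ℝ) (γ : ℝ → ℝ × ℝ) : Prop :=
  IsArcAt γ g ∧ ∀ᶠ δ in 𝓝[>] (0 : ℝ), A =ᶠ[𝓝 g] γ '' Ioo (-δ) δ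

/-- The area form of the parameter plane. -/
def area (v w : ℝ × ℝ) : ℝ := v.1 * w.2 - v.2 * w.1

/-- The Legendrian lift of a curve to the manifold of contact elements of the surface, in the chart
in which the pair `(u, s)` stands for the line spanned by `a + s • b` at `u`: to each point of the
curve the tangent line of the curve is attached. -/
def legendrianLift (a b : ℝ × ℝ) (γ : ℝ → ℝ × ℝ) (t : ℝ) : (ℝ × ℝ) × ℝ :=
  (γ t, area a (deriv γ t) / area (deriv γ t) b)

/-- In the same chart, the curve of all contact elements at the point `g`. -/
def fibreLift (g : ℝ × ℝ) (t : ℝ) : (ℝ × ℝ) × ℝ := (g, t)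

/-- `ρ` is the cross-ratio `(ℓ₁, ℓ₂, ℓ₃, ℓ₄)` of four lines of a plane, spanned by `v₁, …, v₄`.
For lines `ℓᵢ` of slopes `cᵢ` (`i ≤ 3`) and the vertical line `ℓ₄` it is
`(c₁ - c₃) / (c₂ - c₃)`. -/
def IsCrossRatio {V : Type*} [AddCommGroup V] [Module ℝ V] (v₁ v₂ v₃ v₄ : V) (ρ : ℝ) : Prop :=
  LinearIndependent ℝ ![v₃, v₄] ∧ ∃ α₁ β₁ α₂ β₂ : ℝ,
    v₁ = α₁ • v₃ + β₁ • v₄ ∧ v₂ = α₂ • v₃ + β₂ • v₄ ∧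
    α₁ ≠ 0 ∧ α₂ ≠ 0 ∧ β₂ ≠ 0 ∧ ρ = (β₁ / α₁) / (β₂ / α₂)

/-- `ρ` is the cr-invariant of the godron `g`: the cross-ratio of the tangent lines at their common
point `(g, [a])` of the Legendrian curves of contact elements tangent to the flecnodal, the
parabolic and the conodal curve, and of the fibre over `g`. The conodal curve is that of an
arbitrary sufficiently small neighbourhood of `g`. -/
def IsCrInvariant (r : ℝ × ℝ → Fin 3 → ℝ) (Ω : Set (ℝ × ℝ)) (g : ℝ × ℝ) (ρ : ℝ) : Prop :=
  ∃ γF γP γD : ℝ → ℝ × ℝ,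
    IsCurveGerm (flecnodalSet r Ω) g γF ∧
    IsCurveGerm (parabolicSet r Ω) g γP ∧
    (∀ᶠ ε in 𝓝[>] (0 : ℝ), IsCurveGerm (conodalSet r (Ω ∩ Metric.ball g ε)) g γD) ∧
    ∃ a b : ℝ × ℝ, area a b ≠ 0 ∧
      area a (deriv γF 0) = 0 ∧ area a (deriv γP 0) = 0 ∧ area a (deriv γD 0) = 0 ∧
      IsCrossRatio (deriv (legendrianLift a b γF) 0) (deriv (legendrianLift a b γP) 0)
        (deriv (legendrianLift a b γD) 0) (deriv (fibreLift g) 0) ρ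

end Godron

end

/-! In suitable affine coordinates the surface near a godron is the graph of f = y²/2 - x²y + λx⁴/2
plus terms of weight greater than four, with x of weight one and y of weight two
(`exists_normalForm_chart`). All curves in question are parabolas y ~ c x² to leading order, so only
their coefficients c matter.

The Hessian determinant is -2(y - (3λ-2)x²) to leading order, so the parabolic curve has c = 3λ-2
and the elliptic domain lies below it. On the flecnodal curve the asymptotic slope is about 2λx, and
the Hessian form then gives c = λ(2λ-1) (`flecnodal_coeff`). For the conodal curve a partial
Legendre transform in y turns bitangent planes into bitangent lines of the functions -qx² +
(λ-1)x⁴/2 (up to constants and higher terms), with q = f_y; the contact points are nearly opposite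
and c = λ (`conodal_coeff`). The slopes of Legendrian lifts are affine functions of c, so ρ =
(λ(2λ-1) - λ)/((3λ-2) - λ) = λ (`crInvariant_eq`). The nondegeneracy of the cross-ratio forces λ ≠
1.

The tangent plane at p passes through g when f - x f_x - y f_y vanishes at p. To leading order this
function is -(y - 2x²)²/2 + (4-3λ)x⁴/2, and completing the square makes this exact
(`exists_contour_factorization`). It is definite for λ > 4/3. For λ < 4/3 it factors into two curves
with c = 2 ± s, s = √(4-3λ). Since 3λ-2 = 2 - s², the curve 2 + s is always hyperbolic, and the
curve 2 - s is elliptic exactly if s < 1, that is λ > 1.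

At parabolic points the asymptotic direction has slope about 2x, and the derivative of the Hessian
determinant along it is about 12(λ-1)x. Its sign decides whether the hyperbolic half points towards
g (`eventually_asymptotic`). -/

namespace Godron

/-! ### Smooth functions: extension of germs, local inverses, division -/

section Smooth

variable {E F : Type} [NormedAddCommGroup E] [NormedSpace ℝ E] [FiniteDimensional ℝ E]
  [NormedAddCommGroup F] [NormedSpace ℝ F]

/-- Multiplication by a bump function. Every germ can thus be replaced by a globally smooth
function, and later derivatives need no domain conditions. -/
theorem exists_contDiff_eventuallyEq {f : E → F} {a : E}
    (h : ∀ᶠ x in 𝓝 a, ContDiffAt ℝ ∞ f x) : ∃ g : E → F, ContDiff ℝ ∞ g ∧ g =ᶠ[𝓝 a] f := by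
  obtain ⟨ε, hε, hball⟩ := Metric.nhds_basis_closedBall.mem_iff.1 h
  let b : ContDiffBump a := ⟨ε / 2, ε, by positivity, by linarith⟩
  refine ⟨fun x => b x • f x, ?_, ?_⟩
  · rw [contDiff_iff_contDiffAt]
    intro x
    by_cases hx : x ∈ Metric.closedBall a ε
    · exact b.contDiffAt.smul (hball hx)
    · have : (fun x => b x • f x) =ᶠ[𝓝 x] fun _ => 0 := by
        filter_upwards [Metric.isClosed_closedBall.isOpen_compl.mem_nhds hx] with y hy
        have : b y = 0 := b.zero_of_le_dist (by
          have : ε < dist y a := by simpa using hy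
          exact this.le)
        simp [this]
      exact contDiffAt_const.congr_of_eventuallyEq this
  · filter_upwards [b.eventuallyEq_one] with x hx
    simp [hx]

/-- The inverse function theorem, with the inverse cut off to a global smooth map. Invertibility of
the derivative is an open condition, so the inverse is smooth in a whole neighbourhood, as the
cut-off requires. -/
theorem exists_contDiff_localInverse [FiniteDimensional ℝ F] {φ : E → F} (hφ : ContDiff ℝ ∞ φ)
    {a : E} {φ' : E ≃L[ℝ] F} (h' : HasFDerivAt φ (φ' : E →L[ℝ] F) a) :
    ∃ ψ : F → E, ContDiff ℝ ∞ ψ ∧ ψ (φ a) = a ∧ (∀ᶠ u in 𝓝 a, ψ (φ u) = u) ∧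
      (∀ᶠ p in 𝓝 (φ a), φ (ψ p) = p) ∧ HasFDerivAt ψ (φ'.symm : F →L[ℝ] E) (φ a) := by
  have : CompleteSpace E := FiniteDimensional.complete ℝ E
  have hn : (∞ : WithTop ℕ∞) ≠ 0 := by simp
  set e := hφ.contDiffAt.toOpenPartialHomeomorph φ h' hn with he
  have hcoe : (e : E → F) = φ := rfl
  have has : a ∈ e.source := hφ.contDiffAt.mem_toOpenPartialHomeomorph_source h' hn
  have hat : φ a ∈ e.target := hφ.contDiffAt.image_mem_toOpenPartialHomeomorph_target h' hn
  have hsa : e.symm (φ a) = a := e.left_inv has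
  have hsmooth : ∀ᶠ p in 𝓝 (φ a), ContDiffAt ℝ ∞ e.symm p := by
    have h1 : ∀ᶠ u in 𝓝 a, fderiv ℝ φ u ∈ range ((↑) : (E ≃L[ℝ] F) → (E →L[ℝ] F)) := by
      have hc : ContinuousAt (fderiv ℝ φ) a := (hφ.continuous_fderiv hn).continuousAt
      apply hc
      rw [h'.fderiv]
      exact ContinuousLinearEquiv.nhds φ'
    have h2 : Tendsto e.symm (𝓝 (φ a)) (𝓝 a) := by
      have := e.continuousAt_symm hat
      rwa [ContinuousAt, hsa] at this
    filter_upwards [e.open_target.mem_nhds hat, h2.eventually h1] with p hp hq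
    obtain ⟨L, hL⟩ := hq
    refine e.contDiffAt_symm hp (f₀' := L) ?_ ?_
    · rw [hL]
      exact (hφ.differentiable hn _).hasFDerivAt
    · exact hφ.contDiffAt
  obtain ⟨ψ, hψ, hψe⟩ := exists_contDiff_eventuallyEq hsmooth
  have hψa : ψ (φ a) = a := hψe.eq_of_nhds.trans hsa
  have hR : ∀ᶠ p in 𝓝 (φ a), φ (ψ p) = p := by
    filter_upwards [hψe, e.open_target.mem_nhds hat] with p hp ht
    rw [hp]
    exact e.right_inv ht
  refine ⟨ψ, hψ, hψa, ?_, hR, ?_⟩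
  · filter_upwards [(hφ.continuous.continuousAt (x := a)).eventually hψe,
      e.open_source.mem_nhds has] with u hu hs
    rw [hu]
    exact e.left_inv hs
  · apply HasFDerivAt.of_local_left_inverse hψ.continuous.continuousAt _ hR
    rwa [hψa]

/-- Differentiating under the integral gives an integral of the same kind with values in a space of
linear maps. The target space is therefore quantified inside the induction. -/
theorem contDiff_intervalIntegral_nat (n : ℕ) :
    ∀ {G : Type} [NormedAddCommGroup G] [NormedSpace ℝ G] [CompleteSpace G] {f : E × ℝ → G},
      ContDiff ℝ ∞ f → ContDiff ℝ n fun p => ∫ t in (0 : ℝ)..1, f (p, t) := by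
  have hproper : ProperSpace E := FiniteDimensional.proper_real E
  have key : ∀ {G : Type} [NormedAddCommGroup G] [NormedSpace ℝ G] [CompleteSpace G]
      {f : E × ℝ → G}, ContDiff ℝ ∞ f → ∀ p, HasFDerivAt (fun p => ∫ t in (0 : ℝ)..1, f (p, t))
        (∫ t in (0 : ℝ)..1, (fderiv ℝ f (p, t)).comp (ContinuousLinearMap.inl ℝ E ℝ)) p := by
    intro G _ _ _ f hf p
    have hf' : Continuous fun q : E × ℝ =>
        (fderiv ℝ f q).comp (ContinuousLinearMap.inl ℝ E ℝ) :=
      (hf.continuous_fderiv (by simp)).clm_comp continuous_const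
    obtain ⟨C, hC⟩ := ((isCompact_closedBall p 1).prod
      (isCompact_Icc (a := (0 : ℝ)) (b := 1))).exists_bound_of_continuousOn hf'.continuousOn
    refine intervalIntegral.hasFDerivAt_integral_of_dominated_of_fderiv_le
      (F := fun p t => f (p, t))
      (F' := fun p t => (fderiv ℝ f (p, t)).comp (ContinuousLinearMap.inl ℝ E ℝ))
      (bound := fun _ => C) (Metric.closedBall_mem_nhds p one_pos) ?_ ?_ ?_ ?_ ?_ ?_
    · refine Eventually.of_forall fun q => Continuous.aestronglyMeasurable ?_
      exact hf.continuous.comp (by fun_prop)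
    · exact (hf.continuous.comp (by fun_prop : Continuous fun t : ℝ => (p, t))).intervalIntegrable
        _ _
    · exact Continuous.aestronglyMeasurable
        (hf'.comp (by fun_prop : Continuous fun t : ℝ => (p, t)))
    · refine Eventually.of_forall fun t ht q hq => hC (q, t) ⟨hq, ?_⟩
      rw [uIoc_of_le zero_le_one] at ht
      exact ⟨ht.1.le, ht.2⟩
    · exact intervalIntegrable_const
    · refine Eventually.of_forall fun t _ q _ => ?_
      have h1 : HasFDerivAt f (fderiv ℝ f (q, t)) (q, t) :=
        (hf.differentiable (by simp) _).hasFDerivAt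
      exact h1.comp q (hasFDerivAt_prodMk_left q t)
  induction n with
  | zero =>
    intro G _ _ _ f hf
    exact contDiff_zero.2 (continuous_iff_continuousAt.2 fun p => (key hf p).continuousAt)
  | succ n ih =>
    intro G _ _ _ f hf
    push_cast
    rw [contDiff_succ_iff_hasFDerivAt]
    refine ⟨_, ?_, key hf⟩
    exact ih (f := fun q => (fderiv ℝ f q).comp (ContinuousLinearMap.inl ℝ E ℝ))
      ((hf.fderiv_right (by simp)).clm_comp contDiff_const)

theorem contDiff_intervalIntegral [CompleteSpace F] {f : E × ℝ → F} (hf : ContDiff ℝ ∞ f) :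
    ContDiff ℝ ∞ fun p => ∫ t in (0 : ℝ)..1, f (p, t) :=
  contDiff_infty.2 fun n => contDiff_intervalIntegral_nat n hf

/-- Hadamard's lemma with parameters. -/
theorem exists_eq_mul_of_eq_zero {f : E × ℝ → ℝ} (hf : ContDiff ℝ ∞ f) (h0 : ∀ p, f (p, 0) = 0) :
    ∃ g : E × ℝ → ℝ, ContDiff ℝ ∞ g ∧ ∀ p t, f (p, t) = t * g (p, t) := by
  refine ⟨fun q => ∫ s in (0 : ℝ)..1, fderiv ℝ f (q.1, s * q.2) (0, 1), ?_, ?_⟩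
  · refine contDiff_intervalIntegral
      (f := fun z : (E × ℝ) × ℝ => fderiv ℝ f (z.1.1, z.2 * z.1.2) (0, 1)) ?_
    refine ContDiff.clm_apply ?_ contDiff_const
    exact (hf.fderiv_right (m := ∞) (by simp)).comp (by fun_prop)
  · intro p t
    have hd : ∀ s ∈ uIcc (0 : ℝ) 1, HasDerivAt (fun s => f (p, s * t))
        (fderiv ℝ f (p, s * t) (0, t)) s := by
      intro s _
      have h1 : HasFDerivAt f (fderiv ℝ f (p, s * t)) (p, s * t) :=
        (hf.differentiable (by simp) _).hasFDerivAt
      have h2 : HasDerivAt (fun s : ℝ => (p, s * t)) ((0 : E), t) s := by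
        simpa using (hasDerivAt_const s p).prodMk ((hasDerivAt_id s).mul_const t)
      exact h1.comp_hasDerivAt s h2
    have hc : Continuous fun s : ℝ => fderiv ℝ f (p, s * t) (0, t) :=
      ((hf.continuous_fderiv (by simp)).comp (by fun_prop : Continuous fun s : ℝ =>
        (p, s * t))).clm_apply continuous_const
    have := intervalIntegral.integral_eq_sub_of_hasDerivAt hd (hc.intervalIntegrable 0 1)
    simp only [one_mul, zero_mul, h0, sub_zero] at this
    rw [← this, ← intervalIntegral.integral_const_mul]
    congr 1
    ext s
    have : ((0 : E), t) = t • ((0 : E), (1 : ℝ)) := by ext <;> simp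
    rw [this, map_smul, smul_eq_mul]

/-- A finite limit of f / x ^ (n + 1) forces f to vanish at 0, so Hadamard's lemma splits off one
factor x at a time. -/
theorem exists_eq_pow_mul (n : ℕ) : ∀ {f : ℝ → ℝ} {c : ℝ}, ContDiff ℝ ∞ f →
    Tendsto (fun x => f x / x ^ n) (𝓝[≠] 0) (𝓝 c) →
    ∃ g : ℝ → ℝ, ContDiff ℝ ∞ g ∧ g 0 = c ∧ ∀ x, f x = x ^ n * g x := by
  induction n with
  | zero =>
    intro f c hf h
    refine ⟨f, hf, ?_, by simp⟩
    simp only [pow_zero, div_one] at h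
    exact tendsto_nhds_unique (hf.continuous.continuousAt.continuousWithinAt (s := {0}ᶜ)) h
  | succ n ih =>
    intro f c hf h
    have hx : Tendsto (fun x : ℝ => x ^ (n + 1)) (𝓝[≠] 0) (𝓝 0) := by
      have : ContinuousAt (fun x : ℝ => x ^ (n + 1)) 0 := by fun_prop
      exact tendsto_nhdsWithin_of_tendsto_nhds (by simpa [ContinuousAt] using this)
    have h0 : f 0 = 0 := by
      have h1 : Tendsto f (𝓝[≠] 0) (𝓝 (c * 0)) := by
        refine (h.mul hx).congr' ?_
        filter_upwards [self_mem_nhdsWithin] with x hx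
        have : x ≠ 0 := hx
        field_simp
      rw [mul_zero] at h1
      exact tendsto_nhds_unique (hf.continuous.continuousAt.continuousWithinAt (s := {0}ᶜ)) h1
    obtain ⟨g, hg, hfg⟩ := exists_eq_mul_of_eq_zero (E := ℝ) (f := fun q => f q.2)
      (hf.comp contDiff_snd) (fun _ => h0)
    have hfg' : ∀ x, f x = x * g (0, x) := fun x => hfg 0 x
    obtain ⟨k, hk, hk0, hk'⟩ := ih (f := fun x => g (0, x)) (c := c)
      (hg.comp (by fun_prop)) (h.congr' (by
        filter_upwards [self_mem_nhdsWithin] with x hx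
        have : x ≠ 0 := hx
        rw [hfg' x, pow_succ', mul_div_mul_left _ _ this]))
    refine ⟨k, hk, hk0, fun x => ?_⟩
    rw [hfg', hk']
    ring

end Smooth

/-! ### Partial derivatives in the plane -/

/-- The partial derivative with respect to the first variable. -/
noncomputable def dx (f : ℝ × ℝ → ℝ) (p : ℝ × ℝ) : ℝ := fderiv ℝ f p (1, 0)

/-- The partial derivative with respect to the second variable. -/
noncomputable def dy (f : ℝ × ℝ → ℝ) (p : ℝ × ℝ) : ℝ := fderiv ℝ f p (0, 1)

section Partial

variable {f h : ℝ × ℝ → ℝ}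

theorem contDiff_dx (hf : ContDiff ℝ ∞ f) : ContDiff ℝ ∞ (dx f) :=
  (hf.fderiv_right (m := ∞) (by simp)).clm_apply contDiff_const

theorem contDiff_dy (hf : ContDiff ℝ ∞ f) : ContDiff ℝ ∞ (dy f) :=
  (hf.fderiv_right (m := ∞) (by simp)).clm_apply contDiff_const

theorem hasFDerivAt_of_contDiff {E F : Type} [NormedAddCommGroup E] [NormedSpace ℝ E]
    [NormedAddCommGroup F] [NormedSpace ℝ F] {f : E → F} (hf : ContDiff ℝ ∞ f) (p : E) :
    HasFDerivAt f (fderiv ℝ f p) p :=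
  (hf.differentiable (by simp) p).hasFDerivAt

theorem fderiv_eq_dx_dy (f : ℝ × ℝ → ℝ) (p v : ℝ × ℝ) :
    fderiv ℝ f p v = v.1 * dx f p + v.2 * dy f p := by
  have : v = v.1 • ((1 : ℝ), (0 : ℝ)) + v.2 • ((0 : ℝ), (1 : ℝ)) := by ext <;> simp
  conv_lhs => rw [this, map_add, map_smul, map_smul]
  rfl

theorem hasDerivAt_comp_curve (hf : ContDiff ℝ ∞ f) {γ : ℝ → ℝ × ℝ} {γ' : ℝ × ℝ} {t : ℝ}
    (hγ : HasDerivAt γ γ' t) :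
    HasDerivAt (fun t => f (γ t)) (γ'.1 * dx f (γ t) + γ'.2 * dy f (γ t)) t := by
  rw [← fderiv_eq_dx_dy]
  exact (hasFDerivAt_of_contDiff hf _).comp_hasDerivAt t hγ

theorem fderiv_fderiv_apply {E F : Type} [NormedAddCommGroup E] [NormedSpace ℝ E]
    [NormedAddCommGroup F] [NormedSpace ℝ F] {f : E → F} (hf : ContDiff ℝ ∞ f) (p v w : E) :
    fderiv ℝ (fun q => fderiv ℝ f q w) p v = fderiv ℝ (fderiv ℝ f) p v w := by
  have h1 : HasFDerivAt (fderiv ℝ f) (fderiv ℝ (fderiv ℝ f) p) p :=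
    hasFDerivAt_of_contDiff (hf.fderiv_right (m := ∞) (by simp)) p
  have h2 := h1.clm_apply (hasFDerivAt_const w p)
  rw [h2.fderiv]
  simp

theorem dy_dx (hf : ContDiff ℝ ∞ f) : dy (dx f) = dx (dy f) := by
  funext p
  have hs : IsSymmSndFDerivAt ℝ f p :=
    (contDiff_infty.1 hf 2).contDiffAt.isSymmSndFDerivAt (by simp)
  have h1 := fderiv_fderiv_apply hf p (0, 1) (1, 0)
  have h2 := fderiv_fderiv_apply hf p (1, 0) (0, 1)
  exact h1.trans ((hs _ _).trans h2.symm)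

theorem dx_mul (hf : ContDiff ℝ ∞ f) (hh : ContDiff ℝ ∞ h) :
    dx (fun p => f p * h p) = fun p => dx f p * h p + f p * dx h p := by
  funext p
  have := (hasFDerivAt_of_contDiff hf p).mul (hasFDerivAt_of_contDiff hh p)
  rw [dx, show fderiv ℝ (fun p => f p * h p) p = _ from this.fderiv]
  simp [dx]
  ring

theorem dy_mul (hf : ContDiff ℝ ∞ f) (hh : ContDiff ℝ ∞ h) :
    dy (fun p => f p * h p) = fun p => dy f p * h p + f p * dy h p := by
  funext p
  have := (hasFDerivAt_of_contDiff hf p).mul (hasFDerivAt_of_contDiff hh p)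
  rw [dy, show fderiv ℝ (fun p => f p * h p) p = _ from this.fderiv]
  simp [dy]
  ring

theorem dx_sub (hf : ContDiff ℝ ∞ f) (hh : ContDiff ℝ ∞ h) :
    dx (fun p => f p - h p) = fun p => dx f p - dx h p := by
  funext p
  have := (hasFDerivAt_of_contDiff hf p).sub (hasFDerivAt_of_contDiff hh p)
  rw [dx, show fderiv ℝ (fun p => f p - h p) p = _ from this.fderiv]
  simp [dx]

theorem dy_sub (hf : ContDiff ℝ ∞ f) (hh : ContDiff ℝ ∞ h) :
    dy (fun p => f p - h p) = fun p => dy f p - dy h p := by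
  funext p
  have := (hasFDerivAt_of_contDiff hf p).sub (hasFDerivAt_of_contDiff hh p)
  rw [dy, show fderiv ℝ (fun p => f p - h p) p = _ from this.fderiv]
  simp [dy]

theorem dx_add (hf : ContDiff ℝ ∞ f) (hh : ContDiff ℝ ∞ h) :
    dx (fun p => f p + h p) = fun p => dx f p + dx h p := by
  funext p
  have := (hasFDerivAt_of_contDiff hf p).add (hasFDerivAt_of_contDiff hh p)
  rw [dx, show fderiv ℝ (fun p => f p + h p) p = _ from this.fderiv]
  simp [dx]

theorem dy_add (hf : ContDiff ℝ ∞ f) (hh : ContDiff ℝ ∞ h) :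
    dy (fun p => f p + h p) = fun p => dy f p + dy h p := by
  funext p
  have := (hasFDerivAt_of_contDiff hf p).add (hasFDerivAt_of_contDiff hh p)
  rw [dy, show fderiv ℝ (fun p => f p + h p) p = _ from this.fderiv]
  simp [dy]

end Partial

/-! ### Taylor expansions -/

theorem taylor_two {g : ℝ → ℝ} (hg : ContDiff ℝ ∞ g) :
    (fun t => g t - (g 0 + t * deriv g 0 + t ^ 2 / 2 * deriv (deriv g) 0)) =o[𝓝 0]
      fun t => t ^ 2 := by
  have := taylor_isLittleO_univ (x₀ := 0) (n := 2) (contDiff_infty.1 hg 2)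
  simp only [taylorWithinEval_succ, taylor_within_zero_eval, iteratedDerivWithin_univ,
    iteratedDeriv_succ, iteratedDeriv_zero, sub_zero] at this
  refine this.congr_left fun t => ?_
  simp only [Nat.factorial, smul_eq_mul]
  push_cast
  ring

theorem taylor_three {g : ℝ → ℝ} (hg : ContDiff ℝ ∞ g) :
    (fun t => g t - (g 0 + t * deriv g 0 + t ^ 2 / 2 * deriv (deriv g) 0 +
      t ^ 3 / 6 * deriv (deriv (deriv g)) 0)) =o[𝓝 0] fun t => t ^ 3 := by
  have := taylor_isLittleO_univ (x₀ := 0) (n := 3) (contDiff_infty.1 hg 3)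
  simp only [taylorWithinEval_succ, taylor_within_zero_eval, iteratedDerivWithin_univ,
    iteratedDeriv_succ, iteratedDeriv_zero, sub_zero] at this
  refine this.congr_left fun t => ?_
  simp only [Nat.factorial, smul_eq_mul]
  push_cast
  ring

section Weighted

variable {F : ℝ × ℝ → ℝ}

/-- The Taylor formula up to weight two, the variables having weights one and two. -/
theorem weighted_taylor (hF : ContDiff ℝ ∞ F) :
    (fun p : ℝ × ℝ => F p - (F 0 + p.1 * dx F 0 + p.2 * dy F 0 + p.1 ^ 2 / 2 * dx (dx F) 0))
      =o[𝓝 0] fun p => |p.2| + p.1 ^ 2 := by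
  -- Strict differentiability compares two moving points, which gives an error small relative to y
  -- alone; the rest is a one-variable expansion in x.
  have h1 : (fun p : ℝ × ℝ => F p - F (p.1, 0) - p.2 * dy F 0) =o[𝓝 0] fun p => p.2 := by
    have hs : HasStrictFDerivAt F (fderiv ℝ F 0) 0 :=
      hF.contDiffAt.hasStrictFDerivAt (by simp)
    have ht : Tendsto (fun p : ℝ × ℝ => (p, (p.1, (0 : ℝ)))) (𝓝 0) (𝓝 (0, 0)) := by
      have : Continuous fun p : ℝ × ℝ => (p, (p.1, (0 : ℝ))) := by fun_prop
      exact this.tendsto 0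
    refine (hs.isLittleO.comp_tendsto ht).congr' ?_ ?_ |>.trans_isBigO
      (g := fun p : ℝ × ℝ => ((0 : ℝ), p.2)) ?_
    · refine Eventually.of_forall fun p => ?_
      simp [fderiv_eq_dx_dy]
    · refine Eventually.of_forall fun p => ?_
      ext <;> simp
    · exact IsBigO.of_bound 1 (Eventually.of_forall fun p => by simp)
  have hg : ContDiff ℝ ∞ fun x : ℝ => F (x, 0) := hF.comp (by fun_prop)
  have hd : ∀ {G : ℝ × ℝ → ℝ}, ContDiff ℝ ∞ G →
      deriv (fun x : ℝ => G (x, 0)) = fun x => dx G (x, 0) := by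
    intro G hG
    funext x
    have := hasDerivAt_comp_curve hG ((hasDerivAt_id x).prodMk (hasDerivAt_const x (0 : ℝ)))
    simpa using this.deriv
  have h2 := taylor_two hg
  rw [hd hF, hd (contDiff_dx hF)] at h2
  have h3 : Tendsto (fun p : ℝ × ℝ => p.1) (𝓝 0) (𝓝 0) := continuous_fst.tendsto 0
  have h4 := h2.comp_tendsto h3
  have h5 : (fun p : ℝ × ℝ => p.2) =O[𝓝 0] fun p : ℝ × ℝ => |p.2| + p.1 ^ 2 :=
    IsBigO.of_bound 1 (Eventually.of_forall fun p => by
      rw [Real.norm_eq_abs, Real.norm_eq_abs, abs_of_nonneg (a := |p.2| + p.1 ^ 2) (by positivity)]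
      nlinarith [sq_nonneg p.1])
  have h6 : (fun p : ℝ × ℝ => p.1 ^ 2) =O[𝓝 0] fun p : ℝ × ℝ => |p.2| + p.1 ^ 2 :=
    IsBigO.of_bound 1 (Eventually.of_forall fun p => by
      rw [Real.norm_eq_abs, Real.norm_eq_abs, abs_of_nonneg (a := |p.2| + p.1 ^ 2) (by positivity),
        abs_of_nonneg (by positivity)]
      nlinarith [abs_nonneg p.2])
  refine ((h1.trans_isBigO h5).add (h4.trans_isBigO h6)).congr_left fun p => ?_
  simp only [Function.comp, Prod.mk_zero_zero]
  ring

variable {α : Type*} {l : Filter α} {s y ξ : α → ℝ}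

theorem tendsto_zero_pair (hξ : Tendsto ξ l (𝓝 0)) (hs : s =O[l] ξ)
    (hy : y =O[l] fun a => ξ a ^ 2) : Tendsto (fun a => (s a, y a)) l (𝓝 0) := by
  have h1 : Tendsto (fun a => ξ a ^ 2) l (𝓝 0) := by simpa using hξ.pow 2
  exact (hs.trans_tendsto hξ).prodMk_nhds (hy.trans_tendsto h1)

/-- Weighted Taylor formula along a family of points. -/
theorem weighted_taylor_two (hF : ContDiff ℝ ∞ F) (hξ : Tendsto ξ l (𝓝 0)) (hs : s =O[l] ξ)
    (hy : y =O[l] fun a => ξ a ^ 2) :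
    (fun a => F (s a, y a) - (F 0 + s a * dx F 0 + y a * dy F 0 + s a ^ 2 / 2 * dx (dx F) 0))
      =o[l] fun a => ξ a ^ 2 := by
  refine ((weighted_taylor hF).comp_tendsto (tendsto_zero_pair hξ hs hy)).trans_isBigO ?_
  exact (hy.norm_left.add (hs.pow 2))

theorem weighted_taylor_one (hF : ContDiff ℝ ∞ F) (hξ : Tendsto ξ l (𝓝 0)) (hs : s =O[l] ξ)
    (hy : y =O[l] fun a => ξ a ^ 2) :
    (fun a => F (s a, y a) - (F 0 + s a * dx F 0)) =o[l] ξ := by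
  have h1 : (fun a => ξ a ^ 2) =o[l] ξ := by
    have := (isLittleO_one_iff ℝ).2 hξ
    simpa [pow_two] using this.mul_isBigO (isBigO_refl ξ l)
  have h2 := (weighted_taylor_two hF hξ hs hy).trans h1
  have h3 : (fun a => y a * dy F 0 + s a ^ 2 / 2 * dx (dx F) 0) =o[l] ξ := by
    refine IsLittleO.add ?_ ?_
    · simpa [mul_comm] using (hy.trans_isLittleO h1).const_mul_left (dy F 0)
    · have := ((hs.pow 2).trans_isLittleO h1).const_mul_left (dx (dx F) 0 / 2)
      exact this.congr_left fun _ => by ring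
  exact (h2.add h3).congr_left fun _ => by ring

variable {x : α → ℝ} {c : ℝ}

theorem isBigO_of_tendsto_div_sq (hne : ∀ᶠ a in l, x a ≠ 0)
    (hy : Tendsto (fun a => y a / x a ^ 2) l (𝓝 c)) : y =O[l] fun a => x a ^ 2 :=
  isBigO_of_div_tendsto_nhds (hne.mono fun _ ha h => absurd h (pow_ne_zero 2 ha)) c hy

/-- Along points with y ~ c x² the terms y and x² have the same order, so the weight-two part of F
is its leading part. -/
theorem tendsto_div_sq (hF : ContDiff ℝ ∞ F) (h0 : F 0 = 0) (h1 : dx F 0 = 0)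
    (hx : Tendsto x l (𝓝 0)) (hne : ∀ᶠ a in l, x a ≠ 0)
    (hy : Tendsto (fun a => y a / x a ^ 2) l (𝓝 c)) :
    Tendsto (fun a => F (x a, y a) / x a ^ 2) l (𝓝 (c * dy F 0 + dx (dx F) 0 / 2)) := by
  have h := (weighted_taylor_two hF hx (isBigO_refl x l)
    (isBigO_of_tendsto_div_sq hne hy)).tendsto_div_nhds_zero
  have h2 := h.add ((hy.mul_const (dy F 0)).add_const (dx (dx F) 0 / 2))
  rw [zero_add] at h2
  refine h2.congr' ?_
  filter_upwards [hne] with a ha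
  rw [h0, h1]
  field_simp
  ring

theorem tendsto_div (hF : ContDiff ℝ ∞ F) (h0 : F 0 = 0)
    (hx : Tendsto x l (𝓝 0)) (hne : ∀ᶠ a in l, x a ≠ 0)
    (hy : Tendsto (fun a => y a / x a ^ 2) l (𝓝 c)) :
    Tendsto (fun a => F (x a, y a) / x a) l (𝓝 (dx F 0)) := by
  have h := (weighted_taylor_one hF hx (isBigO_refl x l)
    (isBigO_of_tendsto_div_sq hne hy)).tendsto_div_nhds_zero
  have h2 := h.add_const (dx F 0)
  rw [zero_add] at h2
  refine h2.congr' ?_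
  filter_upwards [hne] with a ha
  rw [h0]
  field_simp
  ring

theorem tendsto_apply (hF : ContDiff ℝ ∞ F)
    (hx : Tendsto x l (𝓝 0)) (hne : ∀ᶠ a in l, x a ≠ 0)
    (hy : Tendsto (fun a => y a / x a ^ 2) l (𝓝 c)) :
    Tendsto (fun a => F (x a, y a)) l (𝓝 (F 0)) :=
  (hF.continuous.tendsto 0).comp
    (tendsto_zero_pair hx (isBigO_refl x l) (isBigO_of_tendsto_div_sq hne hy))

end Weighted

/-! ### Graphs in normal form -/

/-- The function `y² / 2 - x² y + lam x⁴ / 2`, up to terms of weight greater than four, the weights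
of `x` and `y` being one and two. -/
structure IsNormalForm (f : ℝ × ℝ → ℝ) (lam : ℝ) : Prop where
  smooth : ContDiff ℝ ∞ f
  zero : f 0 = 0
  x : dx f 0 = 0
  y : dy f 0 = 0
  xx : dx (dx f) 0 = 0
  xy : dx (dy f) 0 = 0
  yy : dy (dy f) 0 = 1
  xxx : dx (dx (dx f)) 0 = 0
  xxy : dx (dx (dy f)) 0 = -2
  xxxx : dx (dx (dx (dx f))) 0 = 12 * lam

/-- The determinant of the Hessian form of a function. -/
noncomputable def hess (f : ℝ × ℝ → ℝ) (p : ℝ × ℝ) : ℝ :=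
  dx (dx f) p * dy (dy f) p - dx (dy f) p * dx (dy f) p

/-- The Hessian form of a function. -/
noncomputable def quadForm (f : ℝ × ℝ → ℝ) (p w : ℝ × ℝ) : ℝ :=
  w.1 ^ 2 * dx (dx f) p + 2 * (w.1 * w.2) * dx (dy f) p + w.2 ^ 2 * dy (dy f) p

/-- The form of third derivatives of a function. -/
noncomputable def cubicForm (f : ℝ × ℝ → ℝ) (p w : ℝ × ℝ) : ℝ :=
  w.1 ^ 3 * dx (dx (dx f)) p + 3 * (w.1 ^ 2 * w.2) * dx (dx (dy f)) p +
    3 * (w.1 * w.2 ^ 2) * dx (dy (dy f)) p + w.2 ^ 3 * dy (dy (dy f)) p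

theorem contDiff_hess {f : ℝ × ℝ → ℝ} (hf : ContDiff ℝ ∞ f) : ContDiff ℝ ∞ (hess f) :=
  ((contDiff_dx (contDiff_dx hf)).mul (contDiff_dy (contDiff_dy hf))).sub
    ((contDiff_dx (contDiff_dy hf)).mul (contDiff_dx (contDiff_dy hf)))

theorem dx_hess {f : ℝ × ℝ → ℝ} (hf : ContDiff ℝ ∞ f) : dx (hess f) = fun p =>
    dx (dx (dx f)) p * dy (dy f) p + dx (dx f) p * dx (dy (dy f)) p -
      (dx (dx (dy f)) p * dx (dy f) p + dx (dy f) p * dx (dx (dy f)) p) := by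
  have hx := contDiff_dx hf
  have hy := contDiff_dy hf
  have hxx := contDiff_dx hx
  have hxy := contDiff_dx hy
  have hyy := contDiff_dy hy
  change dx (fun p => dx (dx f) p * dy (dy f) p - dx (dy f) p * dx (dy f) p) = _
  rw [dx_sub (hxx.mul hyy) (hxy.mul hxy), dx_mul hxx hyy, dx_mul hxy hxy]

theorem dy_hess {f : ℝ × ℝ → ℝ} (hf : ContDiff ℝ ∞ f) : dy (hess f) = fun p =>
    dx (dx (dy f)) p * dy (dy f) p + dx (dx f) p * dy (dy (dy f)) p -
      (dx (dy (dy f)) p * dx (dy f) p + dx (dy f) p * dx (dy (dy f)) p) := by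
  have hx := contDiff_dx hf
  have hy := contDiff_dy hf
  have hxx := contDiff_dx hx
  have hxy := contDiff_dx hy
  have hyy := contDiff_dy hy
  change dy (fun p => dx (dx f) p * dy (dy f) p - dx (dy f) p * dx (dy f) p) = _
  rw [dy_sub (hxx.mul hyy) (hxy.mul hxy), dy_mul hxx hyy, dy_mul hxy hxy, dy_dx hx, dy_dx hf,
    dy_dx hy]

section Zeros

variable {α : Type*} {l : Filter α} {x y : α → ℝ} {F : ℝ × ℝ → ℝ}

/-- The zeros of a function with a horizontal regular level curve at the origin. -/
theorem tendsto_div_sq_of_zeros (hF : ContDiff ℝ ∞ F) (h0 : F 0 = 0) (h1 : dx F 0 = 0)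
    (h2 : dy F 0 ≠ 0) (hp : Tendsto (fun a => (x a, y a)) l (𝓝 0))
    (hne : ∀ᶠ a in l, (x a, y a) ≠ 0) (hz : ∀ᶠ a in l, F (x a, y a) = 0) :
    (∀ᶠ a in l, x a ≠ 0) ∧
      Tendsto (fun a => y a / x a ^ 2) l (𝓝 (-(dx (dx F) 0 / 2) / dy F 0)) := by
  set D := dy F 0 with hD
  set S := dx (dx F) 0 / 2 with hS
  have hW : (fun a => y a * D + x a ^ 2 * S) =o[l] fun a => |y a| + x a ^ 2 := by
    refine ((weighted_taylor hF).comp_tendsto hp).neg_left.congr' ?_ (Eventually.of_forall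
      fun _ => rfl)
    filter_upwards [hz] with a ha
    simp only [Function.comp, ha, h0, h1]
    ring
  have hDpos : 0 < |D| := abs_pos.2 h2
  -- With error constant |D| / 2 the unknown |y| on the right is absorbed by the left side.
  have hb : ∀ᶠ a in l, |y a| ≤ (1 + 2 * |S| / |D|) * x a ^ 2 := by
    filter_upwards [hW.bound (half_pos hDpos)] with a ha
    rw [Real.norm_eq_abs, Real.norm_eq_abs, abs_of_nonneg (a := |y a| + x a ^ 2)
      (by positivity)] at ha
    have h3 : |y a| * |D| ≤ |y a * D + x a ^ 2 * S| + x a ^ 2 * |S| := by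
      have := abs_sub (y a * D + x a ^ 2 * S) (x a ^ 2 * S)
      rw [add_sub_cancel_right, abs_mul, abs_mul (x a ^ 2), abs_of_nonneg (sq_nonneg (x a))] at this
      exact this
    have h4 : |y a| * |D| ≤ (1 + 2 * |S| / |D|) * x a ^ 2 * |D| := by
      have : (1 + 2 * |S| / |D|) * x a ^ 2 * |D| = x a ^ 2 * |D| + 2 * (x a ^ 2 * |S|) := by
        field_simp
      rw [this]
      linarith
    exact le_of_mul_le_mul_right h4 hDpos
  have hx : ∀ᶠ a in l, x a ≠ 0 := by
    filter_upwards [hb, hne] with a ha hn hx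
    apply hn
    rw [hx] at ha ⊢
    have : y a = 0 := abs_nonpos_iff.1 (by simpa using ha)
    rw [this]
    rfl
  refine ⟨hx, ?_⟩
  have hO : (fun a => |y a| + x a ^ 2) =O[l] fun a => x a ^ 2 := by
    refine IsBigO.of_bound (1 + 2 * |S| / |D| + 1) ?_
    filter_upwards [hb] with a ha
    rw [Real.norm_eq_abs, Real.norm_eq_abs, abs_of_nonneg (a := |y a| + x a ^ 2) (by positivity),
      abs_of_nonneg (a := x a ^ 2) (by positivity)]
    linarith
  have h5 := (((hW.trans_isBigO hO).tendsto_div_nhds_zero).sub_const S).div_const D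
  rw [zero_sub] at h5
  refine h5.congr' ?_
  filter_upwards [hx] with a ha
  field_simp
  ring

end Zeros

namespace IsNormalForm

variable {f : ℝ × ℝ → ℝ} {lam : ℝ} (h : IsNormalForm f lam)
include h

theorem hess_zero : hess f 0 = 0 := by
  simp [hess, h.xx, h.xy]

theorem dx_hess_zero : dx (hess f) 0 = 0 := by
  simp [dx_hess h.smooth, h.xx, h.xy, h.xxx]

theorem dy_hess_zero : dy (hess f) 0 = -2 := by
  simp [dy_hess h.smooth, h.xx, h.xy, h.xxy, h.yy]

/-- Only f_xxxx f_yy - 2 f_xxy² survives at the origin. -/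
theorem dx_dx_hess_zero : dx (dx (hess f)) 0 = 12 * lam - 8 := by
  have hx := contDiff_dx h.smooth
  have hy := contDiff_dy h.smooth
  have hxx := contDiff_dx hx
  have hxy := contDiff_dx hy
  have hyy := contDiff_dy hy
  have hxxx := contDiff_dx hxx
  have hxxy := contDiff_dx hxy
  have hxyy := contDiff_dx hyy
  rw [dx_hess h.smooth, dx_sub ((hxxx.mul hyy).add (hxx.mul hxyy))
    ((hxxy.mul hxy).add (hxy.mul hxxy)), dx_add (hxxx.mul hyy) (hxx.mul hxyy),
    dx_add (hxxy.mul hxy) (hxy.mul hxxy), dx_mul hxxx hyy, dx_mul hxx hxyy, dx_mul hxxy hxy,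
    dx_mul hxy hxxy]
  simp only [h.xx, h.xy, h.yy, h.xxx, h.xxy, h.xxxx]
  ring

theorem dy_xx : dy (dx (dx f)) 0 = -2 := by
  rw [dy_dx (contDiff_dx h.smooth), dy_dx h.smooth, h.xxy]

/-! ### Coefficients of the parabolic and the flecnodal curve -/

section

variable {α : Type*} {l : Filter α} {x y : α → ℝ} {c : ℝ}

/-- The sign of the limit decides on which side of the parabolic curve a curve y ~ c x² lies. -/
theorem tendsto_hess (hx : Tendsto x l (𝓝 0)) (hne : ∀ᶠ a in l, x a ≠ 0)
    (hy : Tendsto (fun a => y a / x a ^ 2) l (𝓝 c)) :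
    Tendsto (fun a => hess f (x a, y a) / x a ^ 2) l (𝓝 (-2 * (c - (3 * lam - 2)))) := by
  have := tendsto_div_sq (contDiff_hess h.smooth) h.hess_zero h.dx_hess_zero hx hne hy
  rw [h.dy_hess_zero, h.dx_dx_hess_zero] at this
  convert this using 2
  ring

theorem parabolic_coeff [l.NeBot] (hx : Tendsto x l (𝓝 0)) (hne : ∀ᶠ a in l, x a ≠ 0)
    (hy : Tendsto (fun a => y a / x a ^ 2) l (𝓝 c)) (hz : ∀ᶠ a in l, hess f (x a, y a) = 0) :
    c = 3 * lam - 2 := by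
  have h1 := h.tendsto_hess hx hne hy
  have h2 : Tendsto (fun a => hess f (x a, y a) / x a ^ 2) l (𝓝 0) :=
    tendsto_const_nhds.congr' (by filter_upwards [hz] with a ha; rw [ha, zero_div])
  have := tendsto_nhds_unique h1 h2
  linarith

/-- The cubic equation determines the asymptotic slope, m ~ 2λx; the quadratic equation at order x²
then reads -2c + 6λ - 8λ + 4λ² = 0. -/
theorem flecnodal_coeff [l.NeBot] (hx : Tendsto x l (𝓝 0)) (hne : ∀ᶠ a in l, x a ≠ 0)
    (hy : Tendsto (fun a => y a / x a ^ 2) l (𝓝 c))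
    (hz : ∀ᶠ a in l, ∃ w : ℝ × ℝ, w ≠ 0 ∧ quadForm f (x a, y a) w = 0 ∧
      cubicForm f (x a, y a) w = 0) : c = lam * (2 * lam - 1) := by
  have sx := contDiff_dx h.smooth
  have sy := contDiff_dy h.smooth
  have sxx := contDiff_dx sx
  have sxy := contDiff_dx sy
  have syy := contDiff_dy sy
  have lyy := tendsto_apply syy hx hne hy
  rw [h.yy] at lyy
  have hyy : ∀ᶠ a in l, dy (dy f) (x a, y a) ≠ 0 := lyy.eventually_ne one_ne_zero
  -- Since f_yy is close to 1, no asymptotic direction is vertical, and w can be scaled to (1, m).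
  have hm : ∀ᶠ a in l, ∃ m : ℝ, quadForm f (x a, y a) (1, m) = 0 ∧
      cubicForm f (x a, y a) (1, m) = 0 := by
    filter_upwards [hz, hyy] with a ⟨w, hw, hq, hc⟩ ha
    have hw1 : w.1 ≠ 0 := by
      intro h1
      have hw2 : w.2 ≠ 0 := fun h2 => hw (Prod.ext h1 h2)
      simp [quadForm, h1, hw2, ha] at hq
    refine ⟨w.2 / w.1, ?_, ?_⟩
    · have : quadForm f (x a, y a) (1, w.2 / w.1) = quadForm f (x a, y a) w / w.1 ^ 2 := by
        simp only [quadForm]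
        field_simp
      rw [this, hq, zero_div]
    · have : cubicForm f (x a, y a) (1, w.2 / w.1) = cubicForm f (x a, y a) w / w.1 ^ 3 := by
        simp only [cubicForm]
        field_simp
      rw [this, hc, zero_div]
  obtain ⟨m, hm⟩ := Filter.skolem.1 hm
  have lH := tendsto_apply (contDiff_hess h.smooth) hx hne hy
  rw [h.hess_zero] at lH
  have lxy := tendsto_apply sxy hx hne hy
  rw [h.xy] at lxy
  -- The quadratic equation says (f_yy m + f_xy)² = -hess f, and the right side tends to 0.
  have lm : Tendsto m l (𝓝 0) := by
    have h1 : Tendsto (fun a => dy (dy f) (x a, y a) * m a + dx (dy f) (x a, y a)) l (𝓝 0) := by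
      have h2 : Tendsto (fun a => √(-hess f (x a, y a))) l (𝓝 0) := by
        simpa using lH.neg.sqrt
      refine (tendsto_zero_iff_abs_tendsto_zero _).2 (h2.congr' ?_)
      filter_upwards [hm] with a ha
      have hq := ha.1
      simp only [quadForm] at hq
      rw [Function.comp, ← Real.sqrt_sq_eq_abs]
      congr 1
      simp only [hess]
      linear_combination (-dy (dy f) (x a, y a)) * hq
    have h2 := (h1.sub lxy).div lyy one_ne_zero
    simp only [sub_zero, zero_div] at h2
    refine h2.congr' ?_
    filter_upwards [hyy] with a ha
    simp only [Pi.div_apply]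
    field_simp
    ring
  -- The cubic form at (1, m) is f_xxx + m times this factor, which tends to 3 f_xxy(0) = -6. With
  -- f_xxx ~ 12λx this gives m / x → 2λ.
  have lD : Tendsto (fun a => 3 * dx (dx (dy f)) (x a, y a) + 3 * m a * dx (dy (dy f)) (x a, y a) +
      m a ^ 2 * dy (dy (dy f)) (x a, y a)) l (𝓝 (-6)) := by
    have := (((tendsto_apply (contDiff_dx sxy) hx hne hy).const_mul 3).add
      ((lm.const_mul 3).mul (tendsto_apply (contDiff_dx syy) hx hne hy))).add
      ((lm.pow 2).mul (tendsto_apply (contDiff_dy syy) hx hne hy))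
    rw [h.xxy] at this
    convert this using 2
    ring
  have lmx : Tendsto (fun a => m a / x a) l (𝓝 (2 * lam)) := by
    have h1 := (tendsto_div (contDiff_dx sxx) h.xxx hx hne hy).neg.div lD (by norm_num)
    rw [h.xxxx] at h1
    have h2 : -(12 * lam) / -6 = 2 * lam := by ring
    rw [h2] at h1
    refine h1.congr' ?_
    filter_upwards [hm, hne, lD.eventually_ne (by norm_num : (-6 : ℝ) ≠ 0)] with a ha hxa hd
    have hc := ha.2
    simp only [cubicForm] at hc
    simp only [Pi.div_apply]
    rw [div_eq_iff hd]
    field_simp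
    linear_combination -hc
  have l1 := tendsto_div_sq sxx h.xx h.xxx hx hne hy
  have l2 := tendsto_div sxy h.xy hx hne hy
  have l3 := (l1.add ((lmx.const_mul 2).mul l2)).add ((lmx.pow 2).mul lyy)
  have l4 : Tendsto (fun a => dx (dx f) (x a, y a) / x a ^ 2 +
      2 * (m a / x a) * (dx (dy f) (x a, y a) / x a) + (m a / x a) ^ 2 * dy (dy f) (x a, y a))
      l (𝓝 0) := by
    refine tendsto_const_nhds.congr' ?_
    filter_upwards [hm, hne] with a ha hxa
    have hq := ha.1
    simp only [quadForm] at hq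
    field_simp
    linear_combination -hq
  have := tendsto_nhds_unique l3 l4
  rw [h.dy_xx, h.xxxx, h.xxy] at this
  linarith

end

/-! ### Asymptotic directions at parabolic points -/

theorem eventually_dy_dy_pos : ∀ᶠ p in 𝓝 (0 : ℝ × ℝ), 0 < dy (dy f) p :=
  ((contDiff_dy (contDiff_dy h.smooth)).continuous.tendsto 0).eventually_const_lt
    (by rw [h.yy]; exact one_pos)

/-- At nearby parabolic points the derivative of the Hessian determinant along the asymptotic
direction `(1, -f_xy / f_yy)` is governed by the sign of `lam - 1`. -/
theorem tendsto_dhess_asymptotic {α : Type*} {l : Filter α} {x y : α → ℝ}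
    (hp : Tendsto (fun a => (x a, y a)) l (𝓝 0))
    (hne : ∀ᶠ a in l, (x a, y a) ≠ 0) (hz : ∀ᶠ a in l, hess f (x a, y a) = 0) :
    (∀ᶠ a in l, x a ≠ 0) ∧ (∃ c, Tendsto (fun a => y a / x a ^ 2) l (𝓝 c)) ∧
      Tendsto (fun a => -dx (dy f) (x a, y a) / dy (dy f) (x a, y a)) l (𝓝 0) ∧
      Tendsto (fun a => (dx (hess f) (x a, y a) +
        -dx (dy f) (x a, y a) / dy (dy f) (x a, y a) * dy (hess f) (x a, y a)) / x a) l
        (𝓝 (12 * (lam - 1))) := by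
  have sH := contDiff_hess h.smooth
  have sy := contDiff_dy h.smooth
  obtain ⟨hx0, hy⟩ := tendsto_div_sq_of_zeros sH h.hess_zero h.dx_hess_zero
    (by rw [h.dy_hess_zero]; norm_num) hp hne hz
  have hx : Tendsto x l (𝓝 0) := (continuous_fst.tendsto (0 : ℝ × ℝ)).comp hp
  have lyy := tendsto_apply (contDiff_dy sy) hx hx0 hy
  have lxy := tendsto_apply (contDiff_dx sy) hx hx0 hy
  have lxy' := tendsto_div (contDiff_dx sy) h.xy hx hx0 hy
  rw [h.yy] at lyy
  rw [h.xy] at lxy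
  rw [h.xxy] at lxy'
  refine ⟨hx0, ⟨_, hy⟩, ?_, ?_⟩
  · have := lxy.neg.div lyy one_ne_zero
    rwa [neg_zero, zero_div] at this
  -- After division by x the first term tends to 12λ - 8, and the second to slope 2 times hess_y =
  -- -2.
  · have h1 := (tendsto_div (contDiff_dx sH) h.dx_hess_zero hx hx0 hy).add
      ((lxy'.neg.div lyy one_ne_zero).mul (tendsto_apply (contDiff_dy sH) hx hx0 hy))
    rw [h.dx_dx_hess_zero, h.dy_hess_zero] at h1
    have h2 : 12 * lam - 8 + - -2 / 1 * -2 = 12 * (lam - 1) := by ring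
    rw [h2] at h1
    refine h1.congr' ?_
    filter_upwards [hx0] with a ha
    simp only [Pi.div_apply]
    ring

end IsNormalForm

/-- Where the Hessian determinant vanishes, f_yy times the form is the square of f_yy w₂ + f_xy w₁.
-/
theorem quadForm_eq_zero_iff {f : ℝ × ℝ → ℝ} {p : ℝ × ℝ} (hp : hess f p = 0)
    (hyy : dy (dy f) p ≠ 0) (w : ℝ × ℝ) :
    quadForm f p w = 0 ↔ w.2 = w.1 * (-dx (dy f) p / dy (dy f) p) := by
  have h1 : dy (dy f) p * quadForm f p w = (dy (dy f) p * w.2 + w.1 * dx (dy f) p) ^ 2 := by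
    simp only [quadForm, hess] at *
    linear_combination w.1 ^ 2 * hp
  constructor
  · intro hq
    rw [hq, mul_zero, eq_comm, sq_eq_zero_iff] at h1
    field_simp
    linarith
  · intro hw
    have h2 : dy (dy f) p * w.2 + w.1 * dx (dy f) p = 0 := by
      rw [hw]
      field_simp
      ring
    rw [h2] at h1
    exact (mul_eq_zero.1 (h1.trans (by ring))).resolve_left hyy

/-! ### Implicit functions -/

theorem exists_contDiff_localInverse_of_injective {φ : ℝ × ℝ → ℝ × ℝ} (hφ : ContDiff ℝ ∞ φ)
    {a : ℝ × ℝ} (h' : ∀ v, fderiv ℝ φ a v = 0 → v = 0) :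
    ∃ ψ : ℝ × ℝ → ℝ × ℝ, ContDiff ℝ ∞ ψ ∧ ψ (φ a) = a ∧ (∀ᶠ u in 𝓝 a, ψ (φ u) = u) ∧
      (∀ᶠ p in 𝓝 (φ a), φ (ψ p) = p) := by
  have hinj : Function.Injective (fderiv ℝ φ a : ℝ × ℝ →ₗ[ℝ] ℝ × ℝ) :=
    (injective_iff_map_eq_zero _).2 h'
  let L : (ℝ × ℝ) ≃L[ℝ] (ℝ × ℝ) := (LinearEquiv.ofInjectiveEndo _ hinj).toContinuousLinearEquiv
  have hL : HasFDerivAt φ (L : ℝ × ℝ →L[ℝ] ℝ × ℝ) a := by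
    have : (L : ℝ × ℝ →L[ℝ] ℝ × ℝ) = fderiv ℝ φ a :=
      ContinuousLinearMap.ext fun _ => rfl
    rw [this]
    exact hasFDerivAt_of_contDiff hφ a
  obtain ⟨ψ, h1, h2, h3, h4, -⟩ := exists_contDiff_localInverse hφ hL
  exact ⟨ψ, h1, h2, h3, h4⟩

/-- `Y` is the second component of the local inverse of (x, y) ↦ (x, F(x, y)). Keeping the value of
F as a parameter serves both the Legendre transform and the contour. -/
theorem exists_implicit {F : ℝ × ℝ → ℝ} (hF : ContDiff ℝ ∞ F) (h0 : F 0 = 0) (h1 : dy F 0 ≠ 0) :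
    ∃ Y : ℝ × ℝ → ℝ, ContDiff ℝ ∞ Y ∧ Y 0 = 0 ∧ (∀ᶠ p in 𝓝 0, Y (p.1, F p) = p.2) ∧
      (∀ᶠ z in 𝓝 0, F (z.1, Y z) = z.2) := by
  have hφ : ContDiff ℝ ∞ fun p : ℝ × ℝ => (p.1, F p) := contDiff_fst.prodMk hF
  have hd : HasFDerivAt (fun p : ℝ × ℝ => (p.1, F p))
      ((ContinuousLinearMap.fst ℝ ℝ ℝ).prod (fderiv ℝ F 0)) 0 :=
    hasFDerivAt_fst.prodMk (hasFDerivAt_of_contDiff hF 0)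
  obtain ⟨ψ, hψ, hψ0, hl, hr⟩ := exists_contDiff_localInverse_of_injective hφ (a := 0) (by
    intro v hv
    rw [hd.fderiv] at hv
    simp only [ContinuousLinearMap.prod_apply, ContinuousLinearMap.coe_fst', Prod.mk_eq_zero,
      fderiv_eq_dx_dy] at hv
    obtain ⟨hv1, hv2⟩ := hv
    rw [hv1, zero_mul, zero_add] at hv2
    exact Prod.ext hv1 ((mul_eq_zero.1 hv2).resolve_right h1))
  have h00 : ((0 : ℝ × ℝ).1, F 0) = 0 := by rw [h0]; rfl
  rw [h00] at hψ0 hr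
  refine ⟨fun z => (ψ z).2, contDiff_snd.comp hψ, congrArg Prod.snd hψ0, ?_, ?_⟩
  · filter_upwards [hl] with p hp
    rw [hp]
  · filter_upwards [hr] with z hz
    have hz1 : (ψ z).1 = z.1 := (Prod.ext_iff.1 hz).1
    have hz2 : F (ψ z) = z.2 := (Prod.ext_iff.1 hz).2
    rw [← hz1]
    exact hz2

/-! ### Contours -/

/-- The height, at the origin, of the tangent plane of the graph of `f` at `p`. -/
noncomputable def tangentHeight (f : ℝ × ℝ → ℝ) (p : ℝ × ℝ) : ℝ :=
  f p - (p.1 * dx f p + p.2 * dy f p)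

section

variable {f : ℝ × ℝ → ℝ}

theorem contDiff_tangentHeight (hf : ContDiff ℝ ∞ f) : ContDiff ℝ ∞ (tangentHeight f) :=
  hf.sub ((contDiff_fst.mul (contDiff_dx hf)).add (contDiff_snd.mul (contDiff_dy hf)))

theorem dx_fst : dx (fun p : ℝ × ℝ => p.1) = fun _ => 1 := by
  funext p
  rw [dx, show fderiv ℝ (fun p : ℝ × ℝ => p.1) p = _ from hasFDerivAt_fst.fderiv]
  rfl

theorem dx_snd : dx (fun p : ℝ × ℝ => p.2) = fun _ => 0 := by
  funext p
  rw [dx, show fderiv ℝ (fun p : ℝ × ℝ => p.2) p = _ from hasFDerivAt_snd.fderiv]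
  rfl

theorem dy_fst : dy (fun p : ℝ × ℝ => p.1) = fun _ => 0 := by
  funext p
  rw [dy, show fderiv ℝ (fun p : ℝ × ℝ => p.1) p = _ from hasFDerivAt_fst.fderiv]
  rfl

theorem dy_snd : dy (fun p : ℝ × ℝ => p.2) = fun _ => 1 := by
  funext p
  rw [dy, show fderiv ℝ (fun p : ℝ × ℝ => p.2) p = _ from hasFDerivAt_snd.fderiv]
  rfl

theorem dy_const (c : ℝ) : dy (fun _ : ℝ × ℝ => c) = fun _ => 0 := by
  funext p
  rw [dy, fderiv_const_apply]
  rfl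

theorem dx_tangentHeight (hf : ContDiff ℝ ∞ f) : dx (tangentHeight f) = fun p =>
    -(p.1 * dx (dx f) p + p.2 * dx (dy f) p) := by
  have sx := contDiff_dx hf
  have sy := contDiff_dy hf
  have s1 : ContDiff ℝ ∞ fun p : ℝ × ℝ => p.1 := contDiff_fst
  have s2 : ContDiff ℝ ∞ fun p : ℝ × ℝ => p.2 := contDiff_snd
  change dx (fun p => f p - (p.1 * dx f p + p.2 * dy f p)) = _
  rw [dx_sub hf ((s1.mul sx).add (s2.mul sy)), dx_add (s1.mul sx) (s2.mul sy), dx_mul s1 sx,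
    dx_mul s2 sy, dx_fst, dx_snd]
  funext p
  ring

theorem dy_tangentHeight (hf : ContDiff ℝ ∞ f) : dy (tangentHeight f) = fun p =>
    -(p.1 * dx (dy f) p + p.2 * dy (dy f) p) := by
  have sx := contDiff_dx hf
  have sy := contDiff_dy hf
  have s1 : ContDiff ℝ ∞ fun p : ℝ × ℝ => p.1 := contDiff_fst
  have s2 : ContDiff ℝ ∞ fun p : ℝ × ℝ => p.2 := contDiff_snd
  change dy (fun p => f p - (p.1 * dx f p + p.2 * dy f p)) = _
  rw [dy_sub hf ((s1.mul sx).add (s2.mul sy)), dy_add (s1.mul sx) (s2.mul sy), dy_mul s1 sx,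
    dy_mul s2 sy, dy_fst, dy_snd, dy_dx hf]
  funext p
  ring

end

theorem tendsto_id_nhdsNE : Tendsto (fun x : ℝ => x) (𝓝[≠] 0) (𝓝 0) :=
  tendsto_nhdsWithin_of_tendsto_nhds tendsto_id

theorem tendsto_div_sq_of_deriv_eq_zero {g : ℝ → ℝ} (hg : ContDiff ℝ ∞ g) (h0 : g 0 = 0)
    (h1 : deriv g 0 = 0) :
    Tendsto (fun x => g x / x ^ 2) (𝓝[≠] 0) (𝓝 (deriv (deriv g) 0 / 2)) := by
  have h2 := ((taylor_two hg).mono nhdsWithin_le_nhds).tendsto_div_nhds_zero (l := 𝓝[≠] 0)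
  have h3 := h2.add_const (deriv (deriv g) 0 / 2)
  rw [zero_add] at h3
  refine h3.congr' ?_
  filter_upwards [self_mem_nhdsWithin] with x hx
  have : x ≠ 0 := hx
  rw [h0, h1]
  field_simp
  ring

theorem deriv_eq_zero_of_tendsto_div {g : ℝ → ℝ} (hg : ContDiff ℝ ∞ g) (h0 : g 0 = 0)
    (h1 : Tendsto (fun x => g x / x) (𝓝[≠] 0) (𝓝 0)) : deriv g 0 = 0 := by
  have h2 := (hg.differentiable (by simp) 0).hasDerivAt.tendsto_slope
  refine tendsto_nhds_unique h2 (h1.congr' ?_)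
  filter_upwards with x
  simp [slope_def_field, h0]

theorem tendsto_div_of_tendsto_div_sq {g : ℝ → ℝ} {c : ℝ}
    (h : Tendsto (fun x => g x / x ^ 2) (𝓝[≠] 0) (𝓝 c)) :
    Tendsto (fun x => g x / x) (𝓝[≠] 0) (𝓝 0) := by
  have := h.mul tendsto_id_nhdsNE
  rw [mul_zero] at this
  refine this.congr' ?_
  filter_upwards [self_mem_nhdsWithin] with x hx
  have : x ≠ 0 := hx
  field_simp

namespace IsNormalForm

variable {f : ℝ × ℝ → ℝ} {lam : ℝ} (h : IsNormalForm f lam)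
include h

/-- The y-derivative of the tangent height is 2x² - y to leading order, and its own y-derivative at
0 is -1. The curve β is the centre for completing the square in y. -/
theorem exists_critical_curve : ∃ β : ℝ → ℝ, ContDiff ℝ ∞ β ∧ β 0 = 0 ∧
    (∀ᶠ x in 𝓝 0, dy (tangentHeight f) (x, β x) = 0) ∧
    Tendsto (fun x => β x / x ^ 2) (𝓝[≠] 0) (𝓝 2) := by
  have sy := contDiff_dy h.smooth
  have sxy := contDiff_dx sy
  have syy := contDiff_dy sy
  have sF := contDiff_dy (contDiff_tangentHeight h.smooth)
  have hF := dy_tangentHeight h.smooth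
  have hF0 : dy (tangentHeight f) 0 = 0 := by simp [hF]
  have hyy : dy (dy (tangentHeight f)) 0 ≠ 0 := by
    have s1 : ContDiff ℝ ∞ fun p : ℝ × ℝ => p.1 * dx (dy f) p := contDiff_fst.mul sxy
    have s2 : ContDiff ℝ ∞ fun p : ℝ × ℝ => p.2 * dy (dy f) p := contDiff_snd.mul syy
    have : dy (tangentHeight f) = fun p => 0 - (p.1 * dx (dy f) p + p.2 * dy (dy f) p) := by
      rw [hF]
      funext p
      ring
    rw [this, dy_sub contDiff_const (s1.add s2), dy_add s1 s2, dy_mul contDiff_fst sxy,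
      dy_mul contDiff_snd syy, dy_fst, dy_snd, dy_const]
    simp [h.yy]
  obtain ⟨Y, sY, hY0, -, hY⟩ := exists_implicit sF hF0 hyy
  have sβ : ContDiff ℝ ∞ fun x : ℝ => Y (x, 0) := sY.comp (by fun_prop)
  have hpair : Tendsto (fun x : ℝ => (x, (0 : ℝ))) (𝓝 0) (𝓝 0) := by
    have : Continuous fun x : ℝ => (x, (0 : ℝ)) := by fun_prop
    exact this.tendsto 0
  have hβ : ∀ᶠ x in 𝓝 (0 : ℝ), dy (tangentHeight f) (x, Y (x, 0)) = 0 := hpair.eventually hY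
  have hne : ∀ᶠ x in 𝓝[≠] (0 : ℝ), x ≠ 0 := self_mem_nhdsWithin
  have hcont : Tendsto (fun x => (x, Y (x, 0))) (𝓝[≠] (0 : ℝ)) (𝓝 0) := by
    have : Continuous fun x : ℝ => (x, Y (x, 0)) := continuous_id.prodMk sβ.continuous
    have h2 := this.tendsto 0
    have h3 : ((0 : ℝ), Y (0, 0)) = 0 := by
      rw [Prod.mk_zero_zero, hY0]
      rfl
    rw [h3] at h2
    exact tendsto_nhdsWithin_of_tendsto_nhds h2
  have lyy : Tendsto (fun x => dy (dy f) (x, Y (x, 0))) (𝓝[≠] 0) (𝓝 1) := by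
    have := (syy.continuous.tendsto 0).comp hcont
    rwa [h.yy] at this
  have lxy : Tendsto (fun x => dx (dy f) (x, Y (x, 0))) (𝓝[≠] 0) (𝓝 0) := by
    have := (sxy.continuous.tendsto 0).comp hcont
    rwa [h.xy] at this
  -- This fixed-point form is used twice: f_xy → 0 gives β = o(x), so β / x² has some limit, and
  -- f_xy ~ -2x then shows that this limit is 2.
  have heq : ∀ᶠ x in 𝓝[≠] (0 : ℝ),
      Y (x, 0) = x * (-dx (dy f) (x, Y (x, 0)) / dy (dy f) (x, Y (x, 0))) := by
    filter_upwards [nhdsWithin_le_nhds hβ, lyy.eventually_ne one_ne_zero] with x hx hy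
    rw [hF] at hx
    simp only at hx
    field_simp
    linarith
  have h1 : Tendsto (fun x => Y (x, 0) / x) (𝓝[≠] 0) (𝓝 0) := by
    have := lxy.neg.div lyy one_ne_zero
    rw [neg_zero, zero_div] at this
    refine this.congr' ?_
    filter_upwards [heq, hne] with x hx hx0
    rw [eq_div_iff hx0, mul_comm]
    exact hx.symm
  have h2 := tendsto_div_sq_of_deriv_eq_zero sβ hY0 (deriv_eq_zero_of_tendsto_div sβ hY0 h1)
  have h3 : Tendsto (fun x => Y (x, 0) / x ^ 2) (𝓝[≠] 0) (𝓝 2) := by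
    have := (tendsto_div sxy h.xy tendsto_id_nhdsNE hne h2).neg.div lyy one_ne_zero
    rw [h.xxy, neg_neg, div_one] at this
    refine this.congr' ?_
    filter_upwards [heq, hne] with x hx hx0
    rw [eq_div_iff (pow_ne_zero 2 hx0)]
    conv_rhs => rw [hx]
    simp only [Pi.div_apply]
    field_simp
  exact ⟨_, sβ, hY0, hβ, h3⟩

/-- A Morse lemma in y with parameter x. The critical value is x⁴ k(x), and the quotient E by the
square is close to half the second y-derivative, that is -1/2. -/
theorem exists_contour_factorization : ∃ (β k : ℝ → ℝ) (E : ℝ × ℝ → ℝ),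
    ContDiff ℝ ∞ β ∧ ContDiff ℝ ∞ k ∧ ContDiff ℝ ∞ E ∧ β 0 = 0 ∧
    Tendsto (fun x => β x / x ^ 2) (𝓝[≠] 0) (𝓝 2) ∧ k 0 = (4 - 3 * lam) / 2 ∧ E 0 = -1 / 2 ∧
    ∀ᶠ p in 𝓝 0, tangentHeight f p = p.1 ^ 4 * k p.1 + (p.2 - β p.1) ^ 2 * E p := by
  obtain ⟨β, sβ, hβ0, hβ, hlim⟩ := h.exists_critical_curve
  have sy := contDiff_dy h.smooth
  have sx := contDiff_dx h.smooth
  have sK := contDiff_tangentHeight h.smooth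
  set K := tangentHeight f with hKdef
  have hK0 : K 0 = 0 := by simp [hKdef, tangentHeight, h.zero]
  have sκ : ContDiff ℝ ∞ fun x => K (x, β x) := sK.comp (contDiff_id.prodMk sβ)
  have hne : ∀ᶠ x in 𝓝[≠] (0 : ℝ), x ≠ 0 := self_mem_nhdsWithin
  have hκ0 : K (0, β 0) = 0 := by rw [hβ0]; exact hK0
  -- On the critical curve K_y = 0, so only K_x contributes; the order of the critical value then
  -- follows by l'Hôpital.
  have hdκ : ∀ᶠ x in 𝓝[≠] (0 : ℝ), deriv (fun x => K (x, β x)) x =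
      -(x * dx (dx f) (x, β x) + β x * dx (dy f) (x, β x)) := by
    filter_upwards [nhdsWithin_le_nhds hβ] with x hx
    have h1 : HasDerivAt (fun x => (x, β x)) (1, deriv β x) x :=
      (hasDerivAt_id x).prodMk (sβ.differentiable (by simp) x).hasDerivAt
    have h2 := (hasDerivAt_comp_curve sK h1).deriv
    rw [h2, hx, mul_zero, add_zero, one_mul, hKdef, dx_tangentHeight h.smooth]
  have lκ : Tendsto (fun x => K (x, β x) / x ^ 4) (𝓝[≠] 0) (𝓝 ((4 - 3 * lam) / 2)) := by
    have c4 : ∀ x : ℝ, HasDerivAt (fun x : ℝ => x ^ 4) (4 * x ^ 3) x := fun x => by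
      simpa using hasDerivAt_pow 4 x
    refine deriv.lhopital_zero_nhdsNE (f := fun x => K (x, β x)) (g := fun x => x ^ 4) ?_ ?_ ?_ ?_ ?_
    · exact Eventually.of_forall fun x => sκ.differentiable (by simp) x
    · filter_upwards [hne] with x hx
      rw [(c4 x).deriv]
      positivity
    · have := sκ.continuous.tendsto 0
      simp only [hκ0] at this
      exact tendsto_nhdsWithin_of_tendsto_nhds this
    · have : Continuous fun x : ℝ => x ^ 4 := by fun_prop
      have := this.tendsto 0
      exact tendsto_nhdsWithin_of_tendsto_nhds (by simpa using this)
    · have l1 := tendsto_div_sq (contDiff_dx sx) h.xx h.xxx tendsto_id_nhdsNE hne hlim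
      have l2 := tendsto_div (contDiff_dx sy) h.xy tendsto_id_nhdsNE hne hlim
      have l3 := ((l1.add (hlim.mul l2)).neg).div_const 4
      rw [h.dy_xx, h.xxxx, h.xxy] at l3
      have e : -(2 * -2 + 12 * lam / 2 + 2 * -2) / 4 = (4 - 3 * lam) / 2 := by ring
      rw [e] at l3
      refine l3.congr' ?_
      filter_upwards [hdκ, hne] with x hx hx0
      rw [hx, (c4 x).deriv]
      field_simp
  obtain ⟨k, sk, hk0, hk⟩ := exists_eq_pow_mul 4 sκ lκ
  -- Hadamard's lemma is applied twice in the variable y - β(x). The second factor comes out because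
  -- the first quotient at 0 is K_y(x, β(x)) = 0.
  have sF : ContDiff ℝ ∞ fun q : ℝ × ℝ => K (q.1, β q.1 + q.2) - K (q.1, β q.1) := by
    refine (sK.comp (contDiff_fst.prodMk ((sβ.comp contDiff_fst).add contDiff_snd))).sub
      (sκ.comp contDiff_fst)
  obtain ⟨G, sG, hG⟩ := exists_eq_mul_of_eq_zero sF (fun p => by simp)
  simp only at hG
  obtain ⟨E, sE, hE⟩ := exists_eq_mul_of_eq_zero
    (f := fun q : ℝ × ℝ => G q - G (q.1, 0)) (sG.sub (sG.comp (by fun_prop))) (fun p => by simp)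
  simp only at hE
  have hG0 : ∀ x, G (x, 0) = dy K (x, β x) := by
    intro x
    have h1 : HasDerivAt (fun t => (x, β x + t)) ((0 : ℝ), (1 : ℝ)) 0 := by
      simpa using (hasDerivAt_const (0 : ℝ) x).prodMk ((hasDerivAt_id (0 : ℝ)).const_add (β x))
    have h2 := (hasDerivAt_comp_curve sK h1).sub_const (K (x, β x))
    have h3 : HasDerivAt (fun t => t * G (x, t)) (G (x, 0)) 0 := by
      have sG' : ContDiff ℝ ∞ fun t => G (x, t) := sG.comp (by fun_prop)
      have := (hasDerivAt_id' (0 : ℝ)).fun_mul (sG'.differentiable (by simp) 0).hasDerivAt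
      simpa using this
    have h4 := h3.unique (h2.congr_of_eventuallyEq (Eventually.of_forall fun t => (hG x t).symm))
    simpa using h4
  have hE0 : E 0 = -1 / 2 := by
    have hKy0 : dy K 0 = 0 := by rw [hKdef, dy_tangentHeight h.smooth]; simp
    have hKyy0 : dy (dy K) 0 = -1 := by
      have s1 : ContDiff ℝ ∞ fun p : ℝ × ℝ => p.1 * dx (dy f) p :=
        contDiff_fst.mul (contDiff_dx sy)
      have s2 : ContDiff ℝ ∞ fun p : ℝ × ℝ => p.2 * dy (dy f) p :=
        contDiff_snd.mul (contDiff_dy sy)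
      have : dy K = fun p => 0 - (p.1 * dx (dy f) p + p.2 * dy (dy f) p) := by
        rw [hKdef, dy_tangentHeight h.smooth]
        funext p
        ring
      rw [this, dy_sub contDiff_const (s1.add s2), dy_add s1 s2,
        dy_mul contDiff_fst (contDiff_dx sy), dy_mul contDiff_snd (contDiff_dy sy), dy_fst, dy_snd,
        dy_const]
      simp [h.yy]
    have hd : ∀ {G : ℝ × ℝ → ℝ}, ContDiff ℝ ∞ G →
        deriv (fun t : ℝ => G (0, t)) = fun t => dy G (0, t) := by
      intro G hG
      funext t
      have := hasDerivAt_comp_curve hG ((hasDerivAt_const t (0 : ℝ)).prodMk (hasDerivAt_id t))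
      simpa using this.deriv
    have sK1 : ContDiff ℝ ∞ fun t : ℝ => K (0, t) := sK.comp (by fun_prop)
    have l1 := tendsto_div_sq_of_deriv_eq_zero sK1 hK0 (by rw [hd sK]; exact hKy0)
    rw [hd sK, hd (contDiff_dy sK)] at l1
    change Tendsto _ _ (𝓝 (dy (dy K) 0 / 2)) at l1
    rw [hKyy0] at l1
    have l2 : Tendsto (fun t => E (0, t)) (𝓝[≠] 0) (𝓝 (E 0)) := by
      have : Continuous fun t : ℝ => E (0, t) := sE.continuous.comp (by fun_prop)
      exact tendsto_nhdsWithin_of_tendsto_nhds (this.tendsto 0)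
    refine tendsto_nhds_unique l2 (l1.congr' ?_)
    filter_upwards [hne] with t ht
    have e1 := hG 0 t
    have e2 := hE 0 t
    rw [hG0, hβ0] at e2
    rw [hβ0, zero_add] at e1
    rw [show K (0, 0) = 0 from hK0] at e1
    rw [show dy K (0, 0) = 0 from hKy0] at e2
    rw [div_eq_iff (pow_ne_zero 2 ht)]
    linear_combination e1 + t * e2
  refine ⟨β, k, fun p => E (p.1, p.2 - β p.1), sβ, sk, ?_, hβ0, hlim, hk0, ?_, ?_⟩
  · exact sE.comp (contDiff_fst.prodMk (contDiff_snd.sub (sβ.comp contDiff_fst)))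
  · simp only [Prod.fst_zero, Prod.snd_zero, hβ0, sub_zero]
    exact hE0
  · have h1 : Tendsto (fun p : ℝ × ℝ => p.1) (𝓝 0) (𝓝 0) := continuous_fst.tendsto 0
    filter_upwards [h1.eventually hβ] with p hp
    have e1 := hG p.1 (p.2 - β p.1)
    have e2 := hE p.1 (p.2 - β p.1)
    rw [hG0, hp] at e2
    rw [add_sub_cancel, hk] at e1
    linear_combination e1 + (p.2 - β p.1) * e2

/-- Both terms of the factorization are nonpositive and vanish together only at the origin. -/
theorem eventually_tangentHeight_ne (hlam : 4 / 3 < lam) :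
    ∀ᶠ p in 𝓝 0, p ≠ 0 → tangentHeight f p ≠ 0 := by
  obtain ⟨β, k, E, -, sk, sE, hβ0, -, hk0, hE0, hK⟩ := h.exists_contour_factorization
  have hk : ∀ᶠ p : ℝ × ℝ in 𝓝 0, k p.1 < 0 :=
    ((sk.continuous.comp continuous_fst).tendsto (0 : ℝ × ℝ)).eventually_lt_const
      (by simp only [Function.comp, Prod.fst_zero, hk0]; linarith)
  have hE : ∀ᶠ p in 𝓝 0, E p < 0 :=
    (sE.continuous.tendsto 0).eventually_lt_const (by rw [hE0]; norm_num)
  filter_upwards [hk, hE, hK] with p hkp hEp hKp hp h0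
  rw [hKp] at h0
  have e1 : p.1 ^ 4 * k p.1 ≤ 0 := mul_nonpos_of_nonneg_of_nonpos (by positivity) hkp.le
  have e2 : (p.2 - β p.1) ^ 2 * E p ≤ 0 := mul_nonpos_of_nonneg_of_nonpos (by positivity) hEp.le
  have e3 : p.1 = 0 := by
    have : p.1 ^ 4 * k p.1 = 0 := by linarith
    exact pow_eq_zero_iff (by norm_num) |>.1 ((mul_eq_zero.1 this).resolve_right hkp.ne)
  have e4 : p.2 - β p.1 = 0 := by
    have : (p.2 - β p.1) ^ 2 * E p = 0 := by linarith
    exact pow_eq_zero_iff (by norm_num) |>.1 ((mul_eq_zero.1 this).resolve_right hEp.ne)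
  rw [e3, hβ0, sub_zero] at e4
  exact hp (Prod.ext e3 e4)

/-- For `lam < 4 / 3` the contour is the union of two smooth curves, graphs of functions of the
first coordinate. -/
theorem exists_contour_curves (hlam : lam < 4 / 3) : ∃ y₁ y₂ : ℝ → ℝ,
    ContDiff ℝ ∞ y₁ ∧ ContDiff ℝ ∞ y₂ ∧ y₁ 0 = 0 ∧ y₂ 0 = 0 ∧
    Tendsto (fun x => y₁ x / x ^ 2) (𝓝[≠] 0) (𝓝 (2 - √(4 - 3 * lam))) ∧
    Tendsto (fun x => y₂ x / x ^ 2) (𝓝[≠] 0) (𝓝 (2 + √(4 - 3 * lam))) ∧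
    ∀ᶠ p in 𝓝 0, tangentHeight f p = 0 ↔ p.2 = y₁ p.1 ∨ p.2 = y₂ p.1 := by
  obtain ⟨β, k, E, sβ, sk, sE, hβ0, hβ, hk0, hE0, hK⟩ := h.exists_contour_factorization
  have hkpos : 0 < k 0 := by rw [hk0]; linarith
  have hk : ∀ᶠ x in 𝓝 0, 0 < k x := (sk.continuous.tendsto 0).eventually_const_lt hkpos
  have hE : ∀ᶠ p in 𝓝 0, 0 < -E p :=
    (sE.neg.continuous.tendsto 0).eventually_const_lt (by rw [hE0]; norm_num)
  -- With smooth roots R of k and S of -E the tangent height is the difference of squares (x²R)² -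
  -- ((y - β)S)².
  obtain ⟨R, sR, hR⟩ := exists_contDiff_eventuallyEq (f := fun x => √(k x)) (a := 0) (by
    filter_upwards [hk] with x hx
    exact sk.contDiffAt.sqrt hx.ne')
  obtain ⟨S, sS, hS⟩ := exists_contDiff_eventuallyEq (f := fun p => √(-E p)) (a := 0) (by
    filter_upwards [hE] with x hx
    exact sE.neg.contDiffAt.sqrt hx.ne')
  have hS0 : S 0 = √(1 / 2) := by
    rw [hS.eq_of_nhds, hE0]
    norm_num
  have hS0pos : 0 < S 0 := by rw [hS0]; positivity
  have hR0 : R 0 = √(4 - 3 * lam) * √(1 / 2) := by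
    rw [hR.eq_of_nhds, hk0, ← Real.sqrt_mul (by linarith)]
    congr 1
    ring
  have sβ' : ContDiff ℝ ∞ fun p : ℝ × ℝ => p.2 - β p.1 := contDiff_snd.sub (sβ.comp contDiff_fst)
  have sT : ContDiff ℝ ∞ fun p : ℝ × ℝ => (p.2 - β p.1) * S p := sβ'.mul sS
  have hTy : dy (fun p : ℝ × ℝ => (p.2 - β p.1) * S p) 0 ≠ 0 := by
    have : dy (fun p : ℝ × ℝ => β p.1) 0 = 0 := by
      have := ((sβ.differentiable (by simp) _).hasDerivAt.hasFDerivAt).comp (0 : ℝ × ℝ)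
        hasFDerivAt_fst
      rw [dy, show fderiv ℝ (fun p : ℝ × ℝ => β p.1) 0 = _ from this.fderiv]
      simp
    have sβ'' : ContDiff ℝ ∞ fun p : ℝ × ℝ => β p.1 := sβ.comp contDiff_fst
    rw [dy_mul sβ' sS, dy_sub contDiff_snd sβ'', dy_snd]
    simp only [this, Prod.fst_zero, Prod.snd_zero, hβ0]
    simpa using hS0pos.ne'
  -- With (y - β)S as second coordinate the contour becomes the two curves ±x²R; the sign is `σ`
  -- below.
  obtain ⟨Y, sY, hY0, hl, hr⟩ := exists_implicit sT (by simp [hβ0]) hTy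
  have key : ∀ σ : ℝ, ContDiff ℝ ∞ (fun x => Y (x, σ * (x ^ 2 * R x))) ∧
      Y (0, σ * (0 ^ 2 * R 0)) = 0 ∧ Tendsto (fun x => Y (x, σ * (x ^ 2 * R x)) / x ^ 2) (𝓝[≠] 0)
        (𝓝 (2 + σ * √(4 - 3 * lam))) := by
    intro σ
    have sZ : ContDiff ℝ ∞ fun x : ℝ => (x, σ * (x ^ 2 * R x)) := by fun_prop
    have hZ : Tendsto (fun x : ℝ => (x, σ * (x ^ 2 * R x))) (𝓝 0) (𝓝 0) := by
      simpa [Prod.mk_zero_zero] using sZ.continuous.tendsto 0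
    have sC : ContDiff ℝ ∞ fun x => Y (x, σ * (x ^ 2 * R x)) := sY.comp sZ
    refine ⟨sC, by simpa [Prod.mk_zero_zero] using hY0, ?_⟩
    have hC : Tendsto (fun x : ℝ => (x, Y (x, σ * (x ^ 2 * R x)))) (𝓝 0) (𝓝 0) := by
      have : Continuous fun x : ℝ => (x, Y (x, σ * (x ^ 2 * R x))) :=
        continuous_id.prodMk sC.continuous
      have h2 := this.tendsto 0
      simpa [Prod.mk_zero_zero, hY0] using h2
    have lS : Tendsto (fun x => S (x, Y (x, σ * (x ^ 2 * R x)))) (𝓝[≠] 0) (𝓝 (S 0)) :=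
      tendsto_nhdsWithin_of_tendsto_nhds ((sS.continuous.tendsto 0).comp hC)
    have lR : Tendsto R (𝓝[≠] 0) (𝓝 (R 0)) :=
      tendsto_nhdsWithin_of_tendsto_nhds (sR.continuous.tendsto 0)
    have l := hβ.add ((lR.const_mul σ).div lS hS0pos.ne')
    -- R(0) = √((4 - 3λ)/2) and S(0) = √(1/2).
    have e : 2 + σ * R 0 / S 0 = 2 + σ * √(4 - 3 * lam) := by
      rw [hR0, hS0, ← mul_assoc, mul_div_assoc, div_self (by positivity), mul_one]
    rw [e] at l
    refine l.congr' ?_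
    filter_upwards [nhdsWithin_le_nhds (hZ.eventually hr), self_mem_nhdsWithin,
      lS.eventually_ne hS0pos.ne'] with x hx hx0 hSx
    have hx0 : x ≠ 0 := hx0
    simp only [Pi.div_apply] at hx ⊢
    generalize S (x, Y (x, σ * (x ^ 2 * R x))) = s at hx hSx ⊢
    generalize Y (x, σ * (x ^ 2 * R x)) = y at hx ⊢
    field_simp
    linear_combination -hx
  refine ⟨fun x => Y (x, -1 * (x ^ 2 * R x)), fun x => Y (x, 1 * (x ^ 2 * R x)), (key _).1,
    (key _).1, (key _).2.1, (key _).2.1, ?_, ?_, ?_⟩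
  · convert (key (-1)).2.2 using 2
    ring
  · convert (key 1).2.2 using 2
    ring
  · have h1 : Tendsto (fun p : ℝ × ℝ => p.1) (𝓝 0) (𝓝 0) := continuous_fst.tendsto 0
    have hpair : ∀ σ : ℝ, Tendsto (fun p : ℝ × ℝ => (p.1, σ * (p.1 ^ 2 * R p.1))) (𝓝 0) (𝓝 0) := by
      intro σ
      have : Continuous fun p : ℝ × ℝ => (p.1, σ * (p.1 ^ 2 * R p.1)) := by
        have := sR.continuous
        fun_prop
      simpa [Prod.mk_zero_zero] using this.tendsto 0
    filter_upwards [hK, hl, (hpair (-1)).eventually hr, (hpair 1).eventually hr, h1.eventually hR,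
      h1.eventually hk, hS, hE] with p hKp hlp hr1 hr2 hRp hkp hSp hEp
    have e1 : tangentHeight f p =
        (p.1 ^ 2 * R p.1) ^ 2 - ((p.2 - β p.1) * S p) ^ 2 := by
      rw [hKp, hRp, hSp, mul_pow, mul_pow, Real.sq_sqrt hkp.le, Real.sq_sqrt hEp.le]
      ring
    rw [e1, sub_eq_zero, eq_comm, sq_eq_sq_iff_eq_or_eq_neg, or_comm]
    have e2 : ∀ τ, (τ = (Y (p.1, τ) - β p.1) * S (p.1, Y (p.1, τ))) →
        ((p.2 - β p.1) * S p = τ ↔ p.2 = Y (p.1, τ)) := by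
      intro τ hτ
      constructor
      · rintro rfl
        exact hlp.symm
      · intro hp
        rw [hτ, ← hp]
    rw [← e2 _ hr1.symm, ← e2 _ hr2.symm, neg_one_mul, one_mul]

end IsNormalForm

/-! ### Bitangent planes -/

/-- For a line tangent to the graph of A at x and X, the trapezoid error of A' on intervals centred
at the midpoint vanishes at half-widths 0 and (X - x)/2. Rolle's theorem gives equal values of A''
at two symmetric points, and a second use makes the symmetrized third derivative vanish. This
isolates x + X, the quantity that must be shown small. -/
theorem exists_symmetric_zero_of_bitangent {A B M N : ℝ → ℝ} {x X b : ℝ} (hxX : x < X)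
    (hA : ∀ s ∈ Icc x X, HasDerivAt A (B s) s) (hB : ∀ s ∈ Icc x X, HasDerivAt B (M s) s)
    (hM : ∀ s ∈ Icc x X, HasDerivAt M (N s) s) (hx : B x = b) (hX : B X = b)
    (hAb : A X - A x = b * (X - x)) :
    ∃ s ∈ Icc x X, ∃ s' ∈ Icc x X, s + s' = x + X ∧ N s + N s' = 0 := by
  set m := (x + X) / 2 with hm
  set d := (X - x) / 2 with hd
  have hd0 : 0 < d := by rw [hd]; linarith
  have mem₁ : ∀ τ ∈ Icc 0 d, m + τ ∈ Icc x X := fun τ hτ =>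
    ⟨by linarith [hτ.1, hm, hd], by linarith [hτ.2]⟩
  have mem₂ : ∀ τ ∈ Icc 0 d, m - τ ∈ Icc x X := fun τ hτ =>
    ⟨by linarith [hτ.2], by linarith [hτ.1, hm, hd]⟩
  have e₁ : m + d = X := by rw [hm, hd]; ring
  have e₂ : m - d = x := by rw [hm, hd]; ring
  have plus : ∀ {g g' : ℝ → ℝ}, (∀ s ∈ Icc x X, HasDerivAt g (g' s) s) → ∀ τ ∈ Icc 0 d,
      HasDerivAt (fun τ => g (m + τ)) (g' (m + τ)) τ := fun hg τ hτ =>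
    (hg _ (mem₁ τ hτ)).comp_const_add m τ
  have minus : ∀ {g g' : ℝ → ℝ}, (∀ s ∈ Icc x X, HasDerivAt g (g' s) s) → ∀ τ ∈ Icc 0 d,
      HasDerivAt (fun τ => g (m - τ)) (-g' (m - τ)) τ := fun hg τ hτ =>
    (hg _ (mem₂ τ hτ)).comp_const_sub m τ
  have hw : ∀ τ ∈ Icc 0 d, HasDerivAt
      (fun τ => τ * (B (m + τ) + B (m - τ)) - (A (m + τ) - A (m - τ)))
      (τ * (M (m + τ) - M (m - τ))) τ := by
    intro τ hτ
    have := ((hasDerivAt_id' τ).fun_mul ((plus hB τ hτ).fun_add (minus hB τ hτ))).fun_sub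
      ((plus hA τ hτ).fun_sub (minus hA τ hτ))
    exact this.congr_deriv (by ring)
  obtain ⟨τ₁, hτ₁, h₁⟩ := exists_hasDerivAt_eq_zero hd0
    (fun τ hτ => (hw τ hτ).continuousAt.continuousWithinAt)
    (by
      simp only [e₁, e₂, hx, hX, hAb, add_zero, sub_zero, sub_self, zero_mul]
      rw [hd]
      ring)
    (fun τ hτ => hw τ (Ioo_subset_Icc_self hτ))
  have h₂ : M (m + τ₁) - M (m - τ₁) = 0 := (mul_eq_zero.1 h₁).resolve_left hτ₁.1.ne'
  have hj : ∀ τ ∈ Icc 0 τ₁, HasDerivAt (fun τ => M (m + τ) - M (m - τ))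
      (N (m + τ) + N (m - τ)) τ := by
    intro τ hτ
    have hτ' : τ ∈ Icc 0 d := ⟨hτ.1, hτ.2.trans hτ₁.2.le⟩
    have := (plus hM τ hτ').fun_sub (minus hM τ hτ')
    rwa [sub_neg_eq_add] at this
  obtain ⟨τ₂, hτ₂, h₃⟩ := exists_hasDerivAt_eq_zero hτ₁.1
    (fun τ hτ => (hj τ hτ).continuousAt.continuousWithinAt) (by simp only [h₂]; simp)
    (fun τ hτ => hj τ (Ioo_subset_Icc_self hτ))
  have hτ₂' : τ₂ ∈ Icc 0 d := ⟨hτ₂.1.le, hτ₂.2.le.trans hτ₁.2.le⟩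
  exact ⟨_, mem₁ _ hτ₂', _, mem₂ _ hτ₂', by rw [hm]; ring, h₃⟩

section Graph

variable {F Y : ℝ × ℝ → ℝ}

theorem contDiff_comp_graph (hF : ContDiff ℝ ∞ F) (hY : ContDiff ℝ ∞ Y) :
    ContDiff ℝ ∞ fun z : ℝ × ℝ => F (z.1, Y z) := hF.comp (contDiff_fst.prodMk hY)

theorem fderiv_comp_graph (hF : ContDiff ℝ ∞ F) (hY : ContDiff ℝ ∞ Y) (z v : ℝ × ℝ) :
    fderiv ℝ (fun z : ℝ × ℝ => F (z.1, Y z)) z v =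
      v.1 * dx F (z.1, Y z) + fderiv ℝ Y z v * dy F (z.1, Y z) := by
  have h1 : HasFDerivAt (fun z : ℝ × ℝ => (z.1, Y z))
      ((ContinuousLinearMap.fst ℝ ℝ ℝ).prod (fderiv ℝ Y z)) z :=
    hasFDerivAt_fst.prodMk (hasFDerivAt_of_contDiff hY z)
  have h2 := (hasFDerivAt_of_contDiff hF (z.1, Y z)).comp z h1
  rw [show fderiv ℝ (fun z : ℝ × ℝ => F (z.1, Y z)) z = _ from h2.fderiv,
    ContinuousLinearMap.comp_apply, fderiv_eq_dx_dy]
  rfl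

theorem dx_comp_graph (hF : ContDiff ℝ ∞ F) (hY : ContDiff ℝ ∞ Y) :
    dx (fun z : ℝ × ℝ => F (z.1, Y z)) =
      fun z => dx F (z.1, Y z) + dx Y z * dy F (z.1, Y z) := by
  funext z
  rw [dx, fderiv_comp_graph hF hY, one_mul]
  rfl

theorem dy_comp_graph (hF : ContDiff ℝ ∞ F) (hY : ContDiff ℝ ∞ Y) :
    dy (fun z : ℝ × ℝ => F (z.1, Y z)) = fun z => dy Y z * dy F (z.1, Y z) := by
  funext z
  rw [dy, fderiv_comp_graph hF hY, zero_mul, zero_add]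
  rfl

theorem hasDerivAt_slice (hF : ContDiff ℝ ∞ F) (s q : ℝ) :
    HasDerivAt (fun s => F (s, q)) (dx F (s, q)) s := by
  have := hasDerivAt_comp_curve hF ((hasDerivAt_id' s).prodMk (hasDerivAt_const s q))
  simpa using this

theorem EventuallyEq.dx {G : ℝ × ℝ → ℝ} {z : ℝ × ℝ} (h : F =ᶠ[𝓝 z] G) :
    Godron.dx F =ᶠ[𝓝 z] Godron.dx G := by
  filter_upwards [h.fderiv (𝕜 := ℝ)] with w hw
  rw [Godron.dx, hw]
  rfl

theorem EventuallyEq.dy {G : ℝ × ℝ → ℝ} {z : ℝ × ℝ} (h : F =ᶠ[𝓝 z] G) :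
    Godron.dy F =ᶠ[𝓝 z] Godron.dy G := by
  filter_upwards [h.fderiv (𝕜 := ℝ)] with w hw
  rw [Godron.dy, hw]
  rfl

end Graph

/-- The tangent planes of the graph of `f` at two distinct points coincide. -/
def IsBitangent (f : ℝ × ℝ → ℝ) (p p' : ℝ × ℝ) : Prop :=
  p ≠ p' ∧ dx f p = dx f p' ∧ dy f p = dy f p' ∧ tangentHeight f p = tangentHeight f p'

theorem IsBitangent.symm {f : ℝ × ℝ → ℝ} {p p' : ℝ × ℝ} (h : IsBitangent f p p') :
    IsBitangent f p' p :=
  ⟨h.1.symm, h.2.1.symm, h.2.2.1.symm, h.2.2.2.symm⟩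

theorem abs_le_of_mem_uIcc {s a b : ℝ} (hs : s ∈ uIcc a b) (hab : |b| ≤ |a|) : |s| ≤ |a| := by
  have h1 : |s| ≤ max |a| |b| := by
    rw [mem_uIcc] at hs
    rcases hs with hs | hs
    · exact abs_le_max_abs_abs hs.1 hs.2
    · rw [max_comm]
      exact abs_le_max_abs_abs hs.1 hs.2
  rwa [max_eq_left hab] at h1

namespace IsNormalForm

variable {f : ℝ × ℝ → ℝ} {lam : ℝ} (h : IsNormalForm f lam)
include h

/-- In the coordinates `(x, f_y)` the second derivative along the curves `f_y = const` of the
partial Legendre transform of `f`. -/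
theorem exists_legendre : ∃ Y M : ℝ × ℝ → ℝ, ContDiff ℝ ∞ Y ∧ ContDiff ℝ ∞ M ∧
    M 0 = 0 ∧ dx M 0 = 0 ∧ dy M 0 = -2 ∧ dx (dx M) 0 = 12 * (lam - 1) ∧
    (∀ᶠ p in 𝓝 0, Y (p.1, dy f p) = p.2) ∧
    (∀ᶠ z in 𝓝 0, HasDerivAt (fun s => f (s, Y (s, z.2)) - z.2 * Y (s, z.2))
      (dx f (z.1, Y z)) z.1) ∧
    (∀ z : ℝ × ℝ, HasDerivAt (fun s => dx f (s, Y (s, z.2))) (M z) z.1) := by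
  have sx := contDiff_dx h.smooth
  have sy := contDiff_dy h.smooth
  have sxx := contDiff_dx sx
  have sxy := contDiff_dx sy
  have syy := contDiff_dy sy
  have sxxx := contDiff_dx sxx
  have sxxy := contDiff_dx sxy
  have sxyy := contDiff_dx syy
  obtain ⟨Y, sY, hY0, hl, hr⟩ := exists_implicit sy h.y (by rw [h.yy]; exact one_ne_zero)
  have sYx := contDiff_dx sY
  have sYxx := contDiff_dx sYx
  have e0 : ((0 : ℝ × ℝ).1, Y 0) = 0 := by rw [hY0]; rfl
  -- Implicit differentiation of f_y(x, Y(x, q)) = q yields Y_x = 0, Y_y = 1 and Y_xx = 2 at the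
  -- origin.
  have r1 : (fun z : ℝ × ℝ => dx (dy f) (z.1, Y z) + dx Y z * dy (dy f) (z.1, Y z))
      =ᶠ[𝓝 0] fun _ => 0 := by
    have := EventuallyEq.dx (F := fun z : ℝ × ℝ => dy f (z.1, Y z)) (G := fun z => z.2) hr
    rwa [dx_comp_graph sy sY, dx_snd] at this
  have Yx0 : dx Y 0 = 0 := by
    have := r1.eq_of_nhds
    simpa only [e0, h.xy, h.yy, zero_add, mul_one] using this
  have Yy0 : dy Y 0 = 1 := by
    have := EventuallyEq.dy (F := fun z : ℝ × ℝ => dy f (z.1, Y z)) (G := fun z => z.2) hr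
    rw [dy_comp_graph sy sY, dy_snd] at this
    have := this.eq_of_nhds
    simpa only [e0, h.yy, mul_one] using this
  have Yxx0 : dx (dx Y) 0 = 2 := by
    have := EventuallyEq.dx r1
    rw [dx_add (contDiff_comp_graph sxy sY) (sYx.mul (contDiff_comp_graph syy sY)),
      dx_mul sYx (contDiff_comp_graph syy sY), dx_comp_graph sxy sY, dx_comp_graph syy sY] at this
    have := this.eq_of_nhds
    have hc : dx (fun _ : ℝ × ℝ => (0 : ℝ)) 0 = 0 := by
      rw [dx, fderiv_const_apply]
      rfl
    simp only [e0, Yx0, h.xxy, h.yy, hc] at this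
    linarith
  set M : ℝ × ℝ → ℝ := fun z => dx (dx f) (z.1, Y z) + dx Y z * dx (dy f) (z.1, Y z) with hM
  have sM : ContDiff ℝ ∞ M :=
    (contDiff_comp_graph sxx sY).add (sYx.mul (contDiff_comp_graph sxy sY))
  have hdM : dx M = fun z => dx (dx (dx f)) (z.1, Y z) + dx Y z * dx (dx (dy f)) (z.1, Y z) +
      (dx (dx Y) z * dx (dy f) (z.1, Y z) + dx Y z * (dx (dx (dy f)) (z.1, Y z) +
        dx Y z * dx (dy (dy f)) (z.1, Y z))) := by
    rw [hM, dx_add (contDiff_comp_graph sxx sY) (sYx.mul (contDiff_comp_graph sxy sY)),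
      dx_mul sYx (contDiff_comp_graph sxy sY), dx_comp_graph sxx sY, dx_comp_graph sxy sY,
      dy_dx sx, dy_dx h.smooth, dy_dx sy]
  have hdM0 : dx M 0 = 0 := by
    simp only [hdM, e0, Yx0, h.xxx, h.xy]
    ring
  have hdyM0 : dy M 0 = -2 := by
    rw [hM, dy_add (contDiff_comp_graph sxx sY) (sYx.mul (contDiff_comp_graph sxy sY)),
      dy_mul sYx (contDiff_comp_graph sxy sY), dy_comp_graph sxx sY, dy_comp_graph sxy sY,
      dy_dx sx, dy_dx h.smooth]
    simp only [e0, Yx0, Yy0, h.xxy, h.xy]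
    ring
  have hdxdM0 : dx (dx M) 0 = 12 * (lam - 1) := by
    have c1 := contDiff_comp_graph sxxx sY
    have c2 := contDiff_comp_graph sxxy sY
    have c3 := contDiff_comp_graph sxy sY
    have c4 := contDiff_comp_graph sxyy sY
    rw [hdM, dx_add (c1.add (sYx.mul c2)) ((sYxx.mul c3).add (sYx.mul (c2.add (sYx.mul c4)))),
      dx_add c1 (sYx.mul c2), dx_add (sYxx.mul c3) (sYx.mul (c2.add (sYx.mul c4))),
      dx_mul sYx c2, dx_mul sYxx c3, dx_mul sYx (c2.add (sYx.mul c4)), dx_comp_graph sxxx sY,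
      dx_comp_graph sxy sY]
    simp only [e0, Yx0, Yxx0, h.xxy, h.xy, h.xxxx]
    ring
  refine ⟨Y, M, sY, sM, ?_, hdM0, hdyM0, hdxdM0, hl, ?_, ?_⟩
  · simp only [hM, e0, Yx0, h.xx, h.xy]
    ring
  -- The terms with Y_x cancel because f_y = q on the curve.
  · filter_upwards [hr] with z hz
    have h1 := (hasDerivAt_slice (contDiff_comp_graph h.smooth sY) z.1 z.2).fun_sub
      ((hasDerivAt_slice sY z.1 z.2).const_mul z.2)
    refine h1.congr_deriv ?_
    simp only [dx_comp_graph h.smooth sY, hz]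
    ring
  · intro z
    have h1 := hasDerivAt_slice (contDiff_comp_graph sx sY) z.1 z.2
    rw [dx_comp_graph sx sY, dy_dx h.smooth] at h1
    exact h1

/-- A bitangent plane has one value q = f_y at both contact points, and the Legendre transform at
this q has a common tangent line there. The first equation, from equal slopes, controls q; the
second, from the symmetric zero, controls the sum of the abscissas. -/
theorem exists_bitangent_equations : ∃ M : ℝ × ℝ → ℝ, ContDiff ℝ ∞ M ∧
    M 0 = 0 ∧ dx M 0 = 0 ∧ dy M 0 = -2 ∧ dx (dx M) 0 = 12 * (lam - 1) ∧
    ∃ ε > 0, ∀ p ∈ Metric.ball (0 : ℝ × ℝ) ε, ∀ p' ∈ Metric.ball (0 : ℝ × ℝ) ε,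
      IsBitangent f p p' → p.1 ≠ p'.1 ∧ ∃ s₁ s₂ s₃ : ℝ,
        s₁ ∈ uIcc p.1 p'.1 ∧ s₂ ∈ uIcc p.1 p'.1 ∧ s₃ ∈ uIcc p.1 p'.1 ∧
        M (s₁, dy f p) - 6 * (lam - 1) * s₁ ^ 2 +
          2 * (lam - 1) * (p.1 ^ 2 + p.1 * p'.1 + p'.1 ^ 2) = 0 ∧
        s₂ + s₃ = p.1 + p'.1 ∧ dx M (s₂, dy f p) + dx M (s₃, dy f p) = 0 := by
  obtain ⟨Y, M, sY, sM, hM0, hM1, hM2, hM3, hl, hA, hB⟩ := h.exists_legendre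
  refine ⟨M, sM, hM0, hM1, hM2, hM3, ?_⟩
  obtain ⟨ε₁, hε₁, h₁⟩ := Metric.eventually_nhds_iff_ball.1 hA
  have hq : ∀ᶠ p in 𝓝 (0 : ℝ × ℝ), |dy f p| < ε₁ := by
    have := ((contDiff_dy h.smooth).continuous.abs).tendsto 0
    rw [h.y, abs_zero] at this
    exact this.eventually_lt_const hε₁
  obtain ⟨ε₂, hε₂, h₂⟩ := Metric.eventually_nhds_iff_ball.1 (hl.and hq)
  have habs : ∀ p ∈ Metric.ball (0 : ℝ × ℝ) (min ε₁ ε₂), |p.1| < ε₁ := by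
    intro p hp
    rw [mem_ball_zero_iff] at hp
    exact (norm_fst_le p).trans_lt (hp.trans_le (min_le_left _ _))
  have main : ∀ p ∈ Metric.ball (0 : ℝ × ℝ) (min ε₁ ε₂), ∀ p' ∈ Metric.ball (0 : ℝ × ℝ) (min ε₁ ε₂),
      IsBitangent f p p' → p.1 < p'.1 → ∃ s₁ s₂ s₃ : ℝ,
        s₁ ∈ uIcc p.1 p'.1 ∧ s₂ ∈ uIcc p.1 p'.1 ∧ s₃ ∈ uIcc p.1 p'.1 ∧
        M (s₁, dy f p) - 6 * (lam - 1) * s₁ ^ 2 +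
          2 * (lam - 1) * (p.1 ^ 2 + p.1 * p'.1 + p'.1 ^ 2) = 0 ∧
        s₂ + s₃ = p.1 + p'.1 ∧ dx M (s₂, dy f p) + dx M (s₃, dy f p) = 0 := by
    rintro p hp p' hp' ⟨-, hb1, hb2, hb3⟩ hlt
    obtain ⟨hYp, hqp⟩ := h₂ p (Metric.ball_subset_ball (min_le_right _ _) hp)
    obtain ⟨hYp', -⟩ := h₂ p' (Metric.ball_subset_ball (min_le_right _ _) hp')
    rw [← hb2] at hYp'
    set q := dy f p with hqdef
    have hbox : ∀ s ∈ Icc p.1 p'.1, (s, q) ∈ Metric.ball (0 : ℝ × ℝ) ε₁ := by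
      intro s hs
      rw [mem_ball_zero_iff, Prod.norm_def, max_lt_iff]
      refine ⟨?_, hqp⟩
      have a1 := abs_lt.1 (habs p hp)
      have a2 := abs_lt.1 (habs p' hp')
      exact abs_lt.2 ⟨by linarith [hs.1], by linarith [hs.2]⟩
    have hA' : ∀ s ∈ Icc p.1 p'.1, HasDerivAt (fun s => f (s, Y (s, q)) - q * Y (s, q))
        (dx f (s, Y (s, q))) s := fun s hs => h₁ (s, q) (hbox s hs)
    have hB' : ∀ s ∈ Icc p.1 p'.1, HasDerivAt (fun s => dx f (s, Y (s, q))) (M (s, q)) s :=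
      fun s _ => hB (s, q)
    have hM' : ∀ s ∈ Icc p.1 p'.1, HasDerivAt (fun s => M (s, q)) (dx M (s, q)) s :=
      fun s _ => hasDerivAt_slice sM s q
    have hb3' : f p' - q * p'.2 - (f p - q * p.2) = dx f p * (p'.1 - p.1) := by
      simp only [tangentHeight, ← hb1, ← hb2, ← hqdef] at hb3
      linarith
    obtain ⟨s₂, hs₂, s₃, hs₃, e1, e2⟩ := exists_symmetric_zero_of_bitangent hlt hA' hB' hM'
      (b := dx f p) (by simp only [hYp]) (by simp only [hYp']; exact hb1.symm)
      (by simp only [hYp, hYp']; exact hb3')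
    -- Subtracting the cubic whose derivative is the model term 6(λ-1)s² before applying the mean
    -- value theorem leaves its exact average 2(λ-1)(x² + xX + X²), so the unknown s₁ enters only
    -- through the error.
    have hE : ∀ s ∈ Icc p.1 p'.1, HasDerivAt
        (fun s => dx f (s, Y (s, q)) - 2 * (lam - 1) * s ^ 3)
        (M (s, q) - 6 * (lam - 1) * s ^ 2) s := by
      intro s hs
      have := (hB' s hs).fun_sub ((hasDerivAt_pow 3 s).const_mul (2 * (lam - 1)))
      refine this.congr_deriv ?_
      push_cast
      ring
    obtain ⟨s₁, hs₁, e3⟩ := exists_hasDerivAt_eq_slope _ _ hlt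
      (fun s hs => (hE s hs).continuousAt.continuousWithinAt)
      (fun s hs => hE s (Ioo_subset_Icc_self hs))
    rw [uIcc_of_le hlt.le]
    refine ⟨s₁, s₂, s₃, Ioo_subset_Icc_self hs₁, hs₂, hs₃, ?_, e1, e2⟩
    simp only [hYp, hYp'] at e3
    have hb1' : dx f (p'.1, p'.2) = dx f (p.1, p.2) := hb1.symm
    have hne : p'.1 - p.1 ≠ 0 := by linarith [sub_pos.2 hlt]
    rw [e3, hb1']
    field_simp
    ring
  refine ⟨min ε₁ ε₂, lt_min hε₁ hε₂, fun p hp p' hp' hb => ?_⟩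
  rcases lt_trichotomy p.1 p'.1 with hlt | heq | hgt
  · exact ⟨hlt.ne, main p hp p' hp' hb hlt⟩
  -- Equal abscissas and equal f_y give equal points, since (x, f_y) are local coordinates.
  · exfalso
    obtain ⟨hYp, -⟩ := h₂ p (Metric.ball_subset_ball (min_le_right _ _) hp)
    obtain ⟨hYp', -⟩ := h₂ p' (Metric.ball_subset_ball (min_le_right _ _) hp')
    apply hb.1
    rw [← hb.2.2.1, ← heq, hYp] at hYp'
    exact Prod.ext heq hYp'
  · refine ⟨hgt.ne', ?_⟩
    obtain ⟨s₁, s₂, s₃, m1, m2, m3, e1, e2, e3⟩ := main p' hp' p hp hb.symm hgt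
    rw [uIcc_comm, hb.2.2.1]
    refine ⟨s₁, s₂, s₃, m1, m2, m3, ?_, by rw [e2, add_comm], e3⟩
    rw [← e1]
    ring

/-- Points of contact of bitangent planes close to the origin lie near the curve
`y = lam x²`. -/
theorem conodal_coeff {α : Type*} {l : Filter α} [l.NeBot] {p p' : α → ℝ × ℝ} {c : ℝ}
    (hp : Tendsto p l (𝓝 0)) (hp' : Tendsto p' l (𝓝 0))
    (hb : ∀ᶠ a in l, IsBitangent f (p a) (p' a)) (hle : ∀ᶠ a in l, |(p' a).1| ≤ |(p a).1|)
    (hy : Tendsto (fun a => (p a).2 / (p a).1 ^ 2) l (𝓝 c)) : c = lam := by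
  obtain ⟨M, sM, hM0, hM1, hM2, hM3, ε, hε, hE⟩ := h.exists_bitangent_equations
  have hball := Metric.ball_mem_nhds (0 : ℝ × ℝ) hε
  have hev : ∀ᶠ a in l, (p a).1 ≠ (p' a).1 ∧ ∃ s : ℝ × ℝ × ℝ,
      |s.1| ≤ |(p a).1| ∧ |s.2.1| ≤ |(p a).1| ∧ |s.2.2| ≤ |(p a).1| ∧
      M (s.1, dy f (p a)) - 6 * (lam - 1) * s.1 ^ 2 +
        2 * (lam - 1) * ((p a).1 ^ 2 + (p a).1 * (p' a).1 + (p' a).1 ^ 2) = 0 ∧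
      s.2.1 + s.2.2 = (p a).1 + (p' a).1 ∧
      dx M (s.2.1, dy f (p a)) + dx M (s.2.2, dy f (p a)) = 0 := by
    filter_upwards [hp hball, hp' hball, hb, hle] with a h1 h2 h3 h4
    obtain ⟨hne, s₁, s₂, s₃, m1, m2, m3, e⟩ := hE _ h1 _ h2 h3
    exact ⟨hne, (s₁, s₂, s₃), abs_le_of_mem_uIcc m1 h4, abs_le_of_mem_uIcc m2 h4,
      abs_le_of_mem_uIcc m3 h4, e⟩
  set x : α → ℝ := fun a => (p a).1 with hxdef
  set X : α → ℝ := fun a => (p' a).1 with hXdef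
  set q : α → ℝ := fun a => dy f (p a) with hqdef
  have hx0 : ∀ᶠ a in l, x a ≠ 0 := by
    filter_upwards [hev, hle] with a ha h4 hx
    have h5 : X a = 0 := abs_nonpos_iff.1 (by
      have h6 : |X a| ≤ |x a| := h4
      rwa [hx, abs_zero] at h6)
    exact ha.1 (hx.trans h5.symm)
  have hx : Tendsto x l (𝓝 0) := (continuous_fst.tendsto (0 : ℝ × ℝ)).comp hp
  have hq : Tendsto q l (𝓝 0) := by
    have := ((contDiff_dy h.smooth).continuous.tendsto 0).comp hp
    rwa [h.y] at this
  obtain ⟨s, hs⟩ := Filter.skolem.1 (hev.mono fun a ha => ha.2)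
  have O : ∀ t : α → ℝ, (∀ᶠ a in l, |t a| ≤ |x a|) → t =O[l] x := fun t ht =>
    IsBigO.of_bound 1 (ht.mono fun a ha => by simpa using ha)
  have O1 := O (fun a => (s a).1) (hs.mono fun a ha => ha.1)
  have O2 := O (fun a => (s a).2.1) (hs.mono fun a ha => ha.2.1)
  have O3 := O (fun a => (s a).2.2) (hs.mono fun a ha => ha.2.2.1)
  have OX := O X hle
  -- the size of `q`
  have hpair : Tendsto (fun a => ((s a).1, q a)) l (𝓝 0) := (O1.trans_tendsto hx).prodMk_nhds hq
  have W : (fun a => -2 * q a + 2 * (lam - 1) * (x a ^ 2 + x a * X a + X a ^ 2)) =o[l]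
      fun a => |q a| + (s a).1 ^ 2 := by
    refine ((weighted_taylor sM).comp_tendsto hpair).neg_left.congr' ?_
      (Eventually.of_forall fun _ => rfl)
    filter_upwards [hs] with a ha
    have := ha.2.2.2.1
    simp only [Function.comp, hM0, hM1, hM2, hM3, hxdef, hXdef, hqdef] at this ⊢
    linear_combination -this
  have OQ : (fun a => x a ^ 2 + x a * X a + X a ^ 2) =O[l] fun a => x a ^ 2 := by
    refine ((isBigO_refl _ l).add ?_).add (OX.pow 2)
    simpa [pow_two] using (isBigO_refl x l).mul OX
  -- The weighted error still contains |q|. With error constant 1 it is absorbed by the main term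
  -- 2|q|.
  have Oq : q =O[l] fun a => x a ^ 2 := by
    obtain ⟨C, hC⟩ := (OQ.const_mul_left (2 * (lam - 1))).bound
    refine IsBigO.of_bound (C + 1) ?_
    filter_upwards [W.bound one_pos, hC, hs] with a h1 h2 h3
    have h4 : (s a).1 ^ 2 ≤ x a ^ 2 := sq_le_sq.2 h3.1
    simp only [Real.norm_eq_abs] at h1 h2 ⊢
    rw [abs_of_nonneg (a := |q a| + (s a).1 ^ 2) (by positivity)] at h1
    rw [abs_of_nonneg (a := x a ^ 2) (by positivity)] at h2 ⊢
    have h5 := abs_sub (-2 * q a + 2 * (lam - 1) * (x a ^ 2 + x a * X a + X a ^ 2))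
      (2 * (lam - 1) * (x a ^ 2 + x a * X a + X a ^ 2))
    rw [add_sub_cancel_right, abs_mul, abs_neg, abs_two] at h5
    linarith
  have W' : (fun a => -2 * q a + 2 * (lam - 1) * (x a ^ 2 + x a * X a + X a ^ 2)) =o[l]
      fun a => x a ^ 2 := W.trans_isBigO (Oq.norm_left.add (O1.pow 2))
  -- As M_x(s, q) = 12(λ-1)s + o(x), the symmetric equation says that 12(λ-1)(x + X) = o(x). The
  -- factor λ - 1 is kept, so λ = 1 needs no separate treatment.
  have V : (fun a => (lam - 1) * (x a + X a)) =o[l] x := by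
    have h1 := ((weighted_taylor_one (contDiff_dx sM) hx O2 Oq).add
      (weighted_taylor_one (contDiff_dx sM) hx O3 Oq)).const_mul_left (-1 / 12)
    refine h1.congr' ?_ (Eventually.of_forall fun _ => rfl)
    filter_upwards [hs] with a ha
    have e1 := ha.2.2.2.2.1
    have e2 := ha.2.2.2.2.2
    simp only [hM1, hM3, hxdef, hXdef, hqdef] at e1 e2 ⊢
    linear_combination (-1 / 12) * e2 + (lam - 1) * e1
  have V' : (fun a => X a * ((lam - 1) * (x a + X a))) =o[l] fun a => x a ^ 2 := by
    simpa [pow_two] using OX.mul_isLittleO V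
  -- x² + xX + X² = x² + X(x + X), and the last product is negligible after multiplication by λ - 1.
  -- Comparison with q = f_y ~ (c - 1)x² then gives c = λ.
  have Q : (fun a => q a - (lam - 1) * x a ^ 2) =o[l] fun a => x a ^ 2 := by
    refine ((W'.const_mul_left (-1 / 2)).add V').congr_left fun a => ?_
    ring
  have L1 : Tendsto (fun a => q a / x a ^ 2) l (𝓝 (lam - 1)) := by
    have := Q.tendsto_div_nhds_zero.add_const (lam - 1)
    rw [zero_add] at this
    refine this.congr' ?_
    filter_upwards [hx0] with a ha
    field_simp
    ring
  have L2 := tendsto_div_sq (contDiff_dy h.smooth) h.y h.xy hx hx0 hy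
  rw [h.yy, h.xxy] at L2
  have := tendsto_nhds_unique L1 L2
  linarith

end IsNormalForm

/-! ### Surfaces given as graphs in affine coordinates -/

section GraphMap

open Matrix

variable {r0 : Fin 3 → ℝ} {E : Matrix (Fin 3) (Fin 3) ℝ} {φ : ℝ × ℝ → ℝ × ℝ} {f : ℝ × ℝ → ℝ}

/-- The surface whose affine coordinates, with respect to the origin `r0` and the rows of `E`, are
`φ` and `f ∘ φ`. -/
def graphMap (r0 : Fin 3 → ℝ) (E : Matrix (Fin 3) (Fin 3) ℝ) (φ : ℝ × ℝ → ℝ × ℝ) (f : ℝ × ℝ → ℝ)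
    (u : ℝ × ℝ) : Fin 3 → ℝ :=
  r0 + ![(φ u).1, (φ u).2, f (φ u)] ᵥ* E

/-- Multiplication by a matrix from the right as a continuous linear map. -/
noncomputable def vecMulCLM (E : Matrix (Fin 3) (Fin 3) ℝ) : (Fin 3 → ℝ) →L[ℝ] (Fin 3 → ℝ) :=
  LinearMap.toContinuousLinearMap (Matrix.vecMulLinear E)

theorem vecMulCLM_apply (E : Matrix (Fin 3) (Fin 3) ℝ) (v : Fin 3 → ℝ) :
    vecMulCLM E v = v ᵥ* E := rfl

theorem fderiv_clm_comp {V W W' : Type} [NormedAddCommGroup V] [NormedSpace ℝ V]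
    [NormedAddCommGroup W] [NormedSpace ℝ W] [NormedAddCommGroup W'] [NormedSpace ℝ W']
    (L : W →L[ℝ] W') {F : V → W} (hF : ContDiff ℝ ∞ F) (u v : V) :
    fderiv ℝ (fun u => L (F u)) u v = L (fderiv ℝ F u v) := by
  rw [show fderiv ℝ (fun u => L (F u)) u = _ from
    (L.hasFDerivAt.comp u (hasFDerivAt_of_contDiff hF u)).fderiv]
  rfl

theorem fderiv_fst {V : Type} [NormedAddCommGroup V] [NormedSpace ℝ V] {F : V → ℝ × ℝ}
    (hF : ContDiff ℝ ∞ F) (u v : V) : fderiv ℝ (fun u => (F u).1) u v = (fderiv ℝ F u v).1 :=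
  fderiv_clm_comp (ContinuousLinearMap.fst ℝ ℝ ℝ) hF u v

theorem fderiv_snd {V : Type} [NormedAddCommGroup V] [NormedSpace ℝ V] {F : V → ℝ × ℝ}
    (hF : ContDiff ℝ ∞ F) (u v : V) : fderiv ℝ (fun u => (F u).2) u v = (fderiv ℝ F u v).2 :=
  fderiv_clm_comp (ContinuousLinearMap.snd ℝ ℝ ℝ) hF u v

theorem fderiv_comp_plane {V : Type} [NormedAddCommGroup V] [NormedSpace ℝ V] {F : V → ℝ × ℝ}
    {G : ℝ × ℝ → ℝ} (hG : ContDiff ℝ ∞ G) (hF : ContDiff ℝ ∞ F) (u v : V) :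
    fderiv ℝ (fun u => G (F u)) u v =
      (fderiv ℝ F u v).1 * dx G (F u) + (fderiv ℝ F u v).2 * dy G (F u) := by
  rw [← fderiv_eq_dx_dy, show fderiv ℝ (fun u => G (F u)) u = _ from
    ((hasFDerivAt_of_contDiff hG _).comp u (hasFDerivAt_of_contDiff hF u)).fderiv]
  rfl

theorem fderiv_vec_three {V : Type} [NormedAddCommGroup V] [NormedSpace ℝ V] {a b c : V → ℝ}
    (ha : ContDiff ℝ ∞ a) (hb : ContDiff ℝ ∞ b) (hc : ContDiff ℝ ∞ c) :
    ContDiff ℝ ∞ (fun u => ![a u, b u, c u]) ∧ ∀ u v, fderiv ℝ (fun u => ![a u, b u, c u]) u v =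
      ![fderiv ℝ a u v, fderiv ℝ b u v, fderiv ℝ c u v] := by
  have hs : ContDiff ℝ ∞ (fun u => ![a u, b u, c u]) := by
    rw [contDiff_pi]
    intro i
    fin_cases i
    exacts [ha, hb, hc]
  refine ⟨hs, fun u v => ?_⟩
  ext i
  have := fderiv_clm_comp (ContinuousLinearMap.proj (R := ℝ) (φ := fun _ : Fin 3 => ℝ) i) hs u v
  rw [ContinuousLinearMap.proj_apply] at this
  rw [← this]
  fin_cases i <;> rfl

theorem contDiff_graphMap (hφ : ContDiff ℝ ∞ φ) (hf : ContDiff ℝ ∞ f) :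
    ContDiff ℝ ∞ (graphMap r0 E φ f) := by
  have h1 := (fderiv_vec_three (contDiff_fst.comp hφ) (contDiff_snd.comp hφ) (hf.comp hφ)).1
  exact contDiff_const.add ((vecMulCLM E).contDiff.comp h1)

theorem fderiv_graphMap (hφ : ContDiff ℝ ∞ φ) (hf : ContDiff ℝ ∞ f) (u v : ℝ × ℝ) :
    fderiv ℝ (graphMap r0 E φ f) u v =
      ![(fderiv ℝ φ u v).1, (fderiv ℝ φ u v).2, fderiv ℝ f (φ u) (fderiv ℝ φ u v)] ᵥ* E := by
  obtain ⟨h1, h2⟩ := fderiv_vec_three (contDiff_fst.comp hφ) (contDiff_snd.comp hφ) (hf.comp hφ)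
  have h3 : graphMap r0 E φ f = fun u => r0 + vecMulCLM E
    (![(Prod.fst ∘ φ) u, (Prod.snd ∘ φ) u, (f ∘ φ) u]) := rfl
  rw [h3, fderiv_const_add, fderiv_clm_comp _ h1, h2, vecMulCLM_apply]
  simp only [Function.comp_def, fderiv_fst hφ, fderiv_snd hφ, fderiv_comp_plane hf hφ,
    fderiv_eq_dx_dy f]

/-- The Hessian form of a function as a bilinear form. -/
noncomputable def bilForm (f : ℝ × ℝ → ℝ) (p v w : ℝ × ℝ) : ℝ :=
  v.1 * w.1 * dx (dx f) p + (v.1 * w.2 + v.2 * w.1) * dx (dy f) p + v.2 * w.2 * dy (dy f) p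

theorem bilForm_self (f : ℝ × ℝ → ℝ) (p w : ℝ × ℝ) : bilForm f p w w = quadForm f p w := by
  simp only [bilForm, quadForm]
  ring

/-- The vector n is the second derivative of φ. Its contribution is tangent to the graph, so only
the Hessian form of f is transversal. -/
theorem fderiv_fderiv_graphMap (hφ : ContDiff ℝ ∞ φ) (hf : ContDiff ℝ ∞ f) (u v w : ℝ × ℝ) :
    ∃ n : ℝ × ℝ, fderiv ℝ (fderiv ℝ (graphMap r0 E φ f)) u v w =
      ![n.1, n.2, fderiv ℝ f (φ u) n + bilForm f (φ u) (fderiv ℝ φ u v) (fderiv ℝ φ u w)] ᵥ* E := by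
  have sx := contDiff_dx hf
  have sy := contDiff_dy hf
  have sw : ContDiff ℝ ∞ fun q => fderiv ℝ φ q w :=
    (hφ.fderiv_right (m := ∞) (by simp)).clm_apply contDiff_const
  have sw1 : ContDiff ℝ ∞ fun q => (fderiv ℝ φ q w).1 := contDiff_fst.comp sw
  have sw2 : ContDiff ℝ ∞ fun q => (fderiv ℝ φ q w).2 := contDiff_snd.comp sw
  have sxφ : ContDiff ℝ ∞ fun q => dx f (φ q) := sx.comp hφ
  have syφ : ContDiff ℝ ∞ fun q => dy f (φ q) := sy.comp hφ
  refine ⟨fderiv ℝ (fun q => fderiv ℝ φ q w) u v, ?_⟩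
  rw [← fderiv_fderiv_apply (contDiff_graphMap hφ hf)]
  have h3 : (fun q => fderiv ℝ (graphMap r0 E φ f) q w) = fun q => vecMulCLM E
      (![(fderiv ℝ φ q w).1, (fderiv ℝ φ q w).2,
        (fderiv ℝ φ q w).1 * dx f (φ q) + (fderiv ℝ φ q w).2 * dy f (φ q)]) := by
    funext q
    rw [fderiv_graphMap hφ hf, vecMulCLM_apply, fderiv_eq_dx_dy]
  obtain ⟨h1, h2⟩ := fderiv_vec_three sw1 sw2 ((sw1.mul sxφ).add (sw2.mul syφ))
  rw [h3, fderiv_clm_comp _ h1, h2, vecMulCLM_apply, fderiv_fst sw, fderiv_snd sw]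
  congr 3
  congr 1
  have e := ((hasFDerivAt_of_contDiff sw1 u).fun_mul (hasFDerivAt_of_contDiff sxφ u)).fun_add
    ((hasFDerivAt_of_contDiff sw2 u).fun_mul (hasFDerivAt_of_contDiff syφ u))
  rw [e.fderiv]
  simp only [_root_.add_apply, _root_.smul_apply, smul_eq_mul, fderiv_fst sw, fderiv_snd sw,
    fderiv_comp_plane sx hφ, fderiv_comp_plane sy hφ, dy_dx hf, fderiv_eq_dx_dy f, bilForm]
  ring

/-- The Jacobian determinant of a map of the plane. -/
noncomputable def jac (φ : ℝ × ℝ → ℝ × ℝ) (u : ℝ × ℝ) : ℝ :=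
  area (fderiv ℝ φ u (1, 0)) (fderiv ℝ φ u (0, 1))

theorem contDiff_jac (hφ : ContDiff ℝ ∞ φ) : ContDiff ℝ ∞ (jac φ) := by
  have h : ∀ w, ContDiff ℝ ∞ fun q => fderiv ℝ φ q w := fun w =>
    (hφ.fderiv_right (m := ∞) (by simp)).clm_apply contDiff_const
  exact ((contDiff_fst.comp (h _)).mul (contDiff_snd.comp (h _))).sub
    ((contDiff_snd.comp (h _)).mul (contDiff_fst.comp (h _)))

/-- The tangential part of the second derivative drops out of the determinant. -/
theorem secondForm_graphMap (hφ : ContDiff ℝ ∞ φ) (hf : ContDiff ℝ ∞ f) (u v w : ℝ × ℝ) :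
    secondForm (graphMap r0 E φ f) u v w =
      E.det * jac φ u * bilForm f (φ u) (fderiv ℝ φ u v) (fderiv ℝ φ u w) := by
  obtain ⟨n, hn⟩ := fderiv_fderiv_graphMap (r0 := r0) (E := E) hφ hf u v w
  rw [secondForm, hn, fderiv_graphMap hφ hf, fderiv_graphMap hφ hf]
  generalize bilForm f (φ u) (fderiv ℝ φ u v) (fderiv ℝ φ u w) = Q
  simp only [jac, area, fderiv_eq_dx_dy f]
  generalize fderiv ℝ φ u (1, 0) = a
  generalize fderiv ℝ φ u (0, 1) = b
  have : (Matrix.of ![![a.1, a.2, a.1 * dx f (φ u) + a.2 * dy f (φ u)] ᵥ* E,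
      ![b.1, b.2, b.1 * dx f (φ u) + b.2 * dy f (φ u)] ᵥ* E,
      ![n.1, n.2, n.1 * dx f (φ u) + n.2 * dy f (φ u) + Q] ᵥ* E]) =
      (Matrix.of ![![a.1, a.2, a.1 * dx f (φ u) + a.2 * dy f (φ u)],
      ![b.1, b.2, b.1 * dx f (φ u) + b.2 * dy f (φ u)],
      ![n.1, n.2, n.1 * dx f (φ u) + n.2 * dy f (φ u) + Q]]) * E := by
    ext i j
    fin_cases i <;> rfl
  rw [this, Matrix.det_mul, mul_comm, mul_assoc]
  congr 1
  rw [Matrix.det_fin_three]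
  simp
  ring

/-- Two Jacobian factors come from the scaling of the form and two from the change of basis. The
total factor is a square, so signs are preserved. -/
theorem hessian_graphMap (hφ : ContDiff ℝ ∞ φ) (hf : ContDiff ℝ ∞ f) (u : ℝ × ℝ) :
    hessian (graphMap r0 E φ f) u = E.det ^ 2 * jac φ u ^ 4 * hess f (φ u) := by
  simp only [hessian, secondForm_graphMap hφ hf, bilForm, jac, area, hess]
  ring

theorem vecMul_mem_range_iff (hφ : ContDiff ℝ ∞ φ) (hf : ContDiff ℝ ∞ f) (hE : E.det ≠ 0)
    {u : ℝ × ℝ} (hu : jac φ u ≠ 0) (p : ℝ × ℝ) (z : ℝ) :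
    ![p.1, p.2, z] ᵥ* E ∈
        LinearMap.range (fderiv ℝ (graphMap r0 E φ f) u : ℝ × ℝ →ₗ[ℝ] Fin 3 → ℝ) ↔
      z = p.1 * dx f (φ u) + p.2 * dy f (φ u) := by
  have hinj : ∀ v w : Fin 3 → ℝ, v ᵥ* E = w ᵥ* E → v = w := fun v w hvw =>
    Matrix.vecMul_injective_of_isUnit ((Matrix.isUnit_iff_isUnit_det E).2 hE.isUnit) hvw
  constructor
  · rintro ⟨v, hv⟩
    have hv : fderiv ℝ (graphMap r0 E φ f) u v = ![p.1, p.2, z] ᵥ* E := hv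
    rw [fderiv_graphMap hφ hf] at hv
    have h1 := hinj _ _ hv
    have e1 := congrFun h1 0
    have e2 := congrFun h1 1
    have e3 := congrFun h1 2
    simp only [fderiv_eq_dx_dy f] at e1 e2 e3
    simp at e1 e2 e3
    rw [← e1, ← e2, ← e3]
  · intro hz
    set a := fderiv ℝ φ u (1, 0) with ha
    set b := fderiv ℝ φ u (0, 1) with hb
    have hJ : a.1 * b.2 - a.2 * b.1 ≠ 0 := hu
    -- Cramer's rule for the preimage of p under the derivative of φ.
    set α := (p.1 * b.2 - p.2 * b.1) / (a.1 * b.2 - a.2 * b.1) with hα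
    set β := (a.1 * p.2 - a.2 * p.1) / (a.1 * b.2 - a.2 * b.1) with hβ
    have hw : fderiv ℝ φ u (α, β) = p := by
      have : ((α, β) : ℝ × ℝ) = α • ((1 : ℝ), (0 : ℝ)) + β • ((0 : ℝ), (1 : ℝ)) := by
        ext <;> simp
      rw [this, map_add, map_smul, map_smul, ← ha, ← hb]
      ext
      · simp only [Prod.fst_add, Prod.smul_fst, smul_eq_mul, hα, hβ]
        rw [div_mul_eq_mul_div, div_mul_eq_mul_div, ← add_div, div_eq_iff hJ]
        ring
      · simp only [Prod.snd_add, Prod.smul_snd, smul_eq_mul, hα, hβ]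
        rw [div_mul_eq_mul_div, div_mul_eq_mul_div, ← add_div, div_eq_iff hJ]
        ring
    refine ⟨(α, β), ?_⟩
    change fderiv ℝ (graphMap r0 E φ f) u (α, β) = _
    rw [fderiv_graphMap hφ hf, hw, fderiv_eq_dx_dy, hz]

theorem graphMap_sub (u v : ℝ × ℝ) : graphMap r0 E φ f v - graphMap r0 E φ f u =
    ![(φ v - φ u).1, (φ v - φ u).2, f (φ v) - f (φ u)] ᵥ* E := by
  simp only [graphMap, add_sub_add_left_eq_sub, ← Matrix.sub_vecMul]
  congr 1
  ext i
  fin_cases i <;> rfl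

theorem mem_tangentPlane_graphMap (hφ : ContDiff ℝ ∞ φ) (hf : ContDiff ℝ ∞ f) (hE : E.det ≠ 0)
    {u : ℝ × ℝ} (hu : jac φ u ≠ 0) (v : ℝ × ℝ) :
    graphMap r0 E φ f v ∈ tangentPlane (graphMap r0 E φ f) u ↔
      f (φ v) - f (φ u) =
        ((φ v).1 - (φ u).1) * dx f (φ u) + ((φ v).2 - (φ u).2) * dy f (φ u) := by
  rw [tangentPlane, AffineSubspace.mem_mk', vsub_eq_sub, graphMap_sub,
    vecMul_mem_range_iff hφ hf hE hu]
  rfl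

theorem isBitangent_of_tangentPlane_eq (hφ : ContDiff ℝ ∞ φ) (hf : ContDiff ℝ ∞ f)
    (hE : E.det ≠ 0) {u v : ℝ × ℝ} (hu : jac φ u ≠ 0) (hv : jac φ v ≠ 0) (hne : φ u ≠ φ v)
    (h : tangentPlane (graphMap r0 E φ f) u = tangentPlane (graphMap r0 E φ f) v) :
    IsBitangent f (φ u) (φ v) := by
  have hdir : LinearMap.range (fderiv ℝ (graphMap r0 E φ f) u : ℝ × ℝ →ₗ[ℝ] Fin 3 → ℝ) =
      LinearMap.range (fderiv ℝ (graphMap r0 E φ f) v : ℝ × ℝ →ₗ[ℝ] Fin 3 → ℝ) := by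
    have := congrArg AffineSubspace.direction h
    simpa only [tangentPlane, AffineSubspace.direction_mk'] using this
  -- The tangent vectors over the two basis directions at u also lie in the plane at v, so the
  -- gradients agree.
  have h1 := (vecMul_mem_range_iff (r0 := r0) hφ hf hE hu (1, 0) (dx f (φ u))).2 (by simp)
  have h2 := (vecMul_mem_range_iff (r0 := r0) hφ hf hE hu (0, 1) (dy f (φ u))).2 (by simp)
  rw [hdir, vecMul_mem_range_iff hφ hf hE hv] at h1 h2
  simp only [one_mul, zero_mul, add_zero, zero_add] at h1 h2
  have h3 : graphMap r0 E φ f v ∈ tangentPlane (graphMap r0 E φ f) u := by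
    rw [h]
    exact AffineSubspace.self_mem_mk' _ _
  rw [mem_tangentPlane_graphMap hφ hf hE hu] at h3
  refine ⟨hne, h1, h2, ?_⟩
  simp only [tangentHeight, ← h1, ← h2]
  linarith

theorem deriv_line {G : ℝ × ℝ → ℝ} (hG : ContDiff ℝ ∞ G) (p w : ℝ × ℝ) :
    deriv (fun t : ℝ => G (p + t • w)) = fun t => w.1 * dx G (p + t • w) + w.2 * dy G (p + t • w) := by
  funext t
  have h1 : HasDerivAt (fun t : ℝ => p + t • w) w t := by
    simpa using ((hasDerivAt_id t).smul_const w).const_add p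
  exact (hasDerivAt_comp_curve hG h1).deriv

/-- The cubic form divided by 6 is the coefficient of t³ in f(p + t w). -/
theorem cubicForm_eq_zero_of_isBigO (hf : ContDiff ℝ ∞ f) {p w : ℝ × ℝ} (hq : quadForm f p w = 0)
    (h : (fun t : ℝ => f (p + t • w) - (f p + t * fderiv ℝ f p w)) =O[𝓝 0] fun t : ℝ => t ^ 4) :
    cubicForm f p w = 0 := by
  have sx := contDiff_dx hf
  have sy := contDiff_dy hf
  have sl : ∀ {G : ℝ × ℝ → ℝ}, ContDiff ℝ ∞ G → ContDiff ℝ ∞ fun t : ℝ => G (p + t • w) := by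
    intro G hG
    exact hG.comp (contDiff_const.add (contDiff_id.smul contDiff_const))
  have c1 : deriv (fun t : ℝ => f (p + t • w)) = _ := deriv_line hf p w
  have s1 : ContDiff ℝ ∞ fun q => w.1 * dx f q + w.2 * dy f q :=
    (contDiff_const.mul sx).add (contDiff_const.mul sy)
  have dxc : ∀ {G : ℝ × ℝ → ℝ} (k : ℝ), ContDiff ℝ ∞ G →
      dx (fun q => k * G q) = fun q => k * dx G q := by
    intro G k hG
    funext q
    rw [dx, show fderiv ℝ (fun q => k * G q) q = _ from
      ((hasFDerivAt_of_contDiff hG q).const_mul k).fderiv]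
    rfl
  have dyc : ∀ {G : ℝ × ℝ → ℝ} (k : ℝ), ContDiff ℝ ∞ G →
      dy (fun q => k * G q) = fun q => k * dy G q := by
    intro G k hG
    funext q
    rw [dy, show fderiv ℝ (fun q => k * G q) q = _ from
      ((hasFDerivAt_of_contDiff hG q).const_mul k).fderiv]
    rfl
  have e2 : ∀ q, w.1 * dx (fun q => w.1 * dx f q + w.2 * dy f q) q +
      w.2 * dy (fun q => w.1 * dx f q + w.2 * dy f q) q = quadForm f q w := by
    intro q
    rw [dx_add (contDiff_const.mul sx) (contDiff_const.mul sy),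
      dy_add (contDiff_const.mul sx) (contDiff_const.mul sy), dxc _ sx, dxc _ sy, dyc _ sx,
      dyc _ sy, dy_dx hf]
    simp only [quadForm]
    ring
  have c2 : deriv (deriv (fun t : ℝ => f (p + t • w))) = fun t => quadForm f (p + t • w) w := by
    rw [c1, deriv_line s1 p w]
    funext t
    exact e2 _
  have sxx := contDiff_dx sx
  have sxy := contDiff_dx sy
  have syy := contDiff_dy sy
  have s2 : ContDiff ℝ ∞ fun q => quadForm f q w :=
    ((contDiff_const.mul sxx).add (contDiff_const.mul sxy)).add (contDiff_const.mul syy)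
  have c3 : deriv (deriv (deriv (fun t : ℝ => f (p + t • w)))) =
      fun t => cubicForm f (p + t • w) w := by
    rw [c2, deriv_line s2 p w]
    funext t
    simp only [quadForm]
    rw [dx_add ((contDiff_const.mul sxx).add (contDiff_const.mul sxy)) (contDiff_const.mul syy),
      dy_add ((contDiff_const.mul sxx).add (contDiff_const.mul sxy)) (contDiff_const.mul syy),
      dx_add (contDiff_const.mul sxx) (contDiff_const.mul sxy),
      dy_add (contDiff_const.mul sxx) (contDiff_const.mul sxy),
      dxc _ sxx, dxc _ sxy, dxc _ syy, dyc _ sxx, dyc _ sxy, dyc _ syy, dy_dx sx, dy_dx hf,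
      dy_dx sy]
    simp only [cubicForm]
    ring
  have hT := taylor_three (sl hf)
  rw [c3, c2, c1] at hT
  simp only [zero_smul, add_zero, hq, mul_zero, ← fderiv_eq_dx_dy] at hT
  have h43 : (fun t : ℝ => t ^ 4) =o[𝓝 0] fun t : ℝ => t ^ 3 := isLittleO_pow_pow (by norm_num)
  have h5 : (fun t : ℝ => t ^ 3 * (cubicForm f p w / 6)) =o[𝓝 0] fun t : ℝ => t ^ 3 :=
    ((h.trans_isLittleO h43).sub hT).congr_left fun t => by ring
  have h6 := (h5.mono (nhdsWithin_le_nhds (s := {0}ᶜ))).tendsto_div_nhds_zero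
  have h7 : Tendsto (fun t : ℝ => t ^ 3 * (cubicForm f p w / 6) / t ^ 3) (𝓝[≠] 0)
      (𝓝 (cubicForm f p w / 6)) := by
    refine tendsto_const_nhds.congr' ?_
    filter_upwards [self_mem_nhdsWithin] with t ht
    have : t ≠ 0 := ht
    field_simp
  have := tendsto_nhds_unique h6 h7
  linarith

/-- In affine coordinates the projected contact curve differs from p + t w by O(t⁴). As f is locally
Lipschitz, the curve can be replaced by the straight line. -/
theorem cubicForm_eq_zero_of_hasLineContact (hφ : ContDiff ℝ ∞ φ) (hf : ContDiff ℝ ∞ f)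
    (hE : E.det ≠ 0) {u v : ℝ × ℝ} (hq : quadForm f (φ u) (fderiv ℝ φ u v) = 0)
    (h : HasLineContact (graphMap r0 E φ f) u v 4) :
    cubicForm f (φ u) (fderiv ℝ φ u v) = 0 := by
  obtain ⟨c, hc, hc0, hO⟩ := h
  set w := fderiv ℝ φ u v with hw
  set p := φ u with hp
  have hO' := ((vecMulCLM E⁻¹).isBigO_comp _ (𝓝 0)).trans hO
  have hcoord : ∀ t : ℝ, vecMulCLM E⁻¹ (graphMap r0 E φ f (c t) -
      (graphMap r0 E φ f u + t • fderiv ℝ (graphMap r0 E φ f) u v)) =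
      ![(φ (c t) - (p + t • w)).1, (φ (c t) - (p + t • w)).2,
        f (φ (c t)) - (f p + t * fderiv ℝ f p w)] := by
    intro t
    rw [← sub_sub, graphMap_sub, fderiv_graphMap hφ hf, ← Matrix.smul_vecMul, ← Matrix.sub_vecMul,
      vecMulCLM_apply, Matrix.vecMul_vecMul, Matrix.mul_nonsing_inv _ hE.isUnit, Matrix.vecMul_one]
    ext i
    fin_cases i
    · simp [hp, hw]
      ring
    · simp [hp, hw]
      ring
    · simp [hp, hw]
      ring
  rw [isBigO_congr (Eventually.of_forall hcoord) EventuallyEq.rfl, isBigO_pi] at hO'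
  have h0 : (fun t => (φ (c t) - (p + t • w)).1) =O[𝓝 0] fun t : ℝ => t ^ 4 := hO' 0
  have h1 : (fun t => (φ (c t) - (p + t • w)).2) =O[𝓝 0] fun t : ℝ => t ^ 4 := hO' 1
  have h2 : (fun t => f (φ (c t)) - (f p + t * fderiv ℝ f p w)) =O[𝓝 0] fun t : ℝ => t ^ 4 := hO' 2
  have h01 : (fun t => φ (c t) - (p + t • w)) =O[𝓝 0] fun t : ℝ => t ^ 4 := h0.prod_left h1
  have hcc : ContinuousAt c 0 := hc.self_of_nhds.continuousAt
  have ht : Tendsto (fun t : ℝ => (φ (c t), p + t • w)) (𝓝 0) (𝓝 (p, p)) := by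
    refine Tendsto.prodMk_nhds ?_ ?_
    · have := (hφ.continuous.continuousAt.comp hcc).tendsto
      simpa [hc0, hp, Function.comp_def] using this
    · have : Continuous fun t : ℝ => p + t • w := by fun_prop
      simpa using this.tendsto 0
  have hs : HasStrictFDerivAt f (fderiv ℝ f p) p := hf.contDiffAt.hasStrictFDerivAt (by simp)
  have h3 := (hs.isBigO_sub.comp_tendsto ht).trans h01
  refine cubicForm_eq_zero_of_isBigO hf hq ?_
  refine (h2.sub h3).congr_left fun t => ?_
  simp only [Function.comp]
  ring

end GraphMap

/-! ### Affine charts -/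

section Congr

variable {r R : ℝ × ℝ → Fin 3 → ℝ} {u : ℝ × ℝ}

theorem secondForm_congr (h : r =ᶠ[𝓝 u] R) : secondForm r u = secondForm R u := by
  funext v w
  rw [secondForm, secondForm, h.fderiv_eq, (h.fderiv (𝕜 := ℝ)).fderiv_eq]

theorem hessian_congr (h : r =ᶠ[𝓝 u] R) : hessian r u = hessian R u := by
  rw [hessian, hessian, secondForm_congr h]

theorem tangentPlane_congr (h : r =ᶠ[𝓝 u] R) : tangentPlane r u = tangentPlane R u := by
  rw [tangentPlane, tangentPlane, h.fderiv_eq, h.eq_of_nhds]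

theorem HasLineContact.congr {v : ℝ × ℝ} {k : ℕ} (hc : HasLineContact r u v k)
    (h : r =ᶠ[𝓝 u] R) : HasLineContact R u v k := by
  obtain ⟨c, h1, h2, h3⟩ := hc
  refine ⟨c, h1, h2, h3.congr' ?_ EventuallyEq.rfl⟩
  have hcc : Tendsto c (𝓝 0) (𝓝 u) := by
    have := h1.self_of_nhds.continuousAt.tendsto
    rwa [h2] at this
  filter_upwards [hcc.eventually h] with t ht
  rw [ht, h.eq_of_nhds, h.fderiv_eq]

end Congr

/-- Affine coordinates of the space, given by the rows of `E`, in which the surface is near `g` the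
graph of `f` over the plane of the first two coordinates. -/
structure IsChart (r : ℝ × ℝ → Fin 3 → ℝ) (g : ℝ × ℝ) (E : Matrix (Fin 3) (Fin 3) ℝ)
    (φ ψ : ℝ × ℝ → ℝ × ℝ) (f : ℝ × ℝ → ℝ) : Prop where
  smooth_chart : ContDiff ℝ ∞ φ
  smooth_inv : ContDiff ℝ ∞ ψ
  smooth_fun : ContDiff ℝ ∞ f
  chart_base : φ g = 0
  inv_zero : ψ 0 = g
  left_inv : ∀ᶠ u in 𝓝 g, ψ (φ u) = u
  right_inv : ∀ᶠ p in 𝓝 0, φ (ψ p) = p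
  det_ne : E.det ≠ 0
  jac_ne : jac φ g ≠ 0
  eq_graph : r =ᶠ[𝓝 g] graphMap (r g) E φ f

/-! ### Existence of charts and reduction to normal form -/

section Existence

open Matrix

variable {r : ℝ × ℝ → Fin 3 → ℝ} {g : ℝ × ℝ}

theorem area_map (L : ℝ × ℝ →L[ℝ] ℝ × ℝ) (v w : ℝ × ℝ) :
    area (L v) (L w) = area (L (1, 0)) (L (0, 1)) * area v w := by
  have h : ∀ v : ℝ × ℝ, L v = v.1 • L (1, 0) + v.2 • L (0, 1) := by
    intro v
    rw [← map_smul, ← map_smul, ← map_add]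
    congr 1
    ext <;> simp
  rw [h v, h w]
  simp only [area, Prod.fst_add, Prod.snd_add, Prod.smul_fst, Prod.smul_snd, smul_eq_mul]
  ring

/-- The third row is the cross product c of the other two; the determinant is then c · c. -/
theorem exists_matrix_of_linearIndependent {a b : Fin 3 → ℝ}
    (h : ∀ s t : ℝ, s • a + t • b = 0 → s = 0 ∧ t = 0) :
    ∃ E : Matrix (Fin 3) (Fin 3) ℝ, E.det ≠ 0 ∧ E 0 = a ∧ E 1 = b := by
  have hli : LinearIndependent ℝ ![a, b] := LinearIndependent.pair_iff.2 h
  set c : Fin 3 → ℝ := crossProduct a b with hc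
  refine ⟨Matrix.of ![a, b, c], ?_, rfl, rfl⟩
  have hc0 : c ≠ 0 := crossProduct_ne_zero_iff_linearIndependent.2 hli
  have h1 : c ⬝ᵥ c ≠ 0 := by
    rwa [Ne, dotProduct_self_eq_zero]
  have h2 : (Matrix.of ![a, b, c]).det = c ⬝ᵥ c := by
    rw [Matrix.det_fin_three, hc, cross_apply]
    simp [dotProduct, Fin.sum_univ_three]
    ring
  rwa [h2]

/-- The first two axes are the tangent vectors dr(v) and dr(b), so the first two affine coordinates
parametrize the surface and the third is a function of them with zero gradient at 0. The choice of v
is left free in order to put the asymptotic direction on the x-axis. -/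
theorem exists_chart (hr : ∀ᶠ u in 𝓝 g, ContDiffAt ℝ ∞ r u)
    (himm : Function.Injective (fderiv ℝ r g)) {v b : ℝ × ℝ} (hvb : area v b ≠ 0) :
    ∃ E φ ψ f, IsChart r g E φ ψ f ∧ fderiv ℝ φ g v = (1, 0) ∧ f 0 = 0 ∧ dx f 0 = 0 ∧
      dy f 0 = 0 := by
  obtain ⟨E, hE, hE0, hE1⟩ := exists_matrix_of_linearIndependent (a := fderiv ℝ r g v)
    (b := fderiv ℝ r g b) (by
      intro s t hst
      rw [← map_smul, ← map_smul, ← map_add] at hst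
      have h0 : s • v + t • b = 0 := himm (hst.trans (map_zero _).symm)
      have e1 : s * v.1 + t * b.1 = 0 := congrArg Prod.fst h0
      have e2 : s * v.2 + t * b.2 = 0 := congrArg Prod.snd h0
      constructor
      · have : s * area v b = 0 := by simp only [area]; linear_combination b.2 * e1 - b.1 * e2
        exact (mul_eq_zero.1 this).resolve_right hvb
      · have : t * area v b = 0 := by simp only [area]; linear_combination v.1 * e2 - v.2 * e1
        exact (mul_eq_zero.1 this).resolve_right hvb)
  obtain ⟨w, sw, hw⟩ := exists_contDiff_eventuallyEq (a := g)
    (f := fun u => vecMulCLM E⁻¹ (r u - r g)) (by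
      filter_upwards [hr] with u hu
      exact (vecMulCLM E⁻¹).contDiff.contDiffAt.comp u (hu.sub contDiffAt_const))
  have hrd : HasFDerivAt r (fderiv ℝ r g) g :=
    (hr.self_of_nhds.differentiableAt (by simp)).hasFDerivAt
  have hwd : ∀ z, fderiv ℝ w g z = fderiv ℝ r g z ᵥ* E⁻¹ := by
    intro z
    rw [hw.fderiv_eq, show fderiv ℝ (fun u => vecMulCLM E⁻¹ (r u - r g)) g = _ from
      ((vecMulCLM E⁻¹).hasFDerivAt.comp g (hrd.sub_const (r g))).fderiv]
    rfl
  have hrow : ∀ i, E i ᵥ* E⁻¹ = Pi.single i 1 := by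
    intro i
    have h1 : Pi.single i 1 ᵥ* E = E i := Matrix.single_one_vecMul i E
    rw [← h1, Matrix.vecMul_vecMul, Matrix.mul_nonsing_inv _ hE.isUnit, Matrix.vecMul_one]
  have hwv : fderiv ℝ w g v = Pi.single 0 1 := by rw [hwd, ← hE0, hrow]
  have hwb : fderiv ℝ w g b = Pi.single 1 1 := by rw [hwd, ← hE1, hrow]
  have swi : ∀ i, ContDiff ℝ ∞ fun u => w u i := fun i => contDiff_pi.1 sw i
  have hwi : ∀ i z, fderiv ℝ (fun u => w u i) g z = fderiv ℝ w g z i := fun i z =>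
    fderiv_clm_comp (ContinuousLinearMap.proj (R := ℝ) (φ := fun _ : Fin 3 => ℝ) i) sw g z
  have hwg : w g = 0 := by
    rw [hw.eq_of_nhds, sub_self, map_zero]
  set φ : ℝ × ℝ → ℝ × ℝ := fun u => (w u 0, w u 1) with hφ
  have sφ : ContDiff ℝ ∞ φ := (swi 0).prodMk (swi 1)
  have hdφ : ∀ z, fderiv ℝ φ g z = (fderiv ℝ w g z 0, fderiv ℝ w g z 1) := by
    intro z
    rw [show fderiv ℝ φ g = _ from ((hasFDerivAt_of_contDiff (swi 0) g).prodMk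
      (hasFDerivAt_of_contDiff (swi 1) g)).fderiv, ContinuousLinearMap.prod_apply, hwi, hwi]
  have hφv : fderiv ℝ φ g v = (1, 0) := by rw [hdφ, hwv]; simp
  have hφb : fderiv ℝ φ g b = (0, 1) := by rw [hdφ, hwb]; simp
  have hJ : jac φ g ≠ 0 := by
    have h1 := area_map (fderiv ℝ φ g) v b
    rw [hφv, hφb] at h1
    intro h2
    rw [jac] at h2
    rw [h2, zero_mul] at h1
    simp [area] at h1
  have hφg : φ g = 0 := by simp [hφ, hwg]
  obtain ⟨ψ, sψ, hψ0, hl, hri⟩ := exists_contDiff_localInverse_of_injective sφ (a := g) (by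
    intro z hz
    have h1 := area_map (fderiv ℝ φ g) z b
    have h2 := area_map (fderiv ℝ φ g) v z
    rw [hz] at h1 h2
    have e1 : area z b = 0 := (mul_eq_zero.1 (h1.symm.trans (by simp [area]))).resolve_left hJ
    have e2 : area v z = 0 := (mul_eq_zero.1 (h2.symm.trans (by simp [area]))).resolve_left hJ
    simp only [area] at e1 e2 hvb
    ext
    · have : z.1 * (v.1 * b.2 - v.2 * b.1) = 0 := by linear_combination v.1 * e1 + b.1 * e2
      exact (mul_eq_zero.1 this).resolve_right hvb
    · have : z.2 * (v.1 * b.2 - v.2 * b.1) = 0 := by linear_combination v.2 * e1 + b.2 * e2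
      exact (mul_eq_zero.1 this).resolve_right hvb)
  rw [hφg] at hψ0 hri
  set f : ℝ × ℝ → ℝ := fun p => w (ψ p) 2 with hf
  have sf : ContDiff ℝ ∞ f := (swi 2).comp sψ
  have hfφ : ∀ᶠ u in 𝓝 g, f (φ u) = w u 2 := by
    filter_upwards [hl] with u hu
    simp only [hf, hu]
  have hdf : ∀ z, fderiv ℝ f 0 (fderiv ℝ φ g z) = fderiv ℝ w g z 2 := by
    intro z
    rw [← hwi 2, ← EventuallyEq.fderiv_eq hfφ, fderiv_comp_plane sf sφ, hφg, ← fderiv_eq_dx_dy]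
  refine ⟨E, φ, ψ, f, ⟨sφ, sψ, sf, hφg, hψ0, hl, hri, hE, hJ, ?_⟩, hφv, ?_, ?_, ?_⟩
  · filter_upwards [hw, hfφ] with u hu hfu
    have h1 : ![(φ u).1, (φ u).2, f (φ u)] = w u := by
      rw [hfu]
      ext i
      fin_cases i <;> rfl
    rw [graphMap, h1, hu, vecMulCLM_apply, Matrix.vecMul_vecMul,
      Matrix.nonsing_inv_mul _ hE.isUnit, Matrix.vecMul_one, add_sub_cancel]
  · simp [hf, hψ0, hwg]
  · rw [dx, ← hφv, hdf, hwv]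
    simp
  · rw [dy, ← hφb, hdf, hwb]
    simp

theorem dx_scale {F : ℝ × ℝ → ℝ} (hF : ContDiff ℝ ∞ F) (k s : ℝ) :
    dx (fun p => k * F (p.1, s * p.2)) = fun p => k * dx F (p.1, s * p.2) := by
  funext p
  have h0 : ContDiff ℝ ∞ fun p : ℝ × ℝ => (p.1, s * p.2) := by fun_prop
  have h1 : HasFDerivAt (fun p : ℝ × ℝ => (p.1, s * p.2))
      ((ContinuousLinearMap.fst ℝ ℝ ℝ).prod (s • ContinuousLinearMap.snd ℝ ℝ ℝ)) p :=
    hasFDerivAt_fst.prodMk (hasFDerivAt_snd.const_mul s)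
  have h2 := ((hasFDerivAt_of_contDiff hF _).comp p h1).const_mul k
  rw [dx, show fderiv ℝ (fun p => k * F (p.1, s * p.2)) p = _ from h2.fderiv]
  simp [dx]

theorem dy_scale {F : ℝ × ℝ → ℝ} (hF : ContDiff ℝ ∞ F) (k s : ℝ) :
    dy (fun p => k * F (p.1, s * p.2)) = fun p => (k * s) * dy F (p.1, s * p.2) := by
  funext p
  have h1 : HasFDerivAt (fun p : ℝ × ℝ => (p.1, s * p.2))
      ((ContinuousLinearMap.fst ℝ ℝ ℝ).prod (s • ContinuousLinearMap.snd ℝ ℝ ℝ)) p :=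
    hasFDerivAt_fst.prodMk (hasFDerivAt_snd.const_mul s)
  have h2 := ((hasFDerivAt_of_contDiff hF _).comp p h1).const_mul k
  rw [dy, show fderiv ℝ (fun p => k * F (p.1, s * p.2)) p = _ from h2.fderiv]
  simp [fderiv_eq_dx_dy F]
  ring

/-- Scaling y and the height separately gives the two parameters needed to normalize f_yy and f_xxy.
-/
theorem IsChart.rescale {E φ ψ f} (h : IsChart r g E φ ψ f) {s t : ℝ} (hs : s ≠ 0) (ht : t ≠ 0) :
    IsChart r g (Matrix.diagonal ![1, s, t] * E) (fun u => ((φ u).1, s⁻¹ * (φ u).2))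
      (fun p => ψ (p.1, s * p.2)) (fun p => t⁻¹ * f (p.1, s * p.2)) where
  smooth_chart :=
    (contDiff_fst.comp h.smooth_chart).prodMk (contDiff_const.mul (contDiff_snd.comp h.smooth_chart))
  smooth_inv := h.smooth_inv.comp (by fun_prop)
  smooth_fun := contDiff_const.mul (h.smooth_fun.comp (by fun_prop))
  chart_base := by simp [h.chart_base]
  inv_zero := by simpa [Prod.mk_zero_zero] using h.inv_zero
  left_inv := by
    filter_upwards [h.left_inv] with u hu
    simp only [mul_inv_cancel_left₀ hs]
    exact hu
  right_inv := by
    have : Tendsto (fun p : ℝ × ℝ => (p.1, s * p.2)) (𝓝 0) (𝓝 0) := by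
      have : Continuous fun p : ℝ × ℝ => (p.1, s * p.2) := by fun_prop
      simpa [Prod.mk_zero_zero] using this.tendsto 0
    filter_upwards [this.eventually h.right_inv] with p hp
    rw [hp]
    simp only [inv_mul_cancel_left₀ hs]
  det_ne := by
    rw [Matrix.det_mul, Matrix.det_diagonal]
    refine mul_ne_zero ?_ h.det_ne
    simp [Fin.prod_univ_three, hs, ht]
  jac_ne := by
    have h1 := hasFDerivAt_of_contDiff h.smooth_chart g
    have h2 : HasFDerivAt (fun u => ((φ u).1, s⁻¹ * (φ u).2))
        (((ContinuousLinearMap.fst ℝ ℝ ℝ).comp (fderiv ℝ φ g)).prod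
          (s⁻¹ • (ContinuousLinearMap.snd ℝ ℝ ℝ).comp (fderiv ℝ φ g))) g :=
      (hasFDerivAt_fst.comp g h1).prodMk ((hasFDerivAt_snd.comp g h1).const_mul s⁻¹)
    have h3 : jac (fun u => ((φ u).1, s⁻¹ * (φ u).2)) g = s⁻¹ * jac φ g := by
      rw [jac, h2.fderiv]
      simp [jac, area]
      ring
    rw [h3]
    exact mul_ne_zero (inv_ne_zero hs) h.jac_ne
  eq_graph := by
    filter_upwards [h.eq_graph] with u hu
    rw [hu, graphMap, graphMap, ← Matrix.vecMul_vecMul]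
    congr 2
    ext i
    rw [Matrix.vecMul_diagonal]
    fin_cases i
    · simp
    · simp
      field_simp
    · simp only [mul_inv_cancel_left₀ hs]
      simp
      field_simp

namespace IsChart

variable {E : Matrix (Fin 3) (Fin 3) ℝ} {φ ψ : ℝ × ℝ → ℝ × ℝ} {f : ℝ × ℝ → ℝ}
  (h : IsChart r g E φ ψ f)
include h

theorem tendsto_chart : Tendsto φ (𝓝 g) (𝓝 0) := by
  have := h.smooth_chart.continuous.tendsto g
  rwa [h.chart_base] at this

theorem tendsto_inv : Tendsto ψ (𝓝 0) (𝓝 g) := by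
  have := h.smooth_inv.continuous.tendsto 0
  rwa [h.inv_zero] at this

theorem eventually_jac_ne : ∀ᶠ u in 𝓝 g, jac φ u ≠ 0 :=
  (contDiff_jac h.smooth_chart).continuous.continuousAt.eventually_ne h.jac_ne

theorem eventually_eq_graph : ∀ᶠ u in 𝓝 g, r =ᶠ[𝓝 u] graphMap (r g) E φ f :=
  eventually_eventually_nhds.2 h.eq_graph

theorem eventually_secondForm : ∀ᶠ u in 𝓝 g, ∀ v w, secondForm r u v w =
    E.det * jac φ u * bilForm f (φ u) (fderiv ℝ φ u v) (fderiv ℝ φ u w) := by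
  filter_upwards [h.eventually_eq_graph] with u hu v w
  rw [secondForm_congr hu, secondForm_graphMap h.smooth_chart h.smooth_fun]

theorem eventually_hessian : ∀ᶠ u in 𝓝 g,
    hessian r u = E.det ^ 2 * jac φ u ^ 4 * hess f (φ u) := by
  filter_upwards [h.eventually_eq_graph] with u hu
  rw [hessian_congr hu, hessian_graphMap h.smooth_chart h.smooth_fun]

/-- The derivative of the determinant of the second form at parabolic points. -/
theorem eventually_fderiv_hessian : ∀ᶠ u in 𝓝 g, hess f (φ u) = 0 → ∀ v,
    fderiv ℝ (hessian r) u v = E.det ^ 2 * jac φ u ^ 4 * fderiv ℝ (hess f) (φ u)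
      (fderiv ℝ φ u v) := by
  filter_upwards [eventually_eventually_nhds.2 h.eventually_hessian] with u hu h0 v
  have sJ : ContDiff ℝ ∞ fun u => E.det ^ 2 * jac φ u ^ 4 :=
    contDiff_const.mul ((contDiff_jac h.smooth_chart).pow 4)
  have sH := (contDiff_hess h.smooth_fun).comp h.smooth_chart
  rw [EventuallyEq.fderiv_eq hu, show fderiv ℝ (fun u => E.det ^ 2 * jac φ u ^ 4 * hess f (φ u)) u
    = _ from ((hasFDerivAt_of_contDiff sJ u).fun_mul (hasFDerivAt_of_contDiff sH u)).fderiv]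
  simp only [Function.comp, h0, zero_smul, add_zero, _root_.smul_apply, smul_eq_mul]
  congr 1
  rw [fderiv_eq_dx_dy (hess f)]
  exact fderiv_comp_plane (contDiff_hess h.smooth_fun) h.smooth_chart u v

theorem fderiv_inv_apply : ∀ᶠ u in 𝓝 g, ∀ v, fderiv ℝ ψ (φ u) (fderiv ℝ φ u v) = v := by
  filter_upwards [eventually_eventually_nhds.2 h.left_inv] with u hu v
  have h1 : HasFDerivAt (fun u => ψ (φ u)) _ u :=
    (hasFDerivAt_of_contDiff h.smooth_inv (φ u)).comp u (hasFDerivAt_of_contDiff h.smooth_chart u)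
  have h2 : fderiv ℝ (fun u => ψ (φ u)) u = fderiv ℝ id u := EventuallyEq.fderiv_eq hu
  rw [h1.fderiv, fderiv_id] at h2
  exact congrArg (fun L : ℝ × ℝ →L[ℝ] ℝ × ℝ => L v) h2

theorem fderiv_chart_apply : ∀ᶠ p in 𝓝 0, ∀ w, fderiv ℝ φ (ψ p) (fderiv ℝ ψ p w) = w := by
  filter_upwards [eventually_eventually_nhds.2 h.right_inv] with p hp w
  have h1 : HasFDerivAt (fun p => φ (ψ p)) _ p :=
    (hasFDerivAt_of_contDiff h.smooth_chart (ψ p)).comp p (hasFDerivAt_of_contDiff h.smooth_inv p)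
  have h2 : fderiv ℝ (fun p => φ (ψ p)) p = fderiv ℝ id p := EventuallyEq.fderiv_eq hp
  rw [h1.fderiv, fderiv_id] at h2
  exact congrArg (fun L : ℝ × ℝ →L[ℝ] ℝ × ℝ => L w) h2

end IsChart

/-- Near a godron the surface is in suitable affine coordinates the graph of a function in normal
form. -/
theorem exists_normalForm_chart (hr : ∀ᶠ u in 𝓝 g, ContDiffAt ℝ ∞ r u)
    (himm : Function.Injective (fderiv ℝ r g)) (hgod : IsGodron r g) :
    ∃ E φ ψ f lam, IsChart r g E φ ψ f ∧ IsNormalForm f lam := by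
  obtain ⟨⟨hpar, v₁, hv₁⟩, hreg, v, ⟨hv0, hvv⟩, hvt⟩ := hgod
  have hvb : area v (-v.2, v.1) ≠ 0 := by
    have : 0 < v.1 ^ 2 + v.2 ^ 2 := by
      by_contra hle
      have h1 : v.1 = 0 := by nlinarith [sq_nonneg v.1, sq_nonneg v.2]
      have h2 : v.2 = 0 := by nlinarith [sq_nonneg v.1, sq_nonneg v.2]
      exact hv0 (Prod.ext h1 h2)
    simp only [area]
    nlinarith
  obtain ⟨E, φ, ψ, f, h, hφv, hf0, hfx, hfy⟩ := exists_chart hr himm hvb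
  have sf := h.smooth_fun
  have hk : E.det * jac φ g ≠ 0 := mul_ne_zero h.det_ne h.jac_ne
  have hK : E.det ^ 2 * jac φ g ^ 4 ≠ 0 :=
    mul_ne_zero (pow_ne_zero _ h.det_ne) (pow_ne_zero _ h.jac_ne)
  have hS := h.eventually_secondForm.self_of_nhds
  have hH := h.eventually_hessian.self_of_nhds
  have hD := h.eventually_fderiv_hessian.self_of_nhds
  simp only [h.chart_base] at hS hH hD
  -- The godron conditions translate one by one: v asymptotic gives f_xx = 0, parabolicity f_xy = 0
  -- and f_yy ≠ 0, tangency f_xxx = 0, regularity f_xxy ≠ 0.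
  have hxx : dx (dx f) 0 = 0 := by
    have h1 := hS v v
    rw [hvv, hφv] at h1
    have := (mul_eq_zero.1 h1.symm).resolve_left hk
    simpa [bilForm] using this
  have hH0 : hess f 0 = 0 := (mul_eq_zero.1 (hH.symm.trans hpar)).resolve_left hK
  have hxy : dx (dy f) 0 = 0 := by
    simpa [hess, hxx] using hH0
  have hyy : dy (dy f) 0 ≠ 0 := by
    intro h0
    apply hv₁
    rw [hS]
    simp [bilForm, hxx, hxy, h0]
  have hD' := hD hH0
  have hHx : dx (hess f) 0 = 0 := by
    have h1 := hD' v
    rw [hvt, hφv] at h1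
    exact (mul_eq_zero.1 h1.symm).resolve_left hK
  have hHy : dy (hess f) 0 ≠ 0 := by
    intro h0
    apply hreg
    refine ContinuousLinearMap.ext fun z => ?_
    rw [hD', fderiv_eq_dx_dy, hHx, h0]
    simp
  have hxxx : dx (dx (dx f)) 0 = 0 := by
    rw [dx_hess sf] at hHx
    simp only [hxx, hxy] at hHx
    have : dx (dx (dx f)) 0 * dy (dy f) 0 = 0 := by linarith
    exact (mul_eq_zero.1 this).resolve_right hyy
  have hxxy : dx (dx (dy f)) 0 ≠ 0 := by
    intro h0
    apply hHy
    rw [dy_hess sf]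
    simp only [hxx, hxy, h0]
    ring
  set A := dy (dy f) 0 with hA
  set B := dx (dx (dy f)) 0 with hB
  -- The scales solve s²A/t = 1 and sB/t = -2.
  set s : ℝ := -B / (2 * A) with hs
  have hs0 : s ≠ 0 := div_ne_zero (neg_ne_zero.2 hxxy) (mul_ne_zero two_ne_zero hyy)
  set t : ℝ := s ^ 2 * A with ht
  have ht0 : t ≠ 0 := mul_ne_zero (pow_ne_zero 2 hs0) hyy
  refine ⟨_, _, _, _, t⁻¹ * dx (dx (dx (dx f))) 0 / 12, h.rescale hs0 ht0, ?_⟩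
  have sx := contDiff_dx sf
  have sy := contDiff_dy sf
  have sxx := contDiff_dx sx
  have sxy := contDiff_dx sy
  have sxxx := contDiff_dx sxx
  refine ⟨(h.rescale hs0 ht0).smooth_fun, ?_, ?_, ?_, ?_, ?_, ?_, ?_, ?_, ?_⟩
  · simp [Prod.mk_zero_zero, hf0]
  · rw [dx_scale sf]
    simp [Prod.mk_zero_zero, hfx]
  · rw [dy_scale sf]
    simp [Prod.mk_zero_zero, hfy]
  · rw [dx_scale sf, dx_scale sx]
    simp [Prod.mk_zero_zero, hxx]
  · rw [dy_scale sf, dx_scale sy]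
    simp [Prod.mk_zero_zero, hxy]
  · rw [dy_scale sf, dy_scale sy]
    simp only [Prod.fst_zero, Prod.snd_zero, mul_zero, Prod.mk_zero_zero, ← hA, ht]
    field_simp
  · rw [dx_scale sf, dx_scale sx, dx_scale sxx]
    simp [Prod.mk_zero_zero, hxxx]
  · rw [dy_scale sf, dx_scale sy, dx_scale sxy]
    simp only [Prod.fst_zero, Prod.snd_zero, mul_zero, Prod.mk_zero_zero, ← hB, ht]
    rw [inv_mul_eq_div, div_mul_eq_mul_div, div_eq_iff ht0, ht]
    have : B = -2 * (s * A) := by rw [hs]; field_simp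
    rw [this]
    ring
  · rw [dx_scale sf, dx_scale sx, dx_scale sxx, dx_scale sxxx]
    simp only [Prod.fst_zero, Prod.snd_zero, mul_zero, Prod.mk_zero_zero]
    ring

end Existence

/-! ### Arcs and Legendrian lifts -/

section Arc

variable {γ : ℝ → ℝ × ℝ} {g : ℝ × ℝ}

theorem IsArcAt.exists_smooth (hγ : IsArcAt γ g) : ∃ c : ℝ → ℝ × ℝ, ContDiff ℝ ∞ c ∧ c =ᶠ[𝓝 0] γ ∧
    deriv c 0 = deriv γ 0 ∧ deriv (deriv c) 0 = deriv (deriv γ) 0 := by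
  obtain ⟨c, hc, he⟩ := exists_contDiff_eventuallyEq hγ.1
  exact ⟨c, hc, he, he.deriv_eq, he.deriv.deriv_eq⟩

theorem IsArcAt.tendsto (hγ : IsArcAt γ g) : Tendsto γ (𝓝 0) (𝓝 g) := by
  have := hγ.1.self_of_nhds.continuousAt.tendsto
  rwa [hγ.2.1] at this

theorem IsCurveGerm.eventually_mem {A : Set (ℝ × ℝ)} (h : IsCurveGerm A g γ) :
    ∀ᶠ t in 𝓝 0, γ t ∈ A := by
  obtain ⟨δ, hδ, hδ0⟩ := (h.2.and self_mem_nhdsWithin).exists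
  have hδ0 : 0 < δ := hδ0
  filter_upwards [h.1.tendsto.eventually hδ.mem_iff, Ioo_mem_nhds (neg_lt_zero.2 hδ0) hδ0]
    with t ht hm
  exact ht.2 (mem_image_of_mem _ hm)

theorem hasDerivAt_deriv {c : ℝ → ℝ × ℝ} (hc : ContDiff ℝ ∞ c) (t : ℝ) :
    HasDerivAt c (deriv c t) t ∧ HasDerivAt (deriv c) (deriv (deriv c) t) t := by
  have h1 : ContDiff ℝ ∞ (deriv c) := (contDiff_infty_iff_deriv.1 hc).2
  exact ⟨(hc.differentiable (by simp) t).hasDerivAt, (h1.differentiable (by simp) t).hasDerivAt⟩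

theorem hasDerivAt_fst {c : ℝ → ℝ × ℝ} {c' : ℝ × ℝ} {t : ℝ} (h : HasDerivAt c c' t) :
    HasDerivAt (fun t => (c t).1) c'.1 t :=
  (ContinuousLinearMap.fst ℝ ℝ ℝ).hasFDerivAt.comp_hasDerivAt t h

theorem hasDerivAt_snd {c : ℝ → ℝ × ℝ} {c' : ℝ × ℝ} {t : ℝ} (h : HasDerivAt c c' t) :
    HasDerivAt (fun t => (c t).2) c'.2 t :=
  (ContinuousLinearMap.snd ℝ ℝ ℝ).hasFDerivAt.comp_hasDerivAt t h

theorem deriv_legendrianLift {a b : ℝ × ℝ} (hγ : IsArcAt γ g) (ha : area a (deriv γ 0) = 0)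
    (hb : area (deriv γ 0) b ≠ 0) : deriv (legendrianLift a b γ) 0 =
      (deriv γ 0, area a (deriv (deriv γ) 0) / area (deriv γ 0) b) := by
  obtain ⟨c, hc, hcγ, h1, h2⟩ := hγ.exists_smooth
  have he : legendrianLift a b γ =ᶠ[𝓝 0] legendrianLift a b c := by
    filter_upwards [hcγ, hcγ.deriv] with t ht ht'
    rw [legendrianLift, legendrianLift, ht, ht']
  rw [he.deriv_eq, ← h1, ← h2]
  rw [← h1] at ha hb
  obtain ⟨d1, d2⟩ := hasDerivAt_deriv hc 0
  have f1 : HasDerivAt (fun t => (deriv c t).1) (deriv (deriv c) 0).1 0 :=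
    hasDerivAt_fst d2
  have f2 : HasDerivAt (fun t => (deriv c t).2) (deriv (deriv c) 0).2 0 :=
    hasDerivAt_snd d2
  have n1 : HasDerivAt (fun t => area a (deriv c t)) (area a (deriv (deriv c) 0)) 0 :=
    (f2.const_mul a.1).sub (f1.const_mul a.2)
  have n2 : HasDerivAt (fun t => area (deriv c t) b) (area (deriv (deriv c) 0) b) 0 :=
    (f1.mul_const b.2).sub (f2.mul_const b.1)
  have n3 := d1.prodMk (n1.fun_div n2 hb)
  -- The derivative of the denominator is multiplied by area a (γ'(0)) = 0.
  rw [show deriv (legendrianLift a b c) 0 = _ from n3.deriv, ha, zero_mul, sub_zero]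
  congr 1
  field_simp

theorem deriv_fibreLift (g : ℝ × ℝ) : deriv (fibreLift g) 0 = (0, 1) :=
  ((hasDerivAt_const (0 : ℝ) g).prodMk (hasDerivAt_id (0 : ℝ))).deriv

/-- The cross-ratio of tangent lines of Legendrian lifts in terms of second derivatives. -/
theorem IsCrossRatio.eq_div {v : ℝ × ℝ} {μ₁ μ₂ μ₃ s₁ s₂ s₃ A ρ : ℝ} (hv : v ≠ 0) (hμ₁ : μ₁ ≠ 0)
    (hμ₂ : μ₂ ≠ 0) (hμ₃ : μ₃ ≠ 0) (hA : A ≠ 0)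
    (h : IsCrossRatio (μ₁ • v, s₁ / (μ₁ * A)) (μ₂ • v, s₂ / (μ₂ * A)) (μ₃ • v, s₃ / (μ₃ * A))
      ((0 : ℝ × ℝ), (1 : ℝ)) ρ) :
    s₂ / μ₂ ^ 2 - s₃ / μ₃ ^ 2 ≠ 0 ∧
      ρ * (s₂ / μ₂ ^ 2 - s₃ / μ₃ ^ 2) = s₁ / μ₁ ^ 2 - s₃ / μ₃ ^ 2 := by
  obtain ⟨-, α₁, β₁, α₂, β₂, h1, h2, hα₁, hα₂, hβ₂, rfl⟩ := h
  -- The base components give α = μ/μ₃, after which the fibre components give β. Dividing by μ²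
  -- removes the dependence on the parametrization.
  have key : ∀ {μ α β s : ℝ}, μ ≠ 0 → α ≠ 0 →
      (μ • v, s / (μ * A)) = α • (μ₃ • v, s₃ / (μ₃ * A)) + β • ((0 : ℝ × ℝ), (1 : ℝ)) →
      β / α = μ₃ / A * (s / μ ^ 2 - s₃ / μ₃ ^ 2) := by
    intro μ α β s hμ hα he
    have e1 : μ • v = α • μ₃ • v + β • (0 : ℝ × ℝ) := congrArg Prod.fst he
    have e2 : s / (μ * A) = α * (s₃ / (μ₃ * A)) + β * 1 := congrArg Prod.snd he
    rw [smul_zero, add_zero, smul_smul] at e1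
    have e3 : μ = α * μ₃ := smul_left_injective ℝ hv e1
    subst e3
    have e4 : β = s / (α * μ₃ * A) - α * (s₃ / (μ₃ * A)) := by linarith
    rw [e4]
    field_simp
  have k1 := key hμ₁ hα₁ h1
  have k2 := key hμ₂ hα₂ h2
  have hne : s₂ / μ₂ ^ 2 - s₃ / μ₃ ^ 2 ≠ 0 := by
    intro h0
    rw [h0, mul_zero] at k2
    exact div_ne_zero hβ₂ hα₂ k2
  refine ⟨hne, ?_⟩
  rw [k1, k2, mul_div_mul_left _ _ (div_ne_zero hμ₃ hA), div_mul_cancel₀ _ hne]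

end Arc

/-! ### The cr-invariant in a normal-form chart -/

section Chart

variable {r : ℝ × ℝ → Fin 3 → ℝ} {g : ℝ × ℝ} {E : Matrix (Fin 3) (Fin 3) ℝ}
  {φ ψ : ℝ × ℝ → ℝ × ℝ} {f : ℝ × ℝ → ℝ} {lam : ℝ}

theorem deriv_deriv_comp {G : ℝ × ℝ → ℝ} (hG : ContDiff ℝ ∞ G) {c : ℝ → ℝ × ℝ}
    (hc : ContDiff ℝ ∞ c) : deriv (deriv fun t => G (c t)) 0 =
      quadForm G (c 0) (deriv c 0) + fderiv ℝ G (c 0) (deriv (deriv c) 0) := by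
  have h1 : (deriv fun t => G (c t)) =
      fun t => (deriv c t).1 * dx G (c t) + (deriv c t).2 * dy G (c t) := by
    funext t
    exact (hasDerivAt_comp_curve hG (hasDerivAt_deriv hc t).1).deriv
  obtain ⟨d1, d2⟩ := hasDerivAt_deriv hc 0
  have f1 : HasDerivAt (fun t => (deriv c t).1) (deriv (deriv c) 0).1 0 :=
    hasDerivAt_fst d2
  have f2 : HasDerivAt (fun t => (deriv c t).2) (deriv (deriv c) 0).2 0 :=
    hasDerivAt_snd d2
  have h2 := (f1.fun_mul (hasDerivAt_comp_curve (contDiff_dx hG) d1)).fun_add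
    (f2.fun_mul (hasDerivAt_comp_curve (contDiff_dy hG) d1))
  rw [h1, h2.deriv, dy_dx hG, fderiv_eq_dx_dy]
  simp only [quadForm]
  ring

/-- The curvature coefficient, in the chart, of an arc tangent to the first axis. -/
theorem IsChart.tendsto_arc (h : IsChart r g E φ ψ f) {γ : ℝ → ℝ × ℝ} (hγ : IsArcAt γ g)
    {v : ℝ × ℝ} (hv : fderiv ℝ φ g v = (1, 0)) {μ : ℝ} (hμ : deriv γ 0 = μ • v) (hμ0 : μ ≠ 0) :
    Tendsto (fun t => (φ (γ t)).1) (𝓝[≠] 0) (𝓝 0) ∧ (∀ᶠ t in 𝓝[≠] 0, (φ (γ t)).1 ≠ 0) ∧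
    Tendsto (fun t => (φ (γ t)).2 / (φ (γ t)).1 ^ 2) (𝓝[≠] 0)
      (𝓝 ((quadForm (fun u => (φ u).2) g v +
        (fderiv ℝ φ g (deriv (deriv γ) 0)).2 / μ ^ 2) / 2)) := by
  obtain ⟨c, hc, hcγ, h1, h2⟩ := hγ.exists_smooth
  have hc0 : c 0 = g := hcγ.eq_of_nhds.trans hγ.2.1
  have sφ := h.smooth_chart
  have s1 : ContDiff ℝ ∞ fun u => (φ u).1 := contDiff_fst.comp sφ
  have s2 : ContDiff ℝ ∞ fun u => (φ u).2 := contDiff_snd.comp sφ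
  have sc1 : ContDiff ℝ ∞ fun t => (φ (c t)).1 := s1.comp hc
  have sc2 : ContDiff ℝ ∞ fun t => (φ (c t)).2 := s2.comp hc
  have hd : fderiv ℝ φ g (deriv c 0) = (μ, 0) := by
    rw [h1, hμ, map_smul, hv]
    simp
  have d1 : HasDerivAt (fun t => (φ (c t)).1) μ 0 := by
    have := hasDerivAt_comp_curve s1 (hasDerivAt_deriv hc 0).1
    rw [← fderiv_eq_dx_dy (fun u => (φ u).1), fderiv_fst sφ, hc0, hd] at this
    exact this
  have d2 : deriv (fun t => (φ (c t)).2) 0 = 0 := by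
    have := hasDerivAt_comp_curve s2 (hasDerivAt_deriv hc 0).1
    rw [← fderiv_eq_dx_dy (fun u => (φ u).2), fderiv_snd sφ, hc0, hd] at this
    exact this.deriv
  have d3 : deriv (deriv fun t => (φ (c t)).2) 0 =
      μ ^ 2 * quadForm (fun u => (φ u).2) g v + (fderiv ℝ φ g (deriv (deriv γ) 0)).2 := by
    rw [deriv_deriv_comp s2 hc, hc0, fderiv_snd sφ, h2, h1, hμ]
    simp only [quadForm, Prod.smul_fst, Prod.smul_snd, smul_eq_mul]
    ring
  have hx0 : (φ (c 0)).1 = 0 := by rw [hc0, h.chart_base]; rfl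
  have hy0 : (φ (c 0)).2 = 0 := by rw [hc0, h.chart_base]; rfl
  have l1 : Tendsto (fun t => (φ (c t)).1 / t) (𝓝[≠] 0) (𝓝 μ) := by
    refine d1.tendsto_slope.congr fun t => ?_
    simp [slope_def_field, hx0]
  have l2 := tendsto_div_sq_of_deriv_eq_zero sc2 hy0 d2
  rw [d3] at l2
  have hev : ∀ᶠ t in 𝓝[≠] (0 : ℝ), c t = γ t := nhdsWithin_le_nhds hcγ
  have hne : ∀ᶠ t in 𝓝[≠] (0 : ℝ), t ≠ 0 := self_mem_nhdsWithin
  refine ⟨?_, ?_, ?_⟩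
  · have : Tendsto (fun t => (φ (c t)).1) (𝓝 0) (𝓝 0) := by
      have := sc1.continuous.tendsto 0
      simpa only [hx0] using this
    refine (tendsto_nhdsWithin_of_tendsto_nhds this).congr' ?_
    filter_upwards [hev] with t ht
    rw [ht]
  · filter_upwards [l1.eventually_ne hμ0, hev] with t ht he h0
    rw [he, h0, zero_div] at ht
    exact ht rfl
  · have l3 := l2.div (l1.pow 2) (pow_ne_zero 2 hμ0)
    have e : (μ ^ 2 * quadForm (fun u => (φ u).2) g v + (fderiv ℝ φ g (deriv (deriv γ) 0)).2) / 2 /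
        μ ^ 2 = (quadForm (fun u => (φ u).2) g v +
          (fderiv ℝ φ g (deriv (deriv γ) 0)).2 / μ ^ 2) / 2 := by
      field_simp
    rw [e] at l3
    refine l3.congr' ?_
    filter_upwards [hev, hne] with t he ht
    simp only [Pi.div_apply]
    rw [← he]
    field_simp

theorem IsChart.eventually_flecnodal (h : IsChart r g E φ ψ f) (Ω : Set (ℝ × ℝ)) :
    ∀ᶠ u in 𝓝 g, u ∈ flecnodalSet r Ω → ∃ w : ℝ × ℝ, w ≠ 0 ∧ quadForm f (φ u) w = 0 ∧
      cubicForm f (φ u) w = 0 := by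
  filter_upwards [h.eventually_secondForm, h.eventually_jac_ne, h.eventually_eq_graph,
    h.fderiv_inv_apply] with u hS hJ hg hi ⟨_, v, ⟨hv0, hvv⟩, hc⟩
  have hq : quadForm f (φ u) (fderiv ℝ φ u v) = 0 := by
    rw [hS, bilForm_self] at hvv
    exact (mul_eq_zero.1 hvv).resolve_left (mul_ne_zero h.det_ne hJ)
  refine ⟨fderiv ℝ φ u v, ?_, hq, cubicForm_eq_zero_of_hasLineContact h.smooth_chart h.smooth_fun
    h.det_ne hq (hc.congr hg)⟩
  intro h0
  apply hv0
  rw [← hi v, h0, map_zero]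

theorem IsChart.eventually_hess_eq_zero (h : IsChart r g E φ ψ f) :
    ∀ᶠ u in 𝓝 g, IsParabolic r u → hess f (φ u) = 0 := by
  filter_upwards [h.eventually_hessian, h.eventually_jac_ne] with u hu hJ hp
  have := hu.symm.trans hp.1
  exact (mul_eq_zero.1 this).resolve_left
    (mul_ne_zero (pow_ne_zero _ h.det_ne) (pow_ne_zero _ hJ))

theorem IsChart.eventually_isBitangent (h : IsChart r g E φ ψ f) (hf : IsNormalForm f lam) :
    ∀ᶠ z in 𝓝 (g, g), z.1 ≠ z.2 → tangentPlane r z.1 = tangentPlane r z.2 →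
      IsBitangent f (φ z.1) (φ z.2) ∧ (φ z.1).1 ≠ (φ z.2).1 := by
  obtain ⟨_, -, -, -, -, -, ε, hε, hE⟩ := hf.exists_bitangent_equations
  have hall := ((h.eventually_eq_graph.and h.eventually_jac_ne).and h.left_inv).and
    (h.tendsto_chart (Metric.ball_mem_nhds 0 hε))
  have e1 := (continuous_fst.tendsto ((g, g) : (ℝ × ℝ) × (ℝ × ℝ))).eventually hall
  have e2 := (continuous_snd.tendsto ((g, g) : (ℝ × ℝ) × (ℝ × ℝ))).eventually hall
  filter_upwards [e1, e2] with z ⟨⟨⟨g1, j1⟩, i1⟩, b1⟩ ⟨⟨⟨g2, j2⟩, i2⟩, b2⟩ hne htp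
  rw [tangentPlane_congr g1, tangentPlane_congr g2] at htp
  have hb := isBitangent_of_tangentPlane_eq h.smooth_chart h.smooth_fun h.det_ne j1 j2
    (fun heq => hne (by rw [← i1, heq, i2])) htp
  exact ⟨hb, (hE _ b1 _ b2 hb).1⟩

/-- The coefficient is tested on contact points that accumulate at g: genuine contact points belong
to the conodal set, so near g they lie on γ and inherit its limit c. -/
theorem IsChart.conodal_coeff (h : IsChart r g E φ ψ f) (hf : IsNormalForm f lam)
    {Ω : Set (ℝ × ℝ)} (hΩ : Ω ∈ 𝓝 g) {γ : ℝ → ℝ × ℝ} {c : ℝ}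
    (hγ : ∀ᶠ ε in 𝓝[>] (0 : ℝ), IsCurveGerm (conodalSet r (Ω ∩ Metric.ball g ε)) g γ)
    (hc : Tendsto (fun t => (φ (γ t)).2 / (φ (γ t)).1 ^ 2) (𝓝[≠] 0) (𝓝 c)) : c = lam := by
  -- Of the two contact points the one with the larger |x| comes first, so that its abscissa
  -- dominates all error terms.
  set T : Set ((ℝ × ℝ) × (ℝ × ℝ)) := {z | z.1 ≠ z.2 ∧ tangentPlane r z.1 = tangentPlane r z.2 ∧
    |(φ z.2).1| ≤ |(φ z.1).1|} with hT
  set l : Filter ((ℝ × ℝ) × (ℝ × ℝ)) := 𝓝 (g, g) ⊓ 𝓟 T with hl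
  have hle : l ≤ 𝓝 (g, g) := inf_le_left
  have hmem : ∀ᶠ z in l, z ∈ T := mem_inf_of_right (mem_principal_self T)
  -- Since g lies in the closure for arbitrarily small balls, contact pairs exist arbitrarily close
  -- to (g, g).
  have hNB : l.NeBot := by
    rw [hl, inf_principal_neBot_iff]
    intro U hU
    obtain ⟨η, hη, hball⟩ := Metric.mem_nhds_iff.1 hU
    obtain ⟨ε, hε, hε0⟩ := (hγ.and (Ioo_mem_nhdsGT hη)).exists
    have hg : g ∈ conodalSet r (Ω ∩ Metric.ball g ε) := by
      have := hε.eventually_mem.self_of_nhds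
      rwa [hε.1.2.1] at this
    obtain ⟨u, ⟨-, hu⟩, v, ⟨-, hv⟩, hne, htp⟩ := closure_nonempty_iff.1 ⟨g, hg⟩
    have hin : ∀ {a b : ℝ × ℝ}, a ∈ Metric.ball g ε → b ∈ Metric.ball g ε → (a, b) ∈ U := by
      intro a b ha hb
      apply hball
      rw [Metric.mem_ball] at ha hb ⊢
      rw [Prod.dist_eq]
      exact max_lt (ha.trans hε0.2) (hb.trans hε0.2)
    rcases le_total |(φ v).1| |(φ u).1| with hcmp | hcmp
    · exact ⟨(u, v), hin hu hv, hne.symm, htp, hcmp⟩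
    · exact ⟨(v, u), hin hv hu, hne, htp.symm, hcmp⟩
  have t1 : Tendsto (fun z : (ℝ × ℝ) × (ℝ × ℝ) => z.1) l (𝓝 g) :=
    (continuous_fst.tendsto (g, g)).mono_left hle
  have t2 : Tendsto (fun z : (ℝ × ℝ) × (ℝ × ℝ) => z.2) l (𝓝 g) :=
    (continuous_snd.tendsto (g, g)).mono_left hle
  have hb : ∀ᶠ z in l, IsBitangent f (φ z.1) (φ z.2) ∧ (φ z.1).1 ≠ (φ z.2).1 := by
    filter_upwards [hle (h.eventually_isBitangent hf), hmem] with z hz hm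
    exact hz hm.1 hm.2.1
  refine hf.conodal_coeff (h.tendsto_chart.comp t1) (h.tendsto_chart.comp t2)
    (hb.mono fun _ hz => hz.1) (hmem.mono fun _ hz => hz.2.2) ?_
  rw [tendsto_def] at hc ⊢
  intro N hN
  obtain ⟨δ₀, hδ₀, hN'⟩ := Metric.mem_nhdsWithin_iff.1 (hc N hN)
  obtain ⟨ε, hε, hε0⟩ := (hγ.and self_mem_nhdsWithin).exists
  obtain ⟨δ, hδ, hδ0⟩ := (hε.2.and (Ioo_mem_nhdsGT hδ₀)).exists
  have hΩε : Ω ∩ Metric.ball g ε ∈ 𝓝 g := inter_mem hΩ (Metric.ball_mem_nhds g hε0)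
  filter_upwards [t1 hΩε, t2 hΩε, t1.eventually hδ.mem_iff, hmem, hb] with z h1 h2 h3 h4 h5
  obtain ⟨t, ht, htz⟩ := h3.1 (subset_closure ⟨h1, z.2, h2, h4.1.symm, h4.2.1⟩)
  -- The point g itself is excluded: by the ordering both abscissas would be 0, but contact points
  -- have distinct abscissas.
  have ht0 : t ≠ 0 := by
    rintro rfl
    rw [hε.1.2.1] at htz
    have e1 : (φ z.1).1 = 0 := by rw [← htz, h.chart_base]; rfl
    have e2 : (φ z.2).1 = 0 := by
      have := h4.2.2
      rw [e1, abs_zero] at this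
      exact abs_nonpos_iff.1 this
    exact h5.2 (e1.trans e2.symm)
  have ht' : t ∈ Metric.ball (0 : ℝ) δ₀ ∩ {0}ᶜ := by
    refine ⟨?_, ht0⟩
    rw [mem_ball_zero_iff, Real.norm_eq_abs]
    exact (abs_lt.2 ht).trans hδ0.2
  have := hN' ht'
  simp only [mem_preimage] at this ⊢
  rwa [htz] at this

/-- In the normal form the coefficient of `x⁴ / 2` is the cr-invariant. -/
theorem IsChart.crInvariant_eq (h : IsChart r g E φ ψ f) (hf : IsNormalForm f lam)
    {Ω : Set (ℝ × ℝ)} (hΩ : Ω ∈ 𝓝 g) {ρ : ℝ} (hρ : IsCrInvariant r Ω g ρ) :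
    ρ = lam ∧ lam ≠ 1 ∧ ∃ᶠ u in 𝓝[≠] g, IsParabolic r u := by
  obtain ⟨γF, γP, γD, hF, hP, hD, a, b, hab, haF, haP, haD, hcr⟩ := hρ
  obtain ⟨ε, hDε⟩ := hD.exists
  have aF := hF.1
  have aP := hP.1
  have aD := hDε.1
  have hi := h.fderiv_inv_apply.self_of_nhds
  have hc := h.fderiv_chart_apply.self_of_nhds
  rw [h.chart_base] at hi
  rw [h.inv_zero] at hc
  set v := fderiv ℝ ψ 0 (1, 0) with hvdef
  have hφv : fderiv ℝ φ g v = (1, 0) := hc _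
  have hv0 : v ≠ 0 := by
    intro h0
    rw [h0, map_zero] at hφv
    simpa using congrArg Prod.fst hφv
  -- the parabolic curve is tangent to the asymptotic direction
  have hPt : (fderiv ℝ φ g (deriv γP 0)).2 = 0 := by
    obtain ⟨c, sc, hcγ, h1, -⟩ := aP.exists_smooth
    have hc0 : c 0 = g := hcγ.eq_of_nhds.trans aP.2.1
    have sH : ContDiff ℝ ∞ fun u => hess f (φ u) := (contDiff_hess hf.smooth).comp h.smooth_chart
    have d := hasDerivAt_comp_curve sH (hasDerivAt_deriv sc 0).1
    rw [← fderiv_eq_dx_dy (fun u => hess f (φ u)),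
      fderiv_comp_plane (contDiff_hess hf.smooth) h.smooth_chart, hc0, h.chart_base,
      hf.dx_hess_zero, hf.dy_hess_zero, h1] at d
    have hz : (fun t => hess f (φ (c t))) =ᶠ[𝓝 0] fun _ => 0 := by
      filter_upwards [hcγ, hP.eventually_mem, aP.tendsto.eventually h.eventually_hess_eq_zero]
        with t ht hm hh
      rw [ht]
      exact hh hm.2
    have := d.deriv.symm.trans (hz.deriv_eq.trans (deriv_const 0 0))
    linarith
  have hPv : ∃ μ : ℝ, deriv γP 0 = μ • v := by
    refine ⟨(fderiv ℝ φ g (deriv γP 0)).1, ?_⟩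
    have e : fderiv ℝ φ g (deriv γP 0) = (fderiv ℝ φ g (deriv γP 0)).1 • ((1 : ℝ), (0 : ℝ)) := by
      ext
      · simp
      · simpa using hPt
    conv_lhs => rw [← hi (deriv γP 0), e, map_smul]
  obtain ⟨μP, hμP⟩ := hPv
  have hne : ∀ {γ : ℝ → ℝ × ℝ} {μ : ℝ}, IsArcAt γ g → deriv γ 0 = μ • v → μ ≠ 0 := by
    rintro γ μ hγ hμ rfl
    exact hγ.2.2 (by rw [hμ, zero_smul])
  have hμP0 := hne aP hμP
  have hav : area a v = 0 := by
    rw [hμP] at haP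
    have : μP * area a v = 0 := by
      rw [← haP]
      simp only [area, Prod.smul_fst, Prod.smul_snd, smul_eq_mul]
      ring
    exact (mul_eq_zero.1 this).resolve_left hμP0
  have hvb : area v b ≠ 0 := by
    intro h0
    apply hv0
    simp only [area] at hav h0 hab
    ext
    · have : v.1 * (a.1 * b.2 - a.2 * b.1) = 0 := by linear_combination b.1 * hav + a.1 * h0
      exact (mul_eq_zero.1 this).resolve_right hab
    · have : v.2 * (a.1 * b.2 - a.2 * b.1) = 0 := by linear_combination b.2 * hav + a.2 * h0
      exact (mul_eq_zero.1 this).resolve_right hab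
  have hmult : ∀ w, area a w = 0 → ∃ μ : ℝ, w = μ • v := by
    intro w hw
    refine ⟨area w b / area v b, ?_⟩
    simp only [area] at hav hw hvb hab ⊢
    have hwv : w.1 * v.2 - w.2 * v.1 = 0 := by
      refine (mul_eq_zero.1 (?_ : _ * (a.1 * b.2 - a.2 * b.1) = 0)).resolve_right hab
      linear_combination (b.1 * v.2 - b.2 * v.1) * hw - (b.1 * w.2 - b.2 * w.1) * hav
    ext
    · rw [Prod.smul_fst, smul_eq_mul, div_mul_eq_mul_div, eq_div_iff hvb]
      linear_combination -b.1 * hwv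
    · rw [Prod.smul_snd, smul_eq_mul, div_mul_eq_mul_div, eq_div_iff hvb]
      linear_combination -b.2 * hwv
  obtain ⟨μF, hμF⟩ := hmult _ haF
  obtain ⟨μD, hμD⟩ := hmult _ haD
  have hμF0 := hne aF hμF
  have hμD0 := hne aD hμD
  have hlift : ∀ {γ : ℝ → ℝ × ℝ} {μ : ℝ}, IsArcAt γ g → area a (deriv γ 0) = 0 →
      deriv γ 0 = μ • v → deriv (legendrianLift a b γ) 0 =
        (μ • v, area a (deriv (deriv γ) 0) / (μ * area v b)) := by
    intro γ μ hγ ha hμ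
    have e : area (μ • v) b = μ * area v b := by
      simp only [area, Prod.smul_fst, Prod.smul_snd, smul_eq_mul]
      ring
    rw [deriv_legendrianLift hγ ha (by rw [hμ, e]; exact mul_ne_zero (hne hγ hμ) hvb), hμ, e]
  rw [hlift aF haF hμF, hlift aP haP hμP, hlift aD haD hμD, deriv_fibreLift] at hcr
  obtain ⟨hneq, heq⟩ := hcr.eq_div hv0 hμF0 hμP0 hμD0 hvb
  -- the coefficients of the three curves in the chart
  obtain ⟨xF, nF, cF⟩ := h.tendsto_arc aF hφv hμF hμF0
  obtain ⟨xP, nP, cP⟩ := h.tendsto_arc aP hφv hμP hμP0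
  obtain ⟨-, -, cD⟩ := h.tendsto_arc aD hφv hμD hμD0
  have kF := hf.flecnodal_coeff xF nF cF (by
    filter_upwards [nhdsWithin_le_nhds hF.eventually_mem,
      nhdsWithin_le_nhds (aF.tendsto.eventually (h.eventually_flecnodal Ω))] with t h1 h2
    exact h2 h1)
  have kP := hf.parabolic_coeff xP nP cP (by
    filter_upwards [nhdsWithin_le_nhds hP.eventually_mem,
      nhdsWithin_le_nhds (aP.tendsto.eventually h.eventually_hess_eq_zero)] with t h1 h2
    exact h2 h1.2)
  have kD := h.conodal_coeff hf hΩ hD cD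
  -- The second chart coordinate of dφ kills v, as does area a, so the two functionals are
  -- proportional with ratio C.
  set C := (fderiv ℝ φ g b).2 / area a b with hC
  have hdY : ∀ w, (fderiv ℝ φ g w).2 = C * area a w := by
    intro w
    have h1 := area_map (fderiv ℝ φ g) v w
    have h2 := area_map (fderiv ℝ φ g) v b
    rw [hφv] at h1 h2
    simp only [area, one_mul, zero_mul, sub_zero] at h1 h2 hav hab hC ⊢
    rw [hC, div_mul_eq_mul_div, eq_div_iff hab, h1, h2]
    linear_combination -((fderiv ℝ φ g (1, 0)).1 * (fderiv ℝ φ g (0, 1)).2 -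
      (fderiv ℝ φ g (1, 0)).2 * (fderiv ℝ φ g (0, 1)).1) * (w.1 * b.2 - w.2 * b.1) * hav
  simp only [hdY] at kF kP kD
  -- The second derivative of the chart along v enters all three coefficients equally and cancels in
  -- differences.
  have e1 : C * (area a (deriv (deriv γP) 0) / μP ^ 2 - area a (deriv (deriv γD) 0) / μD ^ 2) =
      4 * (lam - 1) := by
    linear_combination 2 * kP - 2 * kD
  have e2 : C * (area a (deriv (deriv γF) 0) / μF ^ 2 - area a (deriv (deriv γD) 0) / μD ^ 2) =
      4 * lam * (lam - 1) := by
    linear_combination 2 * kF - 2 * kD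
  have hC0 : C ≠ 0 := by
    intro h0
    have h1 := area_map (fderiv ℝ φ g) v b
    rw [hφv] at h1
    have h2 := hdY b
    rw [h0, zero_mul] at h2
    rw [show area (1, 0) (fderiv ℝ φ g b) = 0 by simp [area, h2]] at h1
    exact mul_ne_zero h.jac_ne hvb h1.symm
  -- The cross-ratio is defined only if the parabolic and conodal lines differ.
  have hlam : lam - 1 ≠ 0 := by
    intro h0
    rw [h0, mul_zero] at e1
    exact mul_ne_zero hC0 hneq e1
  refine ⟨?_, fun h1 => hlam (by rw [h1, sub_self]), ?_⟩
  · refine mul_right_cancel₀ (mul_ne_zero four_ne_zero hlam) ?_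
    linear_combination e2 - ρ * e1 + C * heq
  · have ht : Tendsto γP (𝓝[≠] 0) (𝓝[≠] g) := by
      refine tendsto_nhdsWithin_iff.2 ⟨aP.tendsto.mono_left nhdsWithin_le_nhds, ?_⟩
      filter_upwards [nP] with t ht heq
      apply ht
      rw [show γP t = g from heq, h.chart_base]
      rfl
    refine ht.frequently (Eventually.frequently ?_)
    have hm : ∀ᶠ t in 𝓝[≠] (0 : ℝ), γP t ∈ parabolicSet r Ω := nhdsWithin_le_nhds hP.eventually_mem
    exact hm.mono fun _ ht => ht.2

end Chart

/-! ### The contour and the sign of a godron -/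

theorem eventually_forall_mem_Ioo {P : ℝ → Prop} (h : ∀ᶠ t in 𝓝 0, P t) :
    ∀ᶠ δ in 𝓝[>] (0 : ℝ), ∀ t ∈ Ioo (-δ) δ, P t := by
  obtain ⟨ε, hε, h⟩ := Metric.eventually_nhds_iff.1 h
  filter_upwards [Ioo_mem_nhdsGT hε] with δ hδ t ht
  refine h ?_
  rw [Real.dist_eq, sub_zero]
  exact (abs_lt.2 ht).trans hδ.2

namespace IsChart

variable {r : ℝ × ℝ → Fin 3 → ℝ} {g : ℝ × ℝ} {E : Matrix (Fin 3) (Fin 3) ℝ}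
  {φ ψ : ℝ × ℝ → ℝ × ℝ} {f : ℝ × ℝ → ℝ} {lam : ℝ}

theorem inv_deriv_ne_zero (h : IsChart r g E φ ψ f) : fderiv ℝ ψ 0 (1, 0) ≠ 0 := by
  intro h0
  have := h.fderiv_chart_apply.self_of_nhds (1, 0)
  rw [h0, map_zero] at this
  exact zero_ne_one (congrArg Prod.fst this)

section Contour

theorem eventually_mem_contour_iff (h : IsChart r g E φ ψ f) (hf : IsNormalForm f lam)
    {Ω : Set (ℝ × ℝ)} (hΩ : Ω ∈ 𝓝 g) :
    ∀ᶠ u in 𝓝 g, u ∈ contour r Ω g ↔ tangentHeight f (φ u) = 0 := by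
  filter_upwards [hΩ, h.eventually_eq_graph, h.eventually_jac_ne] with u hu hg hJ
  have h0 : r g = graphMap (r g) E φ f g := h.eq_graph.self_of_nhds
  have h1 : u ∈ contour r Ω g ↔
      graphMap (r g) E φ f g ∈ tangentPlane (graphMap (r g) E φ f) u := by
    rw [← h0, ← tangentPlane_congr hg]
    exact and_iff_right hu
  rw [h1, mem_tangentPlane_graphMap h.smooth_chart h.smooth_fun h.det_ne hJ, h.chart_base, hf.zero,
    tangentHeight]
  simp only [Prod.fst_zero, Prod.snd_zero]
  constructor <;> intro h <;> linarith

theorem exists_nhds_notMem_contour (h : IsChart r g E φ ψ f) (hf : IsNormalForm f lam)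
    {Ω : Set (ℝ × ℝ)} (hΩ : Ω ∈ 𝓝 g) (hlam : 4 / 3 < lam) :
    ∃ U ∈ 𝓝 g, ∀ u ∈ U, u ≠ g → u ∉ contour r Ω g := by
  have : ∀ᶠ u in 𝓝 g, u ≠ g → u ∉ contour r Ω g := by
    filter_upwards [h.eventually_mem_contour_iff hf hΩ, h.left_inv,
      h.tendsto_chart.eventually (hf.eventually_tangentHeight_ne hlam)] with u h1 h2 h3 hne hu
    refine h3 (fun h0 => hne ?_) (h1.1 hu)
    rw [← h2, h0, h.inv_zero]
  exact ⟨_, this, fun u hu => hu⟩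

variable {y : ℝ → ℝ} {c : ℝ}

theorem tendsto_graph (hy : ContDiff ℝ ∞ y) (h0 : y 0 = 0) :
    Tendsto (fun t => (t, y t)) (𝓝 0) (𝓝 0) := by
  have : Continuous fun t => (t, y t) := continuous_id.prodMk hy.continuous
  have := this.tendsto 0
  rwa [h0] at this

theorem hasDerivAt_inv_graph (h : IsChart r g E φ ψ f) (hy : ContDiff ℝ ∞ y) (h0 : y 0 = 0)
    (hc : Tendsto (fun x => y x / x ^ 2) (𝓝[≠] 0) (𝓝 c)) :
    HasDerivAt (fun t => ψ (t, y t)) (fderiv ℝ ψ 0 (1, 0)) 0 := by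
  have h1 : deriv y 0 = 0 := deriv_eq_zero_of_tendsto_div hy h0 (tendsto_div_of_tendsto_div_sq hc)
  have h2 : HasDerivAt y 0 0 := by
    have := (hy.differentiable (by simp) 0).hasDerivAt
    rwa [h1] at this
  have h3 := (hasDerivAt_id (0 : ℝ)).prodMk h2
  have h4 := hasFDerivAt_of_contDiff h.smooth_inv (0, y 0)
  have h5 := HasFDerivAt.comp_hasDerivAt (0 : ℝ) h4 h3
  rw [h0] at h5
  exact h5

theorem isArcAt_inv_graph (h : IsChart r g E φ ψ f) (hy : ContDiff ℝ ∞ y) (h0 : y 0 = 0)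
    (hc : Tendsto (fun x => y x / x ^ 2) (𝓝[≠] 0) (𝓝 c)) : IsArcAt (fun t => ψ (t, y t)) g := by
  refine ⟨Eventually.of_forall fun t => ?_, ?_, ?_⟩
  · exact (h.smooth_inv.comp (contDiff_id.prodMk hy)).contDiffAt
  · simpa only [h0, Prod.mk_zero_zero] using h.inv_zero
  · rw [(h.hasDerivAt_inv_graph hy h0 hc).deriv]
    exact h.inv_deriv_ne_zero

theorem fderiv_hessian_inv_graph (h : IsChart r g E φ ψ f) (hf : IsNormalForm f lam)
    (hy : ContDiff ℝ ∞ y) (h0 : y 0 = 0)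
    (hc : Tendsto (fun x => y x / x ^ 2) (𝓝[≠] 0) (𝓝 c)) :
    fderiv ℝ (hessian r) g (deriv (fun t => ψ (t, y t)) 0) = 0 := by
  have hD := h.eventually_fderiv_hessian.self_of_nhds
  have hi := h.fderiv_chart_apply.self_of_nhds (1, 0)
  rw [h.inv_zero] at hi
  rw [h.chart_base] at hD
  rw [hD hf.hess_zero, (h.hasDerivAt_inv_graph hy h0 hc).deriv, hi]
  exact mul_eq_zero_of_right _ hf.dx_hess_zero

theorem eventually_hessian_inv_graph (h : IsChart r g E φ ψ f) (hy : ContDiff ℝ ∞ y)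
    (h0 : y 0 = 0) :
    ∀ᶠ t in 𝓝[≠] (0 : ℝ), ∃ k > 0, hessian r (ψ (t, y t)) = k * hess f (t, y t) := by
  have hT : Tendsto (fun t => (t, y t)) (𝓝[≠] 0) (𝓝 0) :=
    tendsto_nhdsWithin_of_tendsto_nhds (tendsto_graph hy h0)
  have hT' := h.tendsto_inv.comp hT
  filter_upwards [hT'.eventually h.eventually_hessian, hT'.eventually h.eventually_jac_ne,
    hT.eventually h.right_inv] with t h1 h2 h3
  simp only [Function.comp] at h1 h2
  rw [h3] at h1
  refine ⟨_, ?_, h1⟩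
  have := h.det_ne
  positivity

theorem eventually_isHyperbolic (h : IsChart r g E φ ψ f) (hf : IsNormalForm f lam)
    (hy : ContDiff ℝ ∞ y) (h0 : y 0 = 0)
    (hc : Tendsto (fun x => y x / x ^ 2) (𝓝[≠] 0) (𝓝 c)) (hlt : 3 * lam - 2 < c) :
    ∀ᶠ t in 𝓝[≠] (0 : ℝ), IsHyperbolic r (ψ (t, y t)) := by
  filter_upwards [h.eventually_hessian_inv_graph hy h0,
    (hf.tendsto_hess tendsto_id_nhdsNE self_mem_nhdsWithin hc).eventually_lt_const
      (show -2 * (c - (3 * lam - 2)) < 0 by linarith), self_mem_nhdsWithin] with t ⟨k, hk, e⟩ h1 ht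
  have ht : t ≠ 0 := ht
  rw [IsHyperbolic, e]
  refine mul_neg_of_pos_of_neg hk ?_
  by_contra! hle
  exact h1.not_ge (div_nonneg hle (sq_nonneg t))

theorem eventually_isElliptic (h : IsChart r g E φ ψ f) (hf : IsNormalForm f lam)
    (hy : ContDiff ℝ ∞ y) (h0 : y 0 = 0)
    (hc : Tendsto (fun x => y x / x ^ 2) (𝓝[≠] 0) (𝓝 c)) (hlt : c < 3 * lam - 2) :
    ∀ᶠ t in 𝓝[≠] (0 : ℝ), IsElliptic r (ψ (t, y t)) := by
  filter_upwards [h.eventually_hessian_inv_graph hy h0,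
    (hf.tendsto_hess tendsto_id_nhdsNE self_mem_nhdsWithin hc).eventually_const_lt
      (show 0 < -2 * (c - (3 * lam - 2)) by linarith), self_mem_nhdsWithin] with t ⟨k, hk, e⟩ h1 ht
  have ht : t ≠ 0 := ht
  rw [IsElliptic, e]
  refine mul_pos hk ?_
  by_contra! hle
  exact h1.not_ge (div_nonpos_of_nonpos_of_nonneg hle (sq_nonneg t))

theorem eventually_chart_inv_graph (h : IsChart r g E φ ψ f) (hy : ContDiff ℝ ∞ y) (h0 : y 0 = 0) :
    ∀ᶠ t in 𝓝 0, φ (ψ (t, y t)) = (t, y t) :=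
  (tendsto_graph hy h0).eventually h.right_inv

variable {y₁ y₂ : ℝ → ℝ}

theorem contour_eventuallyEq (h : IsChart r g E φ ψ f) (hf : IsNormalForm f lam)
    {Ω : Set (ℝ × ℝ)} (hΩ : Ω ∈ 𝓝 g) (hy₁ : ContDiff ℝ ∞ y₁) (hy₂ : ContDiff ℝ ∞ y₂)
    (h₁ : y₁ 0 = 0) (h₂ : y₂ 0 = 0)
    (hiff : ∀ᶠ p in 𝓝 0, tangentHeight f p = 0 ↔ p.2 = y₁ p.1 ∨ p.2 = y₂ p.1) :
    ∀ᶠ δ in 𝓝[>] (0 : ℝ), contour r Ω g =ᶠ[𝓝 g]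
      ((fun t => ψ (t, y₁ t)) '' Ioo (-δ) δ ∪ (fun t => ψ (t, y₂ t)) '' Ioo (-δ) δ :
        Set (ℝ × ℝ)) := by
  filter_upwards [eventually_forall_mem_Ioo (h.eventually_chart_inv_graph hy₁ h₁),
    eventually_forall_mem_Ioo (h.eventually_chart_inv_graph hy₂ h₂), self_mem_nhdsWithin]
    with δ hδ₁ hδ₂ hδ
  have hδ : 0 < δ := hδ
  have hfst : Tendsto (fun u => (φ u).1) (𝓝 g) (𝓝 0) :=
    (continuous_fst.tendsto (0 : ℝ × ℝ)).comp h.tendsto_chart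
  refine eventuallyEq_set.2 ?_
  filter_upwards [h.eventually_mem_contour_iff hf hΩ, h.tendsto_chart.eventually hiff, h.left_inv,
    hfst.eventually (Ioo_mem_nhds (neg_lt_zero.2 hδ) hδ)] with u e1 e2 e3 e4
  rw [e1, e2]
  -- On these arcs the curve parameter is the first chart coordinate, so membership in the image
  -- reduces to the equation of the graph.
  have key : ∀ {y : ℝ → ℝ}, (∀ t ∈ Ioo (-δ) δ, φ (ψ (t, y t)) = (t, y t)) →
      ((φ u).2 = y (φ u).1 ↔ u ∈ (fun t => ψ (t, y t)) '' Ioo (-δ) δ) := by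
    intro y hy
    constructor
    · intro hu
      refine ⟨(φ u).1, e4, ?_⟩
      change ψ ((φ u).1, y (φ u).1) = u
      rw [← hu]
      exact e3
    · rintro ⟨t, ht, rfl⟩
      simp only [hy t ht]
  rw [key hδ₁, key hδ₂]
  rfl

theorem inter_eq_singleton (h : IsChart r g E φ ψ f) (hy₁ : ContDiff ℝ ∞ y₁)
    (hy₂ : ContDiff ℝ ∞ y₂) (h₁ : y₁ 0 = 0) (h₂ : y₂ 0 = 0)
    (hne : ∀ᶠ t in 𝓝[≠] 0, y₁ t ≠ y₂ t) :
    ∀ᶠ δ in 𝓝[>] (0 : ℝ), (fun t => ψ (t, y₁ t)) '' Ioo (-δ) δ ∩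
      (fun t => ψ (t, y₂ t)) '' Ioo (-δ) δ = {g} := by
  filter_upwards [eventually_forall_mem_Ioo (h.eventually_chart_inv_graph hy₁ h₁),
    eventually_forall_mem_Ioo (h.eventually_chart_inv_graph hy₂ h₂),
    eventually_forall_mem_Ioo (eventually_nhdsWithin_iff.1 hne), self_mem_nhdsWithin]
    with δ hδ₁ hδ₂ hδne hδ
  have hδ : 0 < δ := hδ
  have h0 : (0 : ℝ) ∈ Ioo (-δ) δ := ⟨neg_lt_zero.2 hδ, hδ⟩
  refine Subset.antisymm ?_ ?_
  · rintro u ⟨⟨t, ht, rfl⟩, s, hs, e⟩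
    have e' := congrArg φ e
    simp only [hδ₁ t ht, hδ₂ s hs, Prod.mk.injEq] at e'
    obtain ⟨rfl, e2⟩ := e'
    have hs0 : s = 0 := by
      by_contra hs0
      exact hδne s hs hs0 e2.symm
    simp only [hs0, h₁, mem_singleton_iff]
    exact h.inv_zero
  · rintro u rfl
    refine ⟨⟨0, h0, ?_⟩, 0, h0, ?_⟩
    · simpa only [h₁, Prod.mk_zero_zero] using h.inv_zero
    · simpa only [h₂, Prod.mk_zero_zero] using h.inv_zero

end Contour

/-- The asymptotic directions along which the determinant of the second form decreases, at the
parabolic points next to the godron. -/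
theorem eventually_asymptotic (h : IsChart r g E φ ψ f) (hf : IsNormalForm f lam)
    (hlam : lam ≠ 1) : ∀ᶠ u in 𝓝[≠] g, IsParabolic r u →
      (∃ v, IsAsymptotic r u v ∧ fderiv ℝ (hessian r) u v < 0) ∧
      ∀ v, IsAsymptotic r u v → fderiv ℝ (hessian r) u v < 0 →
        0 < (lam - 1) * (v.1 * (g.1 - u.1) + v.2 * (g.2 - u.2)) := by
  refine (eventually_inf_principal (s := {u | IsParabolic r u})).1 ?_
  set l := 𝓝[≠] g ⊓ 𝓟 {u | IsParabolic r u} with hl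
  have hlg : l ≤ 𝓝 g := inf_le_left.trans nhdsWithin_le_nhds
  have hpar : ∀ᶠ u in l, IsParabolic r u := mem_inf_of_right (mem_principal_self _)
  have hne : ∀ᶠ u in l, u ≠ g := mem_inf_of_left self_mem_nhdsWithin
  have hp : Tendsto (fun u => ((φ u).1, (φ u).2)) l (𝓝 0) := h.tendsto_chart.mono_left hlg
  have hz : ∀ᶠ u in l, hess f ((φ u).1, (φ u).2) = 0 := by
    filter_upwards [hpar, hlg h.eventually_hess_eq_zero] with u h1 h2 using h2 h1
  have hp0 : ∀ᶠ u in l, ((φ u).1, (φ u).2) ≠ 0 := by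
    filter_upwards [hne, hlg h.left_inv] with u h1 h2 h3
    apply h1
    rw [← h2, show φ u = 0 from h3, h.inv_zero]
  obtain ⟨hx0, ⟨c, hy⟩, hm, hD⟩ := hf.tendsto_dhess_asymptotic hp hp0 hz
  have hx : Tendsto (fun u => (φ u).1) l (𝓝 0) := (continuous_fst.tendsto (0 : ℝ × ℝ)).comp hp
  set m : ℝ × ℝ → ℝ := fun u => -dx (dy f) (φ u) / dy (dy f) (φ u) with hmdef
  set D : ℝ × ℝ → ℝ := fun u => dx (hess f) (φ u) + m u * dy (hess f) (φ u) with hDdef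
  -- The asymptotic vector at a parabolic point, pulled back from the chart; D is the derivative of
  -- the chart Hessian along it.
  set e : ℝ × ℝ → ℝ × ℝ := fun u => fderiv ℝ ψ (φ u) (1, m u) with hedef
  have hm : Tendsto m l (𝓝 0) := hm
  have hD : Tendsto (fun u => D u / (φ u).1) l (𝓝 (12 * (lam - 1))) := hD
  set v₀ := fderiv ℝ ψ 0 (1, 0) with hv₀
  have he : Tendsto e l (𝓝 v₀) := by
    have s : ContDiff ℝ ∞ (fderiv ℝ ψ) := h.smooth_inv.fderiv_right (by simp)
    have h1 : Tendsto (fun u => fderiv ℝ ψ (φ u)) l (𝓝 (fderiv ℝ ψ 0)) :=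
      (s.continuous.tendsto 0).comp hp
    have h2 : Tendsto (fun u => ((1 : ℝ), m u)) l (𝓝 (1, 0)) := tendsto_const_nhds.prodMk_nhds hm
    exact (isBoundedBilinearMap_apply.continuous.tendsto (fderiv ℝ ψ 0, ((1 : ℝ), (0 : ℝ)))).comp
      (h1.prodMk_nhds h2)
  have s1 : ContDiff ℝ ∞ fun p => (ψ p).1 - g.1 := h.smooth_inv.fst.sub contDiff_const
  have s2 : ContDiff ℝ ∞ fun p => (ψ p).2 - g.2 := h.smooth_inv.snd.sub contDiff_const
  have q1 : Tendsto (fun u => (u.1 - g.1) / (φ u).1) l (𝓝 v₀.1) := by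
    have h1 := tendsto_div s1 (by simp [h.inv_zero]) hx hx0 hy
    have h2 : dx (fun p => (ψ p).1 - g.1) 0 = v₀.1 := by
      rw [dx, fderiv_sub_const, fderiv_fst h.smooth_inv]
    rw [h2] at h1
    refine h1.congr' ?_
    filter_upwards [hlg h.left_inv] with u hu
    simp only [Prod.mk.eta, hu]
  have q2 : Tendsto (fun u => (u.2 - g.2) / (φ u).1) l (𝓝 v₀.2) := by
    have h1 := tendsto_div s2 (by simp [h.inv_zero]) hx hx0 hy
    have h2 : dx (fun p => (ψ p).2 - g.2) 0 = v₀.2 := by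
      rw [dx, fderiv_sub_const, fderiv_snd h.smooth_inv]
    rw [h2] at h1
    refine h1.congr' ?_
    filter_upwards [hlg h.left_inv] with u hu
    simp only [Prod.mk.eta, hu]
  have he1 : Tendsto (fun u => (e u).1) l (𝓝 v₀.1) := (continuous_fst.tendsto v₀).comp he
  have he2 : Tendsto (fun u => (e u).2) l (𝓝 v₀.2) := (continuous_snd.tendsto v₀).comp he
  -- Both D and u - g change sign with x, so their product over x² has a limit. Weighted by λ - 1
  -- this limit is 12(λ-1)²|v₀|² > 0.
  have hlim := (hD.const_mul (lam - 1)).mul ((he1.mul q1).add (he2.mul q2))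
  have hpos : 0 < (lam - 1) * (12 * (lam - 1)) * (v₀.1 * v₀.1 + v₀.2 * v₀.2) := by
    have h1 : 0 < (lam - 1) ^ 2 := by
      have := sub_ne_zero.2 hlam
      positivity
    have h2 : 0 < v₀.1 * v₀.1 + v₀.2 * v₀.2 := by
      by_contra! hle
      have h1 : v₀.1 = 0 := by nlinarith [mul_self_nonneg v₀.1, mul_self_nonneg v₀.2]
      have h2 : v₀.2 = 0 := by nlinarith [mul_self_nonneg v₀.1, mul_self_nonneg v₀.2]
      exact h.inv_deriv_ne_zero (Prod.ext h1 h2)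
    have := mul_pos h1 h2
    linarith
  have hyy : ∀ᶠ u in l, 0 < dy (dy f) (φ u) := hp.eventually hf.eventually_dy_dy_pos
  filter_upwards [hlim.eventually_const_lt hpos, hx0, hz, hyy, hlg h.eventually_jac_ne,
    hlg h.eventually_secondForm, hlg h.eventually_fderiv_hessian, hlg h.fderiv_inv_apply,
    hp.eventually h.fderiv_chart_apply, hlg h.left_inv] with u k1 k2 k3 k4 k5 k6 k7 k8 k9 k10
  have k3 : hess f (φ u) = 0 := k3
  have k9 : ∀ w, fderiv ℝ φ (ψ (φ u)) (fderiv ℝ ψ (φ u) w) = w := k9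
  rw [k10] at k9
  set d := (e u).1 * (u.1 - g.1) + (e u).2 * (u.2 - g.2) with hd
  have k1' : 0 < (lam - 1) * D u * d := by
    have e1 : (lam - 1) * (D u / (φ u).1) * ((e u).1 * ((u.1 - g.1) / (φ u).1) +
        (e u).2 * ((u.2 - g.2) / (φ u).1)) = (lam - 1) * D u * d / (φ u).1 ^ 2 := by
      rw [hd]
      field_simp
    rw [e1] at k1
    have := mul_pos k1 (show 0 < (φ u).1 ^ 2 by positivity)
    rwa [div_mul_cancel₀ _ (pow_ne_zero 2 k2)] at this
  have hK : 0 < E.det ^ 2 * jac φ u ^ 4 := by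
    have := h.det_ne
    positivity
  have hD0 : D u ≠ 0 := by
    intro h0
    rw [h0] at k1'
    simp at k1'
  have hder : ∀ a : ℝ, fderiv ℝ (hessian r) u (a • e u) =
      E.det ^ 2 * jac φ u ^ 4 * (a * D u) := by
    intro a
    rw [k7 k3, map_smul, k9, map_smul, fderiv_eq_dx_dy, smul_eq_mul, one_mul]
  constructor
  -- The coefficient -D makes the derivative a negative multiple of D².
  · have hneg : fderiv ℝ (hessian r) u (-D u • e u) < 0 := by
      rw [hder]
      refine mul_neg_of_pos_of_neg hK ?_
      have : 0 < D u ^ 2 := by positivity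
      linarith
    refine ⟨-D u • e u, ⟨fun h0 => ?_, ?_⟩, hneg⟩
    · rw [h0, map_zero] at hneg
      exact lt_irrefl _ hneg
    · rw [k6, bilForm_self, map_smul, k9, (quadForm_eq_zero_iff k3 k4.ne' _).2, mul_zero]
      simp [hmdef]
  · rintro v ⟨-, hv⟩ hlt
    rw [k6, bilForm_self] at hv
    have hq := (mul_eq_zero.1 hv).resolve_left (mul_ne_zero h.det_ne k5)
    rw [quadForm_eq_zero_iff k3 k4.ne'] at hq
    set a := (fderiv ℝ φ u v).1 with ha
    have hv : v = a • e u := by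
      rw [← k8 v, hedef]
      simp only
      rw [← map_smul]
      congr 1
      ext
      · simp [ha]
      · simp [hq, hmdef]
    rw [hv, hder] at hlt
    have h1 : a * D u < 0 := by
      by_contra! hle
      exact hlt.not_ge (mul_nonneg hK.le hle)
    have h2 : (a * D u) * ((lam - 1) * D u * d) < 0 := mul_neg_of_neg_of_pos h1 k1'
    have h3 : 0 < D u ^ 2 := by positivity
    have h4 : v.1 * (g.1 - u.1) + v.2 * (g.2 - u.2) = -(a * d) := by
      rw [hv, hd]
      simp only [Prod.smul_fst, Prod.smul_snd, smul_eq_mul]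
      ring
    rw [h4]
    by_contra! hle
    have : 0 ≤ D u ^ 2 * ((lam - 1) * (a * d)) := mul_nonneg h3.le (by linarith)
    linarith

/-- The frequency of parabolic points excludes vacuous positivity in the direct implication. -/
theorem isPositive_iff (h : IsChart r g E φ ψ f) (hf : IsNormalForm f lam) (hlam : lam ≠ 1)
    (hpar : ∃ᶠ u in 𝓝[≠] g, IsParabolic r u) : IsPositive r g ↔ 1 < lam := by
  have key := h.eventually_asymptotic hf hlam
  constructor
  · intro hpos
    obtain ⟨u, hu, h1, h2⟩ := (hpar.and_eventually (hpos.and key)).exists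
    obtain ⟨v, hv, hlt, ht⟩ := h1 hu
    have := (pos_iff_pos_of_mul_pos ((h2 hu).2 v hv hlt)).2 ht
    linarith
  · intro hlt
    filter_upwards [key] with u hu hp
    obtain ⟨⟨v, hv, hd⟩, h2⟩ := hu hp
    exact ⟨v, hv, hd, (pos_iff_pos_of_mul_pos (h2 v hv hd)).1 (by linarith)⟩

theorem isNegative_iff (h : IsChart r g E φ ψ f) (hf : IsNormalForm f lam) (hlam : lam ≠ 1)
    (hpar : ∃ᶠ u in 𝓝[≠] g, IsParabolic r u) : IsNegative r g ↔ lam < 1 := by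
  have key := h.eventually_asymptotic hf hlam
  have hneg : ∀ u v : ℝ × ℝ,
      PointsTowards g u (-v) ↔ v.1 * (g.1 - u.1) + v.2 * (g.2 - u.2) < 0 := by
    intro u v
    simp only [PointsTowards, Prod.fst_neg, Prod.snd_neg]
    constructor <;> intro h <;> linarith
  simp only [IsNegative, hneg]
  constructor
  · intro hpos
    obtain ⟨u, hu, h1, h2⟩ := (hpar.and_eventually (hpos.and key)).exists
    obtain ⟨v, hv, hlt, ht⟩ := h1 hu
    have := (neg_iff_neg_of_mul_pos ((h2 hu).2 v hv hlt)).2 ht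
    linarith
  · intro hlt
    filter_upwards [key] with u hu hp
    obtain ⟨⟨v, hv, hd⟩, h2⟩ := hu hp
    exact ⟨v, hv, hd, (neg_iff_neg_of_mul_pos (h2 v hv hd)).1 (by linarith)⟩

end IsChart

end Godron

theorem theorem15 (r : ℝ × ℝ → Fin 3 → ℝ) (Ω : Set (ℝ × ℝ)) (hΩ : IsOpen Ω)
    (hr : ContDiffOn ℝ ∞ r Ω) (himm : ∀ u ∈ Ω, Function.Injective (fderiv ℝ r u))
    (g : ℝ × ℝ) (hg : g ∈ Ω) (hgod : Godron.IsGodron r g)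
    (ρ : ℝ) (hρ : Godron.IsCrInvariant r Ω g ρ) :
    (ρ ≠ 4 / 3 →
      ((∃ U ∈ 𝓝 g, ∀ u ∈ U, u ≠ g → u ∉ Godron.contour r Ω g) ↔ 4 / 3 < ρ)) ∧
    (ρ < 4 / 3 → ρ ≠ 1 →
      (Godron.IsPositive r g ↔ 1 < ρ) ∧
      (Godron.IsNegative r g ↔ ρ < 1) ∧
      ∃ C₁ C₂ : ℝ → ℝ × ℝ,
        Godron.IsArcAt C₁ g ∧ Godron.IsArcAt C₂ g ∧
        fderiv ℝ (Godron.hessian r) g (deriv C₁ 0) = 0 ∧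
        fderiv ℝ (Godron.hessian r) g (deriv C₂ 0) = 0 ∧
        (∀ᶠ δ in 𝓝[>] (0 : ℝ),
          Godron.contour r Ω g =ᶠ[𝓝 g] (C₁ '' Ioo (-δ) δ ∪ C₂ '' Ioo (-δ) δ : Set (ℝ × ℝ))) ∧
        (∀ᶠ δ in 𝓝[>] (0 : ℝ), C₁ '' Ioo (-δ) δ ∩ C₂ '' Ioo (-δ) δ = {g}) ∧
        (Godron.IsPositive r g →
          (∀ᶠ t in 𝓝[≠] (0 : ℝ), Godron.IsElliptic r (C₁ t)) ∧
          (∀ᶠ t in 𝓝[≠] (0 : ℝ), Godron.IsHyperbolic r (C₂ t))) ∧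
        (Godron.IsNegative r g →
          (∀ᶠ t in 𝓝[≠] (0 : ℝ), Godron.IsHyperbolic r (C₁ t)) ∧
          (∀ᶠ t in 𝓝[≠] (0 : ℝ), Godron.IsHyperbolic r (C₂ t)))) := by
  have hΩg : Ω ∈ 𝓝 g := hΩ.mem_nhds hg
  have hr' : ∀ᶠ u in 𝓝 g, ContDiffAt ℝ ∞ r u := by
    filter_upwards [hΩg] with u hu using hr.contDiffAt (hΩ.mem_nhds hu)
  obtain ⟨E, φ, ψ, f, lam, h, hf⟩ := Godron.exists_normalForm_chart hr' (himm g hg) hgod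
  obtain ⟨rfl, hρ1, hpar⟩ := h.crInvariant_eq hf hΩg hρ
  have hlt : ρ < 4 / 3 → ∃ C₁ C₂ : ℝ → ℝ × ℝ,
      Godron.IsArcAt C₁ g ∧ Godron.IsArcAt C₂ g ∧
      fderiv ℝ (Godron.hessian r) g (deriv C₁ 0) = 0 ∧
      fderiv ℝ (Godron.hessian r) g (deriv C₂ 0) = 0 ∧
      (∀ᶠ δ in 𝓝[>] (0 : ℝ),
        Godron.contour r Ω g =ᶠ[𝓝 g] (C₁ '' Ioo (-δ) δ ∪ C₂ '' Ioo (-δ) δ : Set (ℝ × ℝ))) ∧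
      (∀ᶠ δ in 𝓝[>] (0 : ℝ), C₁ '' Ioo (-δ) δ ∩ C₂ '' Ioo (-δ) δ = {g}) ∧
      (1 < ρ → ∀ᶠ t in 𝓝[≠] (0 : ℝ), Godron.IsElliptic r (C₁ t)) ∧
      (ρ < 1 → ∀ᶠ t in 𝓝[≠] (0 : ℝ), Godron.IsHyperbolic r (C₁ t)) ∧
      ∀ᶠ t in 𝓝[≠] (0 : ℝ), Godron.IsHyperbolic r (C₂ t) := by
    intro hρlt
    obtain ⟨y₁, y₂, s₁, s₂, z₁, z₂, l₁, l₂, hiff⟩ := hf.exists_contour_curves hρlt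
    have hs : 0 < √(4 - 3 * ρ) := Real.sqrt_pos.2 (by linarith)
    have hs2 : √(4 - 3 * ρ) ^ 2 = 4 - 3 * ρ := Real.sq_sqrt (by linarith)
    generalize √(4 - 3 * ρ) = s at hs hs2 l₁ l₂
    have hne : ∀ᶠ t in 𝓝[≠] (0 : ℝ), y₁ t ≠ y₂ t := by
      filter_upwards [l₁.eventually_lt l₂ (by linarith)] with t ht heq
      rw [heq] at ht
      exact lt_irrefl _ ht
    refine ⟨fun t => ψ (t, y₁ t), fun t => ψ (t, y₂ t), h.isArcAt_inv_graph s₁ z₁ l₁,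
      h.isArcAt_inv_graph s₂ z₂ l₂, h.fderiv_hessian_inv_graph hf s₁ z₁ l₁,
      h.fderiv_hessian_inv_graph hf s₂ z₂ l₂, h.contour_eventuallyEq hf hΩg s₁ s₂ z₁ z₂ hiff,
      h.inter_eq_singleton s₁ s₂ z₁ z₂ hne, fun h1 => ?_, fun h1 => ?_, ?_⟩
    -- Here 3ρ - 2 = 2 - s², and 2 - s < 2 - s² because ρ > 1 means s < 1. The next case has s > 1,
    -- and 2 + s exceeds 2 - s² for every s > 0.
    · exact h.eventually_isElliptic hf s₁ z₁ l₁ (by nlinarith)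
    · exact h.eventually_isHyperbolic hf s₁ z₁ l₁ (by nlinarith)
    · exact h.eventually_isHyperbolic hf s₂ z₂ l₂ (by nlinarith)
  refine ⟨fun hne => ⟨?_, h.exists_nhds_notMem_contour hf hΩg⟩, fun hρlt _ => ?_⟩
  -- For ρ < 4/3 the arc C₁ consists of contour points and leaves g with nonzero velocity, so it
  -- meets every neighbourhood away from g.
  · rintro ⟨U, hU, hUc⟩
    by_contra hle
    obtain ⟨C₁, C₂, hC, -, -, -, hgerm, -, -⟩ := hlt (lt_of_le_of_ne (not_lt.1 hle) hne)
    obtain ⟨δ, hδ, hδ0⟩ := (hgerm.and self_mem_nhdsWithin).exists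
    have hδ0 : 0 < δ := hδ0
    have hT := hC.tendsto
    have hmem : ∀ᶠ t in 𝓝 0, C₁ t ∈ Godron.contour r Ω g := by
      filter_upwards [hT.eventually hδ.mem_iff, Ioo_mem_nhds (neg_lt_zero.2 hδ0) hδ0] with t ht hm
      exact ht.2 (Or.inl (mem_image_of_mem _ hm))
    have hCne : ∀ᶠ t in 𝓝[≠] (0 : ℝ), C₁ t ≠ g := by
      have hd := hC.1.self_of_nhds.differentiableAt (by simp)
      exact hd.hasDerivAt.eventually_ne hC.2.2
    obtain ⟨t, ht1, ht2, ht3⟩ := (hCne.and (nhdsWithin_le_nhds (hmem.and (hT hU)))).exists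
    exact hUc _ ht3 ht1 ht2
  · have hpos := h.isPositive_iff hf hρ1 hpar
    have hneg := h.isNegative_iff hf hρ1 hpar
    obtain ⟨C₁, C₂, h1, h2, h3, h4, h5, h6, h7, h8, h9⟩ := hlt hρlt
    exact ⟨hpos, hneg, C₁, C₂, h1, h2, h3, h4, h5, h6, fun hp => ⟨h7 (hpos.1 hp), h9⟩,
      fun hn => ⟨h8 (hneg.1 hn), h9⟩⟩
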